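/- **Setting.** Let $r_\star=\sqrt{2/\sqrt3}$ and let $A_2=\mathbb Z\sigma+\mathbb Z\tau\subset\mathbb R^2$, with $\sigma=r_\star(1,0)$ and $\tau=r_\star(\tfrac12,\tfrac{\sqrt3}{2})$, be the hexagonal lattice of covolume $1$. For $\alpha>0$ and a point configuration $X\subset\mathbb R^2$ let $$E_\alpha(X)=\liminf_{r\to\infty}\frac1{|X\cap B_r|}\sum_{x,y\in X\cap B_r,\ x\ne y}e^{-\pi\alpha|x-y|^2}\in[-\infty,+\infty],$$ where $B_r$ is the disk of center $0$ and radius $r$. A perturbation $p:A_2\to\mathbb R^2$ is *periodic* if $p(x+y)=p(x)$ for all $x\in A_2$, $y\in L$, for some subgroup $L\subset A_2$ of finite index; put $A_2+p=\{x+p(x):x\in A_2\}$ and $\|p\|=\sup_{x\in A_2}|p(x)|$. For such $p$ and $x\in A_2$ define the probability measure $$Q_x=\frac1{|A_2/L|}\sum_{x'\in A_2/L}\delta_{p(x'+x)-p(x')},\qquad\text{and}\qquad \mathsf{FS}(p)=\sum_{x\in A_2,\ |x|=r_\star}\int_{\mathbb R^2}|u|^2\,dQ_x(u).$$ Let $R_x=\frac1{|A_2/L|}\sum_{x'\in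 A_2/L}\tfrac12\big(p(x+x')p(x')^T+p(x')p(x+x')^T\big)$ be the autocorrelation of $p$. Let $\mathcal H=\{u:|u|\le|u-x|\ \forall x\in A_2\}$ be the Voronoi cell of $0$ and $\Omega$ its image under the rotation of angle $\pi/2$ (a fundamental domain of the reciprocal lattice of $A_2$). A *spectral measure* of $p$ is a measure $\widehat R$ on the Borel sets of $\Omega$, with values in the symmetric positive semidefinite real $2\times2$ matrices, such that $R_x=\int_\Omega\cos(2\pi x\cdot\omega)\,d\widehat R(\omega)$ for all $x\in A_2$. Finally let $$\mathsf{SM}(p)=\mathrm{tr}\Big(\int_\Omega|\omega|^2\,d\widehat R(\omega)\Big).$$ **Proposition 3.1.** There are absolute constants $\alpha_\dagger>0$ and $c>0$ such that for every periodic perturbation $p$ of $A_2$: 1. For all $\alpha\ge\alpha_\dagger$, if $\|p\|\le\alpha^{-1}$, then $$E_\alpha(A_2+p)-E_\alpha(A_2)\ \ge\ c\,e^{-\pi\alpha r_\star^2}\,\mathsf{FS}(p).$$ 2. $p$ has a spectral measure; and for all $0<\alpha\le\alpha_\dagger$, if $\|p\|\le c\,e^{-\frac{2\pi}{\alpha}r_\star^2}$,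 then $$E_\alpha(A_2+p)-E_\alpha(A_2)\ \ge\ c\,e^{-\frac{\pi}{\alpha}r_\star^2}\,\mathsf{SM}(p),$$ where $\mathsf{SM}(p)$ may be computed with any spectral measure of $p$. -/

import Mathlib

open MeasureTheory Filter Topology
open scoped ENNReal

noncomputable section

namespace Hexagonal

/-- The Euclidean plane. -/
abbrev Plane : Type := EuclideanSpace ℝ (Fin 2)

/-- The minimal distance `r⋆ = √(2 / √3)` of the hexagonal lattice of covolume one. -/
def rStar : ℝ := √(2 / √3)

/-- The basis vector `σ = r⋆ (1, 0)`. -/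
def latSigma : Plane := !₂[rStar, 0]

/-- The basis vector `τ = r⋆ (1/2, √3/2)`. -/
def latTau : Plane := !₂[rStar * (1 / 2), rStar * (√3 / 2)]

/-- The hexagonal lattice `A₂ = ℤσ + ℤτ`. -/
def A2 : AddSubgroup Plane := AddSubgroup.closure {latSigma, latTau}

/-! ### Energies of point configurations -/

/-- The `f`-energy of a point configuration `X`: the lower limit, as `r → ∞`, of
`|X ∩ B_r|⁻¹ ∑_{x ≠ y ∈ X ∩ B_r} f(|x - y|)`, the sum being over ordered pairs.
It takes values in the extended reals. -/
def energy (f : ℝ → ℝ) (X : Set Plane) : EReal :=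
  liminf (fun r : ℝ =>
    (((∑ᶠ q ∈ (X ∩ Metric.closedBall 0 r).offDiag, f ‖q.1 - q.2‖) /
      ((X ∩ Metric.closedBall 0 r).ncard : ℝ) : ℝ) : EReal)) atTop

/-- The Gaussian interaction potential `Φ_α(r) = exp(-π α r²)`. -/
def gaussPotential (α : ℝ) (r : ℝ) : ℝ := Real.exp (-(Real.pi * α * r ^ 2))

/-- The Gaussian energy `E_α`. -/
def gaussEnergy (α : ℝ) (X : Set Plane) : EReal := energy (gaussPotential α) X

/-! ### Periodic perturbations -/

/-- The perturbed lattice `A₂ + p = {x + p(x) : x ∈ A₂}`. -/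
def perturbedLattice (p : A2 → Plane) : Set Plane := Set.range fun x : A2 => (x : Plane) + p x

/-- The size `‖p‖ = sup_x |p(x)|` of a perturbation (used for bounded `p`; a periodic
perturbation takes finitely many values). -/
def pertSize (p : A2 → Plane) : ℝ := ⨆ x : A2, ‖p x‖

/-- `p` is `L`-periodic, for a sub-lattice `L` of `A₂`. -/
def IsPeriodic (L : AddSubgroup A2) (p : A2 → Plane) : Prop :=
  ∀ x : A2, ∀ y ∈ L, p (x + y) = p x

/-- The law `Q_x = |A₂/L|⁻¹ ∑_{x' ∈ A₂/L} δ_{p(x'+x) - p(x')}` of the relative displacements in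
the direction `x`. For `L`-periodic `p` it does not depend on the choice of the representatives
`x'`. -/
def relDisp (L : AddSubgroup A2) (p : A2 → Plane) (x : A2) : Measure Plane :=
  (L.index : ℝ≥0∞)⁻¹ •
    Measure.sum fun q : A2 ⧸ L => Measure.dirac (p (q.out + x) - p q.out)

/-- The first shell `S⋆`: the lattice points at distance `r⋆` from the origin. -/
def firstShell : Set A2 := {x | ‖(x : Plane)‖ = rStar}

/-- The first-shell size `FS(p) = ∑_{x ∈ S⋆} ∫ |u|² dQ_x(u)`. -/
def FS (L : AddSubgroup A2) (p : A2 → Plane) : ℝ :=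
  ∑ᶠ x ∈ firstShell, ∫ u, ‖u‖ ^ 2 ∂(relDisp L p x)

/-- The expectation of `g(x•)`, for an `L`-periodic `g` and a uniformly chosen random point `x•`
of the period `A₂/L`. -/
def periodMean (L : AddSubgroup A2) (g : A2 → ℝ) : ℝ :=
  (L.index : ℝ)⁻¹ * ∑ᶠ q : A2 ⧸ L, g q.out

/-- The autocorrelation `R_x = ½ 𝔼[P_x P_0ᵀ + P_0 P_xᵀ]` of the stationary random field
`P_x = p(x + x•)`, with `x•` uniform in the period. -/
def autocorr (L : AddSubgroup A2) (p : A2 → Plane) (x : A2) : Matrix (Fin 2) (Fin 2) ℝ :=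
  Matrix.of fun a b => periodMean L fun x' =>
    (1 / 2) * (p (x + x') a * p x' b + p (x + x') b * p x' a)

/-! ### Spectral measures -/

/-- The Voronoi cell `ℋ` of the origin in `A₂`. -/
def hexCell : Set Plane := {u | ∀ x ∈ A2, ‖u‖ ≤ ‖u - x‖}

/-- The fundamental domain `Ω` of the reciprocal lattice of `A₂`, which is the image of `ℋ` under
the rotation of angle `π/2`. -/
def dualCell : Set Plane := (fun u : Plane => (!₂[-u 1, u 0] : Plane)) '' hexCell

/-- Measures on (the Borel sets of) `Ω` with values in the cone of symmetric positive
semidefinite real `2 × 2` matrices. -/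
structure PSDMeasure where
  /-- The underlying countably additive matrix-valued set function. -/
  toVectorMeasure : VectorMeasure dualCell (Matrix (Fin 2) (Fin 2) ℝ)
  posSemidef : ∀ A : Set dualCell, MeasurableSet A → (toVectorMeasure A).PosSemidef

theorem continuous_entryHom (a b : Fin 2) :
    Continuous (Matrix.entryAddMonoidHom ℝ a b : Matrix (Fin 2) (Fin 2) ℝ →+ ℝ) := by
  have h : Continuous fun M : Matrix (Fin 2) (Fin 2) ℝ => M a b := continuous_id.matrix_elem a b
  exact h

/-- The component `μ^{ab}`, a signed measure on `Ω`. -/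
def PSDMeasure.entry (μ : PSDMeasure) (a b : Fin 2) : SignedMeasure dualCell :=
  μ.toVectorMeasure.mapRange (Matrix.entryAddMonoidHom ℝ a b)
    (continuous_entryHom a b)

theorem PSDMeasure.entry_apply (μ : PSDMeasure) (a b : Fin 2) (A : Set dualCell) :
    μ.entry a b A = μ.toVectorMeasure A a b := by
  rw [PSDMeasure.entry, VectorMeasure.mapRange_apply, Matrix.entryAddMonoidHom_apply]

/-- The matrix `∫_Ω g dμ`, computed entry by entry. -/
def PSDMeasure.integral (μ : PSDMeasure) (g : dualCell → ℝ) : Matrix (Fin 2) (Fin 2) ℝ :=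
  Matrix.of fun a b => (μ.entry a b).integral g (ContinuousLinearMap.lsmul ℝ ℝ)

/-- `μ` is a spectral measure of `p`: `R_x = ∫_Ω cos(2π x·ω) dμ(ω)` for all `x ∈ A₂`. -/
def IsSpectralMeasure (L : AddSubgroup A2) (p : A2 → Plane) (μ : PSDMeasure) : Prop :=
  ∀ x : A2, autocorr L p x =
    μ.integral fun ω => Real.cos (2 * Real.pi * inner ℝ (x : Plane) (ω : Plane))

/-- The quantity `tr (∫_Ω |ω|² dμ(ω))`, which is `SM(p)` if `μ` is the spectral measure of `p`. -/
def SM (μ : PSDMeasure) : ℝ := (μ.integral fun ω => ‖(ω : Plane)‖ ^ 2).trace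

end Hexagonal

end

open Hexagonal

namespace Hexagonal

/-! ### Elementary inequalities for the exponential function -/

/-! All interactions are positive, so the perturbed energy is at least the sum over lattice vectors
`x` of the mean of `exp(-πα|x+u|²)`, with `u` the relative displacement in direction `x`. The
unperturbed energy is at most the full lattice sum. It therefore suffices to bound below the mean
change of each interaction and to sum these bounds (`tsum_le_gaussEnergy_sub`). In the expansion in
`u` the linear term averages to zero by periodicity. The quadratic term involves only the mean
squares of `u` (`msd`) and of `x·u` (`longMsd`). Finite Fourier analysis on `A₂/L` writes both as
sums over modes, a mode of frequency `θ` entering with the weight `1 - cos(2π x·θ)`.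

Put `S = 2πα r⋆²`. If `S ≥ 21/4`, the first shell dominates. The Korn type inequality
`shell_rigidity` shows that longitudinal displacements along the six shortest vectors control `FS`.
The negative terms of all lattice vectors together are at most `6/5` of the first shell's
(`far_sum_le`), since `weight_le` bounds every weight by that of the shell. With a quadratic
coefficient close to `1/2`, the balance `S/8 - 3/5` is positive (`energy_gap_of_shell`).

If `S ≤ 21/4`, the quadratic part of each mode is `dynForm`. Poisson summation turns it into a
difference of second Gaussian moments over the reciprocal lattice, shifted by `θ` and unshifted, at
the dual parameter `T = 16π²/(3S) ≥ 10` (`dynForm_eq`). The inequality `moment_sum_ge` says that the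
shifted sum is larger, by at least a multiple of `exp(-T/2)|θ|²`, and `T/2 = π r⋆²/α`. Near the
origin of the cell this follows by pairing opposite vectors, and elsewhere from the four points
nearest to the origin. The cubic error is of order `‖p‖ S⁻³ FS`; the assumed smallness of `p`
absorbs it, as `exp(-T/2) ≤ S³`.

In both regimes the gain is a multiple of `FS`. Every spectral measure satisfies `SM ≤ FS`
(`SM_bounds`), because `|ω|²` is at most the shell weight on the cell. -/

theorem cosh_quadratic_ge (A B y : ℝ) :
    A ^ 2 - B ^ 2 ≤ (A ^ 2 + B ^ 2) * Real.cosh y - 2 * A * B * Real.sinh y := by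
  have hC := Real.one_le_cosh y
  have hCD := Real.cosh_sq y
  set C := Real.cosh y
  set D := Real.sinh y
  -- Since `D² = C² - 1`, the factor `C + 1` turns the difference into a perfect square.
  have h : 0 ≤ (C + 1) * ((A ^ 2 + B ^ 2) * C - 2 * A * B * D - (A ^ 2 - B ^ 2)) := by
    have : (C + 1) * ((A ^ 2 + B ^ 2) * C - 2 * A * B * D - (A ^ 2 - B ^ 2))
        = (A * D - B * (C + 1)) ^ 2 := by linear_combination A ^ 2 * hCD
    rw [this]; positivity
  have := nonneg_of_mul_nonneg_right h (by linarith)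
  linarith

/-- The same completion of a square, balanced differently: part of the growth of `cosh` survives in
the coefficient of `A²`, at the price of a larger loss in `B²`. The term of the origin will pay for
that loss. -/
theorem cosh_quadratic_ge' (A B y : ℝ) :
    A ^ 2 * (1 + 3 / 4 * (Real.cosh y - 1)) - B ^ 2 * (3 * Real.cosh y + 4) ≤
      (A ^ 2 + B ^ 2) * Real.cosh y - 2 * A * B * Real.sinh y := by
  have hC := Real.one_le_cosh y
  have hCD := Real.cosh_sq y
  set C := Real.cosh y
  set D := Real.sinh y
  have h : 0 ≤ (C + 1) * ((A ^ 2 + B ^ 2) * C - 2 * A * B * D -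
      (A ^ 2 * (1 + 3 / 4 * (C - 1)) - B ^ 2 * (3 * C + 4))) := by
    have : (C + 1) * ((A ^ 2 + B ^ 2) * C - 2 * A * B * D -
        (A ^ 2 * (1 + 3 / 4 * (C - 1)) - B ^ 2 * (3 * C + 4)))
        = (A * D / 2 - 2 * B * (C + 1)) ^ 2 := by linear_combination A ^ 2 / 4 * hCD
    rw [this]; positivity
  have := nonneg_of_mul_nonneg_right h (by linarith)
  linarith

theorem exp_ge_cubic {x : ℝ} (hx : 0 ≤ x) : 1 + x + x ^ 2 / 2 + x ^ 3 / 6 ≤ Real.exp x := by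
  have := Real.sum_le_exp_of_nonneg hx 4
  simp [Finset.sum_range_succ, Nat.factorial] at this
  linarith

theorem one_add_sq_half_le_cosh (y : ℝ) : 1 + y ^ 2 / 2 ≤ Real.cosh y := by
  have h1 : Real.cosh y = 1 + 2 * Real.sinh (|y| / 2) ^ 2 := by
    rw [← Real.cosh_abs, show |y| = 2 * (|y| / 2) by ring, Real.cosh_two_mul, Real.cosh_sq]
    simp; ring
  have h2 : |y| / 2 ≤ Real.sinh (|y| / 2) := Real.self_le_sinh_iff.2 (by positivity)
  have h3 : (|y| / 2) ^ 2 ≤ Real.sinh (|y| / 2) ^ 2 := by gcongr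
  rw [div_pow, sq_abs] at h3
  linarith

/-- The Padé lower bound for the exponential function. -/
theorem exp_neg_ge_pade (y : ℝ) : 1 - y + y ^ 2 / (2 + |y|) ≤ Real.exp (-y) := by
  rcases le_total 0 y with hy | hy
  · rw [abs_of_nonneg hy]
    have h1 : 1 - y + y ^ 2 / (2 + y) = (2 - y) / (2 + y) := by field_simp; ring
    rw [h1, div_le_iff₀ (by linarith)]
    have hd : ∀ t : ℝ, HasDerivAt (fun t => Real.exp (-t) * (2 + t) - (2 - t))
        (-Real.exp (-t) * (2 + t) + Real.exp (-t) + 1) t := fun t => by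
      have := (((hasDerivAt_id t).neg.exp).mul ((hasDerivAt_id t).const_add 2)).sub
        ((hasDerivAt_id t).const_sub 2)
      convert! this using 1
      simp; 
    have hm : MonotoneOn (fun t => Real.exp (-t) * (2 + t) - (2 - t)) (Set.Ici 0) := by
      apply monotoneOn_of_deriv_nonneg (convex_Ici 0)
      · exact fun t _ => (hd t).continuousAt.continuousWithinAt
      · exact fun t _ => (hd t).differentiableAt.differentiableWithinAt
      · intro t _
        rw [(hd t).deriv]
        have := Real.add_one_le_exp t
        have h2 : Real.exp (-t) * Real.exp t = 1 := by rw [← Real.exp_add]; simp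
        nlinarith [Real.exp_pos (-t)]
    have := hm (Set.mem_Ici.2 le_rfl) (Set.mem_Ici.2 hy) hy
    simp at this
    linarith
  · rw [abs_of_nonpos hy]
    have := exp_ge_cubic (neg_nonneg.2 hy)
    have h2 : y ^ 2 / (2 + -y) ≤ y ^ 2 / 2 := by
      apply div_le_div_of_nonneg_left (sq_nonneg y) <;> linarith
    have h3 : 0 ≤ (-y) ^ 3 / 6 := by have := neg_nonneg.2 hy; positivity
    have h4 : (-y) ^ 2 = y ^ 2 := by ring
    linarith

theorem exp_neg_ge_cubic (y : ℝ) : 1 - y + y ^ 2 / 2 - |y| ^ 3 / 4 ≤ Real.exp (-y) := by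
  refine le_trans ?_ (exp_neg_ge_pade y)
  have h0 := abs_nonneg y
  have : y ^ 2 / 2 - |y| ^ 3 / 4 ≤ y ^ 2 / (2 + |y|) := by
    rw [le_div_iff₀ (by linarith), ← sq_abs y]
    nlinarith [pow_nonneg h0 4]
  linarith

/-! ### The hexagonal inequality for reciprocal Gaussian sums -/

/-- The quadratic form of the reciprocal lattice of `A₂`. -/
noncomputable def qf (a : ℝ × ℝ) : ℝ := a.1 ^ 2 - a.1 * a.2 + a.2 ^ 2

/-- The bilinear form of the quadratic form `qf`. -/
noncomputable def bf (a b : ℝ × ℝ) : ℝ := a.1 * b.1 - (a.1 * b.2 + a.2 * b.1) / 2 + a.2 * b.2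

theorem bf_self (a : ℝ × ℝ) : bf a a = qf a := by simp only [bf, qf]; ring

theorem qf_nonneg (a : ℝ × ℝ) : 0 ≤ qf a := by
  unfold qf; nlinarith [sq_nonneg (a.1 - a.2), sq_nonneg a.1, sq_nonneg a.2]

theorem bf_sq_le (a b : ℝ × ℝ) : bf a b ^ 2 ≤ qf a * qf b := by
  have : qf a * qf b - bf a b ^ 2 = 3 / 4 * (a.1 * b.2 - a.2 * b.1) ^ 2 := by
    unfold qf bf; ring
  nlinarith [sq_nonneg (a.1 * b.2 - a.2 * b.1)]

theorem qf_add (a b : ℝ × ℝ) : qf (a + b) = qf a + 2 * bf a b + qf b := by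
  simp [qf, bf]; ring

theorem bf_add_left (a b c : ℝ × ℝ) : bf (a + b) c = bf a c + bf b c := by
  simp [bf]; ring

theorem bf_neg_left (a c : ℝ × ℝ) : bf (-a) c = -bf a c := by
  simp [bf]; ring

theorem bf_comm (a b : ℝ × ℝ) : bf a b = bf b a := by
  simp [bf]; ring

theorem qf_neg (a : ℝ × ℝ) : qf (-a) = qf a := by
  simp [qf]

theorem half_le_qf (a : ℝ × ℝ) : (a.1 ^ 2 + a.2 ^ 2) / 2 ≤ qf a := by
  unfold qf; nlinarith [sq_nonneg (a.1 - a.2)]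

/-- The second directional moment of a Gaussian, as a function on the plane. -/
noncomputable def gaussMoment (S : ℝ) (v y : ℝ × ℝ) : ℝ := bf y v ^ 2 * Real.exp (-(S / 2) * qf y)

theorem gaussMoment_nonneg (S : ℝ) (v y : ℝ × ℝ) : 0 ≤ gaussMoment S v y := by
  unfold gaussMoment; positivity

/-- A symmetric pair of translates of a Gaussian moment, in terms of hyperbolic functions. -/
theorem gaussMoment_pair (S : ℝ) (v k y : ℝ × ℝ) :
    gaussMoment S v (y + k) + gaussMoment S v (y - k) =
      2 * Real.exp (-(S / 2) * qf k) * (Real.exp (-(S / 2) * qf y) *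
        ((bf k v ^ 2 + bf y v ^ 2) * Real.cosh (S * bf k y) -
          2 * bf k v * bf y v * Real.sinh (S * bf k y))) := by
  have h1 : Real.exp (-(S / 2) * qf (y + k)) = Real.exp (-(S / 2) * qf k) *
      (Real.exp (-(S / 2) * qf y) * Real.exp (-(S * bf k y))) := by
    rw [← Real.exp_add, ← Real.exp_add, qf_add, bf_comm y k]; ring_nf
  have h2 : Real.exp (-(S / 2) * qf (y - k)) = Real.exp (-(S / 2) * qf k) *
      (Real.exp (-(S / 2) * qf y) * Real.exp (S * bf k y)) := by
    rw [← Real.exp_add, ← Real.exp_add, sub_eq_add_neg, qf_add, qf_neg, bf_comm y, bf_neg_left]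
    ring_nf
  rw [gaussMoment, gaussMoment, h1, h2, sub_eq_add_neg, bf_add_left, bf_add_left, bf_neg_left,
    Real.cosh_eq, Real.sinh_eq]
  ring

/-- Pairing `k` with `-k` cancels the first order in `y`, so that the possible loss is proportional
to `qf y`. This is used for the tail, where the loss is summable and tiny. -/
theorem gaussMoment_pair_ge {S : ℝ} (hS : 0 ≤ S) (v k y : ℝ × ℝ) :
    2 * gaussMoment S v k -
      2 * Real.exp (-(S / 2) * qf k) * ((qf k * (S / 2) + 1) * (qf y * qf v)) ≤
      gaussMoment S v (y + k) + gaussMoment S v (y - k) := by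
  rw [gaussMoment_pair]
  have h1 := cosh_quadratic_ge (bf k v) (bf y v) (S * bf k y)
  have h2 := Real.add_one_le_exp (-(S / 2) * qf y)
  have h3 : Real.exp (-(S / 2) * qf y) ≤ 1 :=
    Real.exp_le_one_iff.2 (by nlinarith [qf_nonneg y])
  have h4 := bf_sq_le k v
  have h5 := bf_sq_le y v
  have hy := qf_nonneg y
  set G := Real.exp (-(S / 2) * qf y)
  have hG : 0 < G := Real.exp_pos _
  have key : bf k v ^ 2 - (qf k * (S / 2) + 1) * (qf y * qf v) ≤
      G * ((bf k v ^ 2 + bf y v ^ 2) * Real.cosh (S * bf k y) -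
          2 * bf k v * bf y v * Real.sinh (S * bf k y)) := by
    refine le_trans ?_ (mul_le_mul_of_nonneg_left h1 hG.le)
    have a1 : bf k v ^ 2 * (1 - S / 2 * qf y) ≤ bf k v ^ 2 * G :=
      mul_le_mul_of_nonneg_left (by linarith) (sq_nonneg _)
    have a2 : G * bf y v ^ 2 ≤ 1 * (qf y * qf v) :=
      mul_le_mul h3 h5 (sq_nonneg _) (by norm_num)
    have a3 : bf k v ^ 2 * (S / 2 * qf y) ≤ qf k * qf v * (S / 2 * qf y) :=
      mul_le_mul_of_nonneg_right h4 (by positivity)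
    nlinarith
  have := mul_le_mul_of_nonneg_left key (Real.exp_pos (-(S / 2) * qf k)).le
  rw [gaussMoment]
  nlinarith

theorem exp_five_halves_le : Real.exp (5 / 2) ≤ 61 / 5 := by
  have h : Real.exp (5 / 2) ^ 2 = Real.exp 1 ^ 5 := by
    rw [← Real.exp_nat_mul, ← Real.exp_nat_mul]; norm_num
  have h1 : Real.exp 1 ^ 5 ≤ (2.7182818286 : ℝ) ^ 5 := by
    gcongr; exact Real.exp_one_lt_d9.le
  by_contra! h2
  have h3 : (61 / 5 : ℝ) ^ 2 < Real.exp (5 / 2) ^ 2 := by gcongr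
  rw [h] at h3
  have := h3.trans_le h1
  norm_num at this

theorem le_exp_five : (148 : ℝ) ≤ Real.exp 5 := by
  have h : Real.exp 5 = Real.exp 1 ^ 5 := by
    rw [← Real.exp_nat_mul]; norm_num
  have h1 : (2.7182818283 : ℝ) ^ 5 ≤ Real.exp 1 ^ 5 := by
    gcongr; exact Real.exp_one_gt_d9.le
  norm_num at h1
  linarith

theorem cosh_five_halves_le : Real.cosh (5 / 2) ≤ 615 / 100 := by
  rw [Real.cosh_eq]
  have h1 := exp_five_halves_le
  have h2 : Real.exp (-(5 / 2)) ≤ 1 / 10 := by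
    rw [Real.exp_neg, ← one_div]
    apply one_div_le_one_div_of_le (by norm_num)
    have := exp_ge_cubic (x := 5 / 2) (by norm_num)
    by_contra! h
    have h3 : Real.exp (5 / 2) ^ 2 = Real.exp 5 := by
      rw [← Real.exp_nat_mul]; norm_num
    have := le_exp_five
    nlinarith [Real.exp_pos (5 / 2)]
  linarith

theorem exp_neg_five_le {S : ℝ} (hS : 10 ≤ S) : Real.exp (-(S / 2)) ≤ 1 / 148 := by
  have : Real.exp (-(S / 2)) ≤ Real.exp (-5) := Real.exp_le_exp.2 (by linarith)
  refine this.trans ?_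
  rw [Real.exp_neg, ← one_div]
  exact one_div_le_one_div_of_le (by norm_num) le_exp_five

/-- The constraints describe a hexagon, and the convex form takes the value `M²` at each of its
vertices. -/
theorem sq_add_mul_le {x y M : ℝ} (hx : |x| ≤ M) (hy : |y| ≤ M) (hxy : |x + y| ≤ M) :
    x ^ 2 + x * y + y ^ 2 ≤ M ^ 2 := by
  rw [abs_le] at *
  rcases le_total 0 x with h1 | h1 <;> rcases le_total 0 y with h2 | h2 <;>
  rcases le_total 0 (x + y) with h3 | h3 <;> nlinarith [mul_nonneg_iff.2 (Or.inl ⟨sub_nonneg.2 hx.2, sub_nonneg.2 hx.2⟩)]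

/-- Sixfold symmetry makes the fourth order tensor of the shell isotropic, so it is a combination of
`qf y * qf v` and `bf y v ^ 2`. -/
theorem bf_sq_sum_eq (v y : ℝ × ℝ) :
    bf (1, 0) v ^ 2 * bf (1, 0) y ^ 2 + bf (0, 1) v ^ 2 * bf (0, 1) y ^ 2 +
      bf (1, 1) v ^ 2 * bf (1, 1) y ^ 2 = 3 / 8 * (qf y * qf v) + 3 / 4 * bf y v ^ 2 := by
  simp only [bf, qf]; ring

theorem bf_sq_sum (v : ℝ × ℝ) :
    bf (1, 0) v ^ 2 + bf (0, 1) v ^ 2 + bf (1, 1) v ^ 2 = 3 / 2 * qf v := by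
  simp only [bf, qf]; ring

theorem sq_mul_qf_le {S M : ℝ} (y : ℝ × ℝ) (h1 : |S * bf (1, 0) y| ≤ M)
    (h2 : |S * bf (0, 1) y| ≤ M) (h3 : |S * bf (1, 1) y| ≤ M) :
    S ^ 2 * qf y ≤ 4 / 3 * M ^ 2 := by
  have hb3 : S * bf (1, 1) y = S * bf (1, 0) y + S * bf (0, 1) y := by simp [bf]; ring
  have hN : S ^ 2 * qf y = 4 / 3 * ((S * bf (1, 0) y) ^ 2 +
      (S * bf (1, 0) y) * (S * bf (0, 1) y) + (S * bf (0, 1) y) ^ 2) := by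
    simp [bf, qf]; ring
  have := sq_add_mul_le h1 h2 (by rw [← hb3]; exact h3)
  rw [hN]; linarith

/-- Here `p = exp(-S/2)` is the weight of the shell, `G` that of the origin, `N = qf y` and `V = qf
v`. The numbers `Aᵢ` and `B` pair `v` with the shell vectors and with `y`, and `yᵢ` is `S` times the
pairing of a shell vector with `y`. The losses in `B²` of the three pairs are covered by `B² G`
because `p` is small, and the growth of `cosh` outweighs the decay of `G`. -/
theorem shell_sum_ge {S p G N V B A1 A2 A3 y1 y2 y3 : ℝ} (hS : 10 ≤ S) (hp0 : 0 < p)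
    (hp : p ≤ 1 / 148) (hG0 : 0 < G) (hG : 1 - S / 2 * N ≤ G) (hN : 0 ≤ N) (hV : 0 ≤ V)
    (hSN : S ^ 2 * N ≤ 25 / 3) (hA : A1 ^ 2 + A2 ^ 2 + A3 ^ 2 = 3 / 2 * V)
    (hAy : 3 / 8 * (S ^ 2 * N) * V ≤ A1 ^ 2 * y1 ^ 2 + A2 ^ 2 * y2 ^ 2 + A3 ^ 2 * y3 ^ 2)
    (h1 : |y1| ≤ 5 / 2) (h2 : |y2| ≤ 5 / 2) (h3 : |y3| ≤ 5 / 2) :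
    p * ((3 + 6 / 5 * N) * V) ≤ B ^ 2 * G
      + 2 * p * (G * ((A1 ^ 2 + B ^ 2) * Real.cosh y1 - 2 * A1 * B * Real.sinh y1))
      + 2 * p * (G * ((A2 ^ 2 + B ^ 2) * Real.cosh y2 - 2 * A2 * B * Real.sinh y2))
      + 2 * p * (G * ((A3 ^ 2 + B ^ 2) * Real.cosh y3 - 2 * A3 * B * Real.sinh y3)) := by
  have i1 := cosh_quadratic_ge' A1 B y1
  have i2 := cosh_quadratic_ge' A2 B y2
  have i3 := cosh_quadratic_ge' A3 B y3
  have c1 := one_add_sq_half_le_cosh y1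
  have c2 := one_add_sq_half_le_cosh y2
  have c3 := one_add_sq_half_le_cosh y3
  have hcosh : ∀ t : ℝ, |t| ≤ 5 / 2 → Real.cosh t ≤ 615 / 100 := fun t ht =>
    (Real.cosh_le_cosh.2 (by rwa [abs_of_pos (by norm_num : (0 : ℝ) < 5 / 2)])).trans
      cosh_five_halves_le
  have d1 := hcosh _ h1
  have d2 := hcosh _ h2
  have d3 := hcosh _ h3
  generalize Real.cosh y1 = C1 at *
  generalize Real.cosh y2 = C2 at *
  generalize Real.cosh y3 = C3 at *
  generalize Real.sinh y1 = D1 at *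
  generalize Real.sinh y2 = D2 at *
  generalize Real.sinh y3 = D3 at *
  -- With `cosh ≤ 6.15` the bracket is at most `134.7`, below `148 ≤ 1/p`.
  have k1 : p * (2 * ((3 * C1 + 4) + (3 * C2 + 4) + (3 * C3 + 4))) ≤ 1 := by
    have : 2 * ((3 * C1 + 4) + (3 * C2 + 4) + (3 * C3 + 4)) ≤ 148 := by linarith
    have := mul_le_mul_of_nonneg_left this hp0.le
    linarith
  have k2 : 0 ≤ B ^ 2 * G * (1 - p * (2 * ((3 * C1 + 4) + (3 * C2 + 4) + (3 * C3 + 4)))) :=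
    mul_nonneg (by positivity) (by linarith)
  -- The constant is `9/64 = 3/4 · 1/2 · 3/8`: the retained part of `cosh`, its Taylor coefficient,
  -- and the isotropic shell sum.
  have k5 : V * (3 / 2 + 9 / 64 * (S ^ 2 * N)) ≤ A1 ^ 2 * (1 + 3 / 4 * (C1 - 1)) +
      A2 ^ 2 * (1 + 3 / 4 * (C2 - 1)) + A3 ^ 2 * (1 + 3 / 4 * (C3 - 1)) := by
    have m1 := mul_le_mul_of_nonneg_left c1 (sq_nonneg A1)
    have m2 := mul_le_mul_of_nonneg_left c2 (sq_nonneg A2)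
    have m3 := mul_le_mul_of_nonneg_left c3 (sq_nonneg A3)
    linarith
  -- The gain `9/64 S²N` competes with losses of order `SN`; the surplus `3/5 N` is available from
  -- `S = 10` on.
  have k6 : 3 / 2 + 3 / 5 * N ≤ G * (3 / 2 + 9 / 64 * (S ^ 2 * N)) := by
    have e1 : (1 - S / 2 * N) * (3 / 2 + 9 / 64 * (S ^ 2 * N)) ≤
        G * (3 / 2 + 9 / 64 * (S ^ 2 * N)) :=
      mul_le_mul_of_nonneg_right (by linarith) (by positivity)
    have e2 : S * N * (S ^ 2 * N) ≤ S * N * (25 / 3) :=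
      mul_le_mul_of_nonneg_left hSN (by positivity)
    have e3 : 0 ≤ N * (S * (S - 10)) :=
      mul_nonneg hN (mul_nonneg (by linarith) (by linarith))
    have e4 : 0 ≤ N * (S - 10) := mul_nonneg hN (by linarith)
    nlinarith
  have k7 : V * (3 / 2 + 3 / 5 * N) ≤ V * (G * (3 / 2 + 9 / 64 * (S ^ 2 * N))) :=
    mul_le_mul_of_nonneg_left k6 hV
  have k8 := mul_le_mul_of_nonneg_left k5 hG0.le
  have k9 := mul_le_mul_of_nonneg_left i1 (mul_pos hp0 hG0).le
  have k10 := mul_le_mul_of_nonneg_left i2 (mul_pos hp0 hG0).le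
  have k11 := mul_le_mul_of_nonneg_left i3 (mul_pos hp0 hG0).le
  have k12 := mul_le_mul_of_nonneg_left (k7.trans (le_of_eq (by ring)) |>.trans k8) hp0.le
  linear_combination 2 * k9 + 2 * k10 + 2 * k11 + 2 * k12 + k2

/-- The contribution of the origin and of the first shell, close to the origin of the cell. -/
theorem firstShell_moment_ge_of_small {S : ℝ} (hS : 10 ≤ S) (v y : ℝ × ℝ)
    (h1 : |S * bf (1, 0) y| ≤ 5 / 2) (h2 : |S * bf (0, 1) y| ≤ 5 / 2)
    (h3 : |S * bf (1, 1) y| ≤ 5 / 2) :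
    Real.exp (-(S / 2)) * ((3 + 6 / 5 * qf y) * qf v) ≤
      gaussMoment S v y + (gaussMoment S v (y + (1, 0)) + gaussMoment S v (y - (1, 0)))
        + (gaussMoment S v (y + (0, 1)) + gaussMoment S v (y - (0, 1)))
        + (gaussMoment S v (y + (1, 1)) + gaussMoment S v (y - (1, 1))) := by
  have q1 : qf (1, 0) = 1 := by norm_num [qf]
  have q2 : qf (0, 1) = 1 := by norm_num [qf]
  have q3 : qf (1, 1) = 1 := by norm_num [qf]
  rw [gaussMoment_pair, gaussMoment_pair, gaussMoment_pair, q1, q2, q3, mul_one, gaussMoment]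
  have hG := Real.add_one_le_exp (-(S / 2) * qf y)
  have hSN := sq_mul_qf_le y h1 h2 h3
  refine shell_sum_ge hS (Real.exp_pos _) (exp_neg_five_le hS) (Real.exp_pos _) (by linarith)
    (qf_nonneg y) (qf_nonneg v) (by linarith) (bf_sq_sum v) ?_ h1 h2 h3
  have := bf_sq_sum_eq v y
  have := mul_le_mul_of_nonneg_left
    (by linarith [sq_nonneg (bf y v)] : 3 / 8 * (qf y * qf v) ≤ bf (1, 0) v ^ 2 * bf (1, 0) y ^ 2 +
      bf (0, 1) v ^ 2 * bf (0, 1) y ^ 2 + bf (1, 1) v ^ 2 * bf (1, 1) y ^ 2) (sq_nonneg S)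
  linarith

/-- This inverts the Gram matrix of `e, e'`, whose determinant is `1 - 1/4 = 3/4`. -/
theorem gram_expansion {e e' : ℝ × ℝ} (he : qf e = 1) (he' : qf e' = 1)
    (hee : bf e e' = -1 / 2) (v y : ℝ × ℝ) :
    bf y v = 4 / 3 * (bf e y * bf e v + bf e' y * bf e' v +
      (bf e y * bf e' v + bf e' y * bf e v) / 2) := by
  have h : bf y v * (qf e * qf e' - bf e e' ^ 2) = qf e' * (bf e y * bf e v) -
      bf e e' * (bf e y * bf e' v + bf e' y * bf e v) + qf e * (bf e' y * bf e' v) := by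
    simp only [bf, qf]; ring
  rw [he, he', hee] at h
  linarith

/-- The contribution of the four points which are closest to the origin, away from the origin of
the cell. Here `e` and `e'` are unit vectors at angle `2π/3`. -/
theorem four_points_moment_ge {S : ℝ} (hS : 10 ≤ S) (v y e e' : ℝ × ℝ) (he : qf e = 1)
    (he' : qf e' = 1) (hee : bf e e' = -1 / 2) (h1 : 0 ≤ bf e y) (h2 : 0 ≤ bf e' y)
    (h3 : 5 / 2 ≤ S * (bf e y + bf e' y)) (h4 : bf e y + bf e' y ≤ 1 / 2) :
    Real.exp (-(S / 2)) * (27 / 8 * qf v) ≤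
      gaussMoment S v y + gaussMoment S v (y - e) + gaussMoment S v (y - e')
        + gaussMoment S v (y - (e + e')) := by
  have hB := gram_expansion he he' hee v y
  have hN := gram_expansion he he' hee y y
  have hV := gram_expansion he he' hee v v
  rw [bf_self] at hN hV
  have n1 : qf (y - e) = qf y + 1 - 2 * bf e y := by
    rw [sub_eq_add_neg, qf_add, qf_neg, bf_comm, bf_neg_left, he]; ring
  have n2 : qf (y - e') = qf y + 1 - 2 * bf e' y := by
    rw [sub_eq_add_neg, qf_add, qf_neg, bf_comm, bf_neg_left, he']; ring
  have n3 : qf (y - (e + e')) = qf y + 1 - 2 * (bf e y + bf e' y) := by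
    rw [sub_eq_add_neg, qf_add, qf_neg, bf_comm, bf_neg_left, qf_add, he, he', hee, bf_add_left]
    ring
  have b1 : bf (y - e) v = bf y v - bf e v := by
    rw [sub_eq_add_neg, bf_add_left, bf_neg_left]; ring
  have b2 : bf (y - e') v = bf y v - bf e' v := by
    rw [sub_eq_add_neg, bf_add_left, bf_neg_left]; ring
  have b3 : bf (y - (e + e')) v = bf y v - (bf e v + bf e' v) := by
    rw [sub_eq_add_neg, bf_add_left, bf_neg_left, bf_add_left]; ring
  simp only [gaussMoment]
  rw [n1, n2, n3, b1, b2, b3]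
  generalize bf e y = a at *
  generalize bf e' y = a' at *
  generalize bf e v = A at *
  generalize bf e' v = A' at *
  generalize bf y v = B at *
  generalize qf y = N at *
  generalize qf v = V at *
  -- The pairing of `y` with the bisector `e + e'`, again a unit vector.
  set m := a + a' with hm
  have hm0 : 0 < m := by
    by_contra! h
    linarith [mul_nonpos_of_nonneg_of_nonpos (by linarith : 0 ≤ S) h]
  have hNm : N ≤ 4 / 3 * m ^ 2 := by rw [hN]; nlinarith [mul_nonneg h1 h2]
  -- Relative to `exp(-S/2)`, `X` is the geometric mean of the weights of `y - e` and `y - e'`,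
  -- while `Y` is the weight of `y - (e + e')`. The origin weighs at least `Y` because `m ≤ 1/2`.
  set X := Real.exp (S * (m - N) / 2) with hX
  set Y := Real.exp (S * (m - N / 2)) with hY
  have hSN : S * N ≤ S * (4 / 3 * m ^ 2) := mul_le_mul_of_nonneg_left hNm (by linarith)
  have hS0 : 0 ≤ (S - 10) * m := mul_nonneg (by linarith) hm0.le
  -- For `m ≤ 1/4` use `S m ≥ 5/2`. For larger `m` use `S ≥ 10`: the concave function `10 m (1 -
  -- 4m/3)` equals `5/3` at both `1/4` and `1/2`.
  have hmN : 5 / 6 ≤ S * (m - N) / 2 := by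
    have : 5 / 3 ≤ S * m * (1 - 4 / 3 * m) := by
      rcases le_total m (1 / 4) with h | h
      · have := mul_le_mul h3 (by linarith : 2 / 3 ≤ 1 - 4 / 3 * m) (by norm_num) (by linarith)
        linarith
      · have h5 := mul_nonneg hS0 (by linarith : 0 ≤ 1 - 4 / 3 * m)
        have h6 := mul_nonneg (sub_nonneg.2 h) (sub_nonneg.2 h4)
        linarith
    linarith
  have hX1 : 9 / 4 ≤ X := by
    have := exp_ge_cubic (x := S * (m - N) / 2) (by linarith)
    nlinarith [sq_nonneg (S * (m - N) / 2 - 5 / 6)]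
  have hXY : X ≤ Y := by
    apply Real.exp_le_exp.2; linarith
  have hY1 : 27 / 4 ≤ Y := by
    have h25 : 25 / 12 ≤ S * (m - N / 2) := by
      have : 25 / 12 ≤ S * m * (1 - 2 / 3 * m) := by
        rcases le_total m (1 / 4) with h | h
        · have := mul_le_mul h3 (by linarith : 5 / 6 ≤ 1 - 2 / 3 * m) (by norm_num) (by linarith)
          linarith
        · have h5 := mul_nonneg hS0 (by linarith : 0 ≤ 1 - 2 / 3 * m)
          have h6 := mul_nonneg (sub_nonneg.2 h) (sub_nonneg.2 h4)
          linarith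
      linarith
    have h1 := exp_ge_cubic (x := 25 / 12) (by norm_num)
    have h2 : Real.exp (25 / 12) ≤ Y := Real.exp_le_exp.2 h25
    norm_num at h1
    linarith
  have e0 : Real.exp (-(S / 2)) * Y ≤ Real.exp (-(S / 2) * N) := by
    rw [hY, ← Real.exp_add]
    apply Real.exp_le_exp.2
    linarith [mul_nonneg (by linarith : 0 ≤ S) (by linarith : 0 ≤ 1 / 2 - m)]
  have e3 : Real.exp (-(S / 2) * (N + 1 - 2 * m)) = Real.exp (-(S / 2)) * Y := by
    rw [hY, ← Real.exp_add]; ring_nf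
  have e1 : Real.exp (-(S / 2) * (N + 1 - 2 * a)) =
      Real.exp (-(S / 2)) * (X * Real.exp (S * (a - a') / 2)) := by
    rw [hX, ← Real.exp_add, ← Real.exp_add, hm]; ring_nf
  have e2 : Real.exp (-(S / 2) * (N + 1 - 2 * a')) =
      Real.exp (-(S / 2)) * (X * Real.exp (-(S * (a - a') / 2))) := by
    rw [hX, ← Real.exp_add, ← Real.exp_add, hm]; ring_nf
  rw [e1, e2, e3]
  have hp := Real.exp_pos (-(S / 2))
  -- The two side points form a hyperbolic pair centred at `B - (A + A')/2`. The negative square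
  -- that this leaves, with coefficient `X`, is compensated by the two heavier points since `X ≤ Y`.
  have hc := cosh_quadratic_ge ((A - A') / 2) (B - (A + A') / 2) (S * (a - a') / 2)
  rw [Real.cosh_eq, Real.sinh_eq] at hc
  generalize Real.exp (-(S / 2)) = p at *
  generalize Real.exp (S * (a - a') / 2) = E at *
  generalize Real.exp (-(S * (a - a') / 2)) = E' at *
  generalize Real.exp (-(S / 2) * N) = G at *
  have f0 := mul_le_mul_of_nonneg_left e0 (sq_nonneg B)
  have f1 := mul_le_mul_of_nonneg_left hc (mul_pos hp (by linarith : 0 < X)).le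
  have f2 : 0 ≤ p * ((Y - X) * (B - (A + A') / 2) ^ 2) :=
    mul_nonneg hp.le (mul_nonneg (by linarith) (sq_nonneg _))
  have f3 : 0 ≤ p * ((Y - 27 / 4) * (A + A') ^ 2) :=
    mul_nonneg hp.le (mul_nonneg (by linarith) (sq_nonneg _))
  have f4 : 0 ≤ p * ((X - 9 / 4) * (A - A') ^ 2) :=
    mul_nonneg hp.le (mul_nonneg (by linarith) (sq_nonneg _))
  -- As `27/8 V = 27/8 (A + A')² + 9/8 (A - A')²`, the thresholds needed are exactly `Y ≥ 27/4` and
  -- `X ≥ 9/4`.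
  rw [hV]
  linear_combination f0 + 2 * f1 + 2 * f2 + f3 / 2 + f4 / 2

/-! ### Gaussian sums over `ℤ × ℤ` -/

theorem summable_exp_neg_mul_int_sq {c : ℝ} (hc : 0 < c) :
    Summable fun n : ℤ => Real.exp (-c * (n : ℝ) ^ 2) := by
  have hg : Summable fun n : ℕ => Real.exp (-c * (n : ℝ) ^ 2) := by
    refine Summable.of_nonneg_of_le (fun n => (Real.exp_pos _).le) (fun n => ?_)
      (summable_geometric_of_lt_one (Real.exp_pos (-c)).le
        (Real.exp_lt_one_iff.2 (neg_neg_of_pos hc)))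
    rw [← Real.exp_nat_mul]
    apply Real.exp_le_exp.2
    have : (n : ℝ) ≤ (n : ℝ) ^ 2 := by exact_mod_cast Nat.le_self_pow two_ne_zero n
    nlinarith
  exact Summable.of_nat_of_neg (by simpa using hg) (by simpa using hg)

theorem summable_exp_neg_mul_sq_add_sq {c : ℝ} (hc : 0 < c) :
    Summable fun k : ℤ × ℤ => Real.exp (-c * ((k.1 : ℝ) ^ 2 + (k.2 : ℝ) ^ 2)) := by
  have h := summable_exp_neg_mul_int_sq hc
  refine (h.mul_of_nonneg h (fun n => (Real.exp_pos _).le) (fun n => (Real.exp_pos _).le)).congr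
    fun k => ?_
  rw [← Real.exp_add]; ring_nf

theorem tsum_exp_neg_int_sq_le : ∑' n : ℤ, Real.exp (-(1 / 2) * (n : ℝ) ^ 2) ≤ 3 := by
  set g : ℤ → ℝ := fun n => Real.exp (-(1 / 2) * (n : ℝ) ^ 2) with hg
  have hs : Summable g := summable_exp_neg_mul_int_sq (by norm_num)
  have h1 : ∑' n : ℤ, g n = g 0 + 2 * ∑' n : ℕ, g (n + 1) := by
    have h2 := tsum_of_nat_of_neg_add_one (f := g) (hs.comp_injective Nat.cast_injective)
      (hs.comp_injective (i := fun n : ℕ => -((n : ℤ) + 1)) (fun a b h => by simpa using h))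
    have h3 : ∑' n : ℕ, g n = g (0 : ℕ) + ∑' n : ℕ, g ((n + 1 : ℕ) : ℤ) :=
      (hs.comp_injective (i := fun n : ℕ => (n : ℤ)) Nat.cast_injective).tsum_eq_zero_add
    rw [h2, h3]
    have : ∀ n : ℕ, g (-((n : ℤ) + 1)) = g (n + 1) := fun n => by simp only [hg]; push_cast; ring_nf
    simp only [this]
    push_cast
    ring
  have hx := exp_ge_cubic (x := 1 / 2) (by norm_num)
  have hlt : Real.exp (-1) < 1 := Real.exp_lt_one_iff.2 (by norm_num)
  -- From `(n+1)²/2 ≥ 1/2 + n`, the sum is dominated by a geometric series.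
  have h3 : ∑' n : ℕ, g (n + 1) ≤ Real.exp (-(1 / 2)) * (1 - Real.exp (-1))⁻¹ := by
    rw [← tsum_geometric_of_lt_one (Real.exp_pos _).le hlt, ← tsum_mul_left]
    refine Summable.tsum_le_tsum (fun n => ?_) ?_ ?_
    · rw [← Real.exp_nat_mul, ← Real.exp_add]
      apply Real.exp_le_exp.2
      push_cast
      nlinarith [sq_nonneg (n : ℝ)]
    · exact hs.comp_injective (i := fun n : ℕ => (n : ℤ) + 1) (fun a b h => by simpa using h)
    · exact (summable_geometric_of_lt_one (Real.exp_pos _).le hlt).mul_left _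
  have h0 : g 0 = 1 := by simp [hg]
  have hh : Real.exp (-(1 / 2)) ≤ 1 - Real.exp (-1) := by
    have h4 : Real.exp (-1) = Real.exp (-(1 / 2)) ^ 2 := by
      rw [← Real.exp_nat_mul]; norm_num
    have h5 : Real.exp (-(1 / 2)) ≤ 61 / 100 := by
      rw [Real.exp_neg, ← one_div, div_le_iff₀ (Real.exp_pos _)]
      norm_num at hx
      linarith
    rw [h4]
    nlinarith [Real.exp_pos (-(1 / 2))]
  have h6 : Real.exp (-(1 / 2)) * (1 - Real.exp (-1))⁻¹ ≤ 1 := by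
    rw [← div_eq_mul_inv, div_le_one (by linarith)]; exact hh
  linarith

theorem tsum_exp_neg_sq_add_sq_le :
    ∑' k : ℤ × ℤ, Real.exp (-(1 / 2) * ((k.1 : ℝ) ^ 2 + (k.2 : ℝ) ^ 2)) ≤ 9 := by
  have hs := summable_exp_neg_mul_int_sq (c := 1 / 2) (by norm_num)
  have h0 : 0 ≤ ∑' n : ℤ, Real.exp (-(1 / 2) * (n : ℝ) ^ 2) :=
    tsum_nonneg fun n => (Real.exp_pos _).le
  have h1 : ∑' k : ℤ × ℤ, Real.exp (-(1 / 2) * ((k.1 : ℝ) ^ 2 + (k.2 : ℝ) ^ 2)) =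
      (∑' n : ℤ, Real.exp (-(1 / 2) * (n : ℝ) ^ 2)) *
        ∑' n : ℤ, Real.exp (-(1 / 2) * (n : ℝ) ^ 2) := by
    rw [hs.tsum_mul_tsum hs (hs.mul_of_nonneg hs (fun n => (Real.exp_pos _).le)
      (fun n => (Real.exp_pos _).le))]
    congr 1; ext k
    rw [← Real.exp_add]; ring_nf
  rw [h1]
  nlinarith [tsum_exp_neg_int_sq_le]

/-- The real point with integer coordinates `k`. -/
def zc (k : ℤ × ℤ) : ℝ × ℝ := (k.1, k.2)

theorem zc_neg (k : ℤ × ℤ) : zc (-k) = -zc k := by simp [zc]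

/-- The parallelogram law around the midpoint `y + k/2`, which makes shifted Gaussians summable. -/
theorem qf_shift_ge (y : ℝ × ℝ) (k : ℤ × ℤ) :
    ((k.1 : ℝ) ^ 2 + (k.2 : ℝ) ^ 2) / 4 - qf y ≤ qf (y + zc k) := by
  have h1 := half_le_qf (zc k)
  have h2 := qf_nonneg (y + (1 / 2 : ℝ) • zc k)
  have h3 : qf (y + zc k) + qf y - qf (zc k) / 2 = 2 * qf (y + (1 / 2 : ℝ) • zc k) := by
    simp [qf]; ring
  have h4 : ((zc k).1 ^ 2 + (zc k).2 ^ 2) = (k.1 : ℝ) ^ 2 + (k.2 : ℝ) ^ 2 := rfl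
  linarith

theorem summable_exp_neg_mul_qf {c : ℝ} (hc : 0 < c) (y : ℝ × ℝ) :
    Summable fun k : ℤ × ℤ => Real.exp (-c * qf (y + zc k)) := by
  refine Summable.of_nonneg_of_le (fun k => (Real.exp_pos _).le) (fun k => ?_)
    ((summable_exp_neg_mul_sq_add_sq (c := c / 4) (by linarith)).mul_left (Real.exp (c * qf y)))
  rw [← Real.exp_add]
  apply Real.exp_le_exp.2
  nlinarith [qf_shift_ge y k]

theorem mul_exp_neg_le {c t : ℝ} (hc : 0 < c) : t * Real.exp (-c * t) ≤
    2 / c * Real.exp (-(c / 2) * t) := by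
  have h1 := Real.add_one_le_exp (c / 2 * t)
  have h2 : Real.exp (-(c / 2) * t) = Real.exp (c / 2 * t) * Real.exp (-c * t) := by
    rw [← Real.exp_add]; ring_nf
  rw [h2, ← mul_assoc]
  refine mul_le_mul_of_nonneg_right ?_ (Real.exp_pos _).le
  rw [div_mul_eq_mul_div, le_div_iff₀ hc]
  linarith

theorem summable_qf_mul_exp {c : ℝ} (hc : 0 < c) (y : ℝ × ℝ) :
    Summable fun k : ℤ × ℤ => qf (y + zc k) * Real.exp (-c * qf (y + zc k)) :=
  Summable.of_nonneg_of_le (fun k => mul_nonneg (qf_nonneg _) (Real.exp_pos _).le)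
    (fun k => mul_exp_neg_le hc) ((summable_exp_neg_mul_qf (by linarith : 0 < c / 2) y).mul_left _)

theorem summable_gaussMoment {S : ℝ} (hS : 0 < S) (v y : ℝ × ℝ) :
    Summable fun k : ℤ × ℤ => gaussMoment S v (y + zc k) := by
  refine Summable.of_nonneg_of_le (fun k => gaussMoment_nonneg _ _ _) (fun k => ?_)
    ((summable_qf_mul_exp (by linarith : 0 < S / 2) y).mul_left (qf v))
  rw [gaussMoment, ← mul_assoc, mul_comm (qf v)]
  exact mul_le_mul_of_nonneg_right (bf_sq_le _ _) (Real.exp_pos _).le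

/-- The origin and the first shell, in the coordinates of the reciprocal lattice. -/
def innerPoints : Finset (ℤ × ℤ) :=
  {(0, 0), (1, 0), (-1, 0), (0, 1), (0, -1), (1, 1), (-1, -1)}

theorem three_le_qf {k : ℤ × ℤ} (hk : k ∉ innerPoints) : 3 ≤ qf (zc k) := by
  obtain ⟨m, n⟩ := k
  have h : (3 : ℤ) ≤ m ^ 2 - m * n + n ^ 2 := by
    by_contra! h
    have hm : m ^ 2 < 4 := by nlinarith [sq_nonneg (m - 2 * n)]
    have hn : n ^ 2 < 4 := by nlinarith [sq_nonneg (2 * m - n)]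
    have hm1 : -2 < m ∧ m < 2 := abs_lt.1 (abs_lt_of_sq_lt_sq (by linarith) (by norm_num))
    have hn1 : -2 < n ∧ n < 2 := abs_lt.1 (abs_lt_of_sq_lt_sq (by linarith) (by norm_num))
    obtain ⟨h1, h2⟩ := hm1
    obtain ⟨h3, h4⟩ := hn1
    interval_cases m <;> interval_cases n <;> simp_all [innerPoints]
  have : ((3 : ℤ) : ℝ) ≤ ((m ^ 2 - m * n + n ^ 2 : ℤ) : ℝ) := Int.cast_le.2 h
  push_cast at this
  simpa [qf, zc] using this

/-- Once `exp(-S/2)` is split off, the exponent left is `S/2 (q - 1) ≥ S ≥ 10`. A quarter of it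
absorbs the polynomial, and the rest yields the small constant and the factor `exp(-q)` that makes
the tail summable. -/
theorem tail_term_le {S q : ℝ} (hS : 10 ≤ S) (hq : 3 ≤ q) :
    Real.exp (-(S / 2) * q) * (q * (S / 2) + 1) ≤
      Real.exp (-(S / 2)) * (1 / 30 * Real.exp (-q)) := by
  have hx : 5 * (q - 1) ≤ S / 2 * (q - 1) := by nlinarith
  have hq2 : S ≤ S / 2 * (q - 1) := by nlinarith
  have hx10 : 10 ≤ S / 2 * (q - 1) := by nlinarith
  have e1 : Real.exp (-(S / 2) * q) = Real.exp (-(S / 2)) * Real.exp (-(S / 2 * (q - 1))) := by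
    rw [← Real.exp_add]; ring_nf
  have e2 : q * (S / 2) + 1 ≤ 8 / 5 * (S / 2 * (q - 1)) := by nlinarith
  rw [e1, mul_assoc]
  refine mul_le_mul_of_nonneg_left ?_ (Real.exp_pos _).le
  generalize S / 2 * (q - 1) = x at *
  have e3 : x ≤ Real.exp (x / 4) := by
    have h1 := Real.add_one_le_exp (x / 4 - 5 / 2)
    have h2 : Real.exp (x / 4) = Real.exp (5 / 2) * Real.exp (x / 4 - 5 / 2) := by
      rw [← Real.exp_add]; ring_nf
    have h3 : 12 ≤ Real.exp (5 / 2) := by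
      have h4 : Real.exp (5 / 2) ^ 2 = Real.exp 5 := by
        rw [← Real.exp_nat_mul]; norm_num
      by_contra! h
      nlinarith [le_exp_five, Real.exp_pos (5 / 2)]
    rw [h2]
    nlinarith
  have e4 : x * Real.exp (-x) ≤ Real.exp (-(3 / 4 * x)) := by
    have : Real.exp (-(3 / 4 * x)) = Real.exp (x / 4) * Real.exp (-x) := by
      rw [← Real.exp_add]; ring_nf
    rw [this]
    exact mul_le_mul_of_nonneg_right e3 (Real.exp_pos _).le
  have e5 : Real.exp (-(3 / 4 * x)) ≤ Real.exp (-4) * Real.exp (-q) := by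
    rw [← Real.exp_add]; apply Real.exp_le_exp.2; linarith
  have e6 : Real.exp (-4) ≤ 1 / 54 := by
    rw [Real.exp_neg, ← one_div]
    apply one_div_le_one_div_of_le (by norm_num)
    have h : Real.exp 4 = Real.exp 1 ^ 4 := by rw [← Real.exp_nat_mul]; norm_num
    have h1 : (2.7182818283 : ℝ) ^ 4 ≤ Real.exp 1 ^ 4 := by
      gcongr; exact Real.exp_one_gt_d9.le
    norm_num at h1
    linarith
  have e7 := mul_le_mul_of_nonneg_left e2 (Real.exp_pos (-x)).le
  have e8 := mul_le_mul_of_nonneg_right e6 (Real.exp_pos (-q)).le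
  linarith [Real.exp_pos (-q)]

/-- The sum of the tail of the Gaussian moments over the reciprocal lattice. -/
theorem tail_sum_le {S : ℝ} (hS : 10 ≤ S) {g : ℤ × ℤ → ℝ} (hg : Summable g) {C : ℝ} (hC : 0 ≤ C)
    (h : ∀ k ∉ innerPoints,
      g k ≤ Real.exp (-(S / 2) * qf (zc k)) * ((qf (zc k) * (S / 2) + 1) * C)) :
    ∑' k, g k ≤ ∑ k ∈ innerPoints, g k + Real.exp (-(S / 2)) * (3 / 10 * C) := by
  rw [← hg.sum_add_tsum_subtype_compl innerPoints]
  have hs := summable_exp_neg_mul_sq_add_sq (c := 1 / 2) (by norm_num)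
  have hs' : Summable fun k : {k // k ∉ innerPoints} => Real.exp (-(S / 2)) * (1 / 30 * C) *
      Real.exp (-(1 / 2) * (((k : ℤ × ℤ).1 : ℝ) ^ 2 + ((k : ℤ × ℤ).2 : ℝ) ^ 2)) :=
    (hs.subtype _).mul_left _
  have h1 : ∑' k : {k // k ∉ innerPoints}, g k ≤ ∑' k : {k // k ∉ innerPoints},
      Real.exp (-(S / 2)) * (1 / 30 * C) *
        Real.exp (-(1 / 2) * (((k : ℤ × ℤ).1 : ℝ) ^ 2 + ((k : ℤ × ℤ).2 : ℝ) ^ 2)) := by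
    refine Summable.tsum_le_tsum (fun k => ?_) (hg.subtype _) hs'
    refine (h k k.2).trans ?_
    have h2 := mul_le_mul_of_nonneg_right (tail_term_le hS (three_le_qf k.2)) hC
    have h3 : Real.exp (-qf (zc k)) ≤
        Real.exp (-(1 / 2) * (((k : ℤ × ℤ).1 : ℝ) ^ 2 + ((k : ℤ × ℤ).2 : ℝ) ^ 2)) := by
      apply Real.exp_le_exp.2
      have := half_le_qf (zc k)
      simp only [zc] at this ⊢
      linarith
    have h4 := mul_le_mul_of_nonneg_left h3
      (by positivity : 0 ≤ Real.exp (-(S / 2)) * (1 / 30 * C))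
    linarith
  have h5 : ∑' k : {k // k ∉ innerPoints}, Real.exp (-(S / 2)) * (1 / 30 * C) *
        Real.exp (-(1 / 2) * (((k : ℤ × ℤ).1 : ℝ) ^ 2 + ((k : ℤ × ℤ).2 : ℝ) ^ 2)) ≤
      Real.exp (-(S / 2)) * (3 / 10 * C) := by
    rw [tsum_mul_left]
    have h6 := Summable.tsum_subtype_le
      (fun k : ℤ × ℤ => Real.exp (-(1 / 2) * ((k.1 : ℝ) ^ 2 + (k.2 : ℝ) ^ 2)))
      {k | k ∉ innerPoints} (fun k => (Real.exp_pos _).le) hs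
    have h7 := mul_le_mul_of_nonneg_left (h6.trans tsum_exp_neg_sq_add_sq_le)
      (by positivity : 0 ≤ Real.exp (-(S / 2)) * (1 / 30 * C))
    refine h7.trans (le_of_eq ?_)
    ring
  linarith

theorem sum_innerPoints (g : ℤ × ℤ → ℝ) : ∑ k ∈ innerPoints, g k = g (0, 0) +
    (g (1, 0) + g (-1, 0)) + (g (0, 1) + g (0, -1)) + (g (1, 1) + g (-1, -1)) := by
  simp [innerPoints]; ring

theorem sum_innerPoints_gaussMoment (S : ℝ) (v : ℝ × ℝ) :
    ∑ k ∈ innerPoints, gaussMoment S v (zc k) = Real.exp (-(S / 2)) * (3 * qf v) := by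
  rw [sum_innerPoints]
  simp [gaussMoment, bf, qf, zc]
  ring_nf

/-! ### Shifted against unshifted second moments -/

theorem moment_sum_ge_of_small {S : ℝ} (hS : 10 ≤ S) (v y : ℝ × ℝ)
    (h1 : |S * bf (1, 0) y| ≤ 5 / 2) (h2 : |S * bf (0, 1) y| ≤ 5 / 2)
    (h3 : |S * bf (1, 1) y| ≤ 5 / 2) :
    9 / 10 * (Real.exp (-(S / 2)) * (qf y * qf v)) ≤
      ∑' k, gaussMoment S v (y + zc k) - ∑' k, gaussMoment S v (zc k) := by
  have hF := summable_gaussMoment (by linarith : 0 < S) v y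
  have hF0 : Summable fun k => gaussMoment S v (zc k) := by
    simpa using summable_gaussMoment (by linarith : 0 < S) v 0
  have hFn : Summable fun k => gaussMoment S v (y + zc (-k)) :=
    (Equiv.neg (ℤ × ℤ)).summable_iff.2 hF
  have hsym : ∑' k, gaussMoment S v (y + zc (-k)) = ∑' k, gaussMoment S v (y + zc k) :=
    (Equiv.neg (ℤ × ℤ)).tsum_eq fun k => gaussMoment S v (y + zc k)
  -- Symmetrising over `k ↦ -k` leaves the sum of the shifted moments unchanged and allows the
  -- paired bound. The tail costs `3/10` of the `6/5` gained on the shell.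
  have hT := tail_sum_le hS (g := fun k => gaussMoment S v (zc k) -
      1 / 2 * (gaussMoment S v (y + zc k) + gaussMoment S v (y + zc (-k))))
    (hF0.sub ((hF.add hFn).mul_left _)) (mul_nonneg (qf_nonneg y) (qf_nonneg v)) (fun k _ => by
      have := gaussMoment_pair_ge (by linarith : 0 ≤ S) v (zc k) y
      rw [zc_neg, ← sub_eq_add_neg]
      linarith)
  rw [hF0.tsum_sub ((hF.add hFn).mul_left _), tsum_mul_left, hF.tsum_add hFn, hsym,
    Finset.sum_sub_distrib, sum_innerPoints_gaussMoment, sum_innerPoints] at hT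
  have hmain := firstShell_moment_ge_of_small hS v y h1 h2 h3
  have z0 : y + zc (0, 0) = y := by ext <;> simp [zc]
  have z0' : y + zc (-(0, 0)) = y := by ext <;> simp [zc]
  have z1 : ∀ m n : ℤ, y + zc (-(m, n)) = y - zc (m, n) := fun m n => by
    rw [zc_neg, sub_eq_add_neg]
  have z2 : zc (1, 0) = (1, 0) ∧ zc (0, 1) = (0, 1) ∧ zc (1, 1) = (1, 1) := by simp [zc]
  have z3 : zc (-1, 0) = -(1, 0) ∧ zc (0, -1) = -(0, 1) ∧ zc (-1, -1) = -(1, 1) := by simp [zc]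
  simp only [z0, z0', z1, z2, z3, sub_neg_eq_add, ← sub_eq_add_neg] at hT
  linarith

/-- The unshifted sum is at most `3 + 3/10` in units of `exp(-S/2) qf v`, its term at the origin
being zero. In the shifted sum four distinct terms already give `27/8`, the others being
nonnegative; the surplus is `3/40`. -/
theorem moment_sum_ge_of_large {S : ℝ} (hS : 10 ≤ S) (v y : ℝ × ℝ) (k k' : ℤ × ℤ)
    (he : qf (zc k) = 1) (he' : qf (zc k') = 1) (hee : bf (zc k) (zc k') = -1 / 2)
    (hd : (0 : ℤ × ℤ) ∉ ({-k, -k', -(k + k')} : Finset (ℤ × ℤ)) ∧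
      -k ∉ ({-k', -(k + k')} : Finset (ℤ × ℤ)) ∧ -k' ∉ ({-(k + k')} : Finset (ℤ × ℤ)))
    (h1 : 0 ≤ bf (zc k) y) (h2 : 0 ≤ bf (zc k') y)
    (h3 : 5 / 2 ≤ S * (bf (zc k) y + bf (zc k') y)) (h4 : bf (zc k) y + bf (zc k') y ≤ 1 / 2) :
    3 / 40 * (Real.exp (-(S / 2)) * qf v) ≤
      ∑' k, gaussMoment S v (y + zc k) - ∑' k, gaussMoment S v (zc k) := by
  have hF := summable_gaussMoment (by linarith : 0 < S) v y
  have hF0 : Summable fun k => gaussMoment S v (zc k) := by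
    simpa using summable_gaussMoment (by linarith : 0 < S) v 0
  have hT := tail_sum_le hS hF0 (qf_nonneg v) (fun k _ => by
    rw [gaussMoment, mul_comm]
    refine mul_le_mul_of_nonneg_left ((bf_sq_le _ _).trans ?_) (Real.exp_pos _).le
    refine mul_le_mul_of_nonneg_right ?_ (qf_nonneg v)
    nlinarith [qf_nonneg (zc k)])
  rw [sum_innerPoints_gaussMoment] at hT
  have h5 := hF.sum_le_tsum {0, -k, -k', -(k + k')} (fun k _ => gaussMoment_nonneg _ _ _)
  rw [Finset.sum_insert hd.1, Finset.sum_insert hd.2.1, Finset.sum_insert hd.2.2,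
    Finset.sum_singleton, zc_neg, zc_neg, zc_neg] at h5
  have h6 : zc (k + k') = zc k + zc k' := by simp [zc]
  have h7 : y + zc 0 = y := by ext <;> simp [zc]
  have h8 := four_points_moment_ge hS v y _ _ he he' hee h1 h2 h3 h4
  rw [h6, h7, ← sub_eq_add_neg, ← sub_eq_add_neg, ← sub_eq_add_neg] at h5
  linarith

/-- The Gaussian moments of the shifted reciprocal lattice are larger than those of the reciprocal
lattice itself, quantitatively. -/
theorem moment_sum_ge {S : ℝ} (hS : 10 ≤ S) (v y : ℝ × ℝ) (h1 : |bf (1, 0) y| ≤ 1 / 2)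
    (h2 : |bf (0, 1) y| ≤ 1 / 2) (h3 : |bf (1, 1) y| ≤ 1 / 2) :
    1 / 5 * (Real.exp (-(S / 2)) * (qf y * qf v)) ≤
      ∑' k, gaussMoment S v (y + zc k) - ∑' k, gaussMoment S v (zc k) := by
  have hE := Real.exp_pos (-(S / 2))
  have hv := qf_nonneg v
  have hy := qf_nonneg y
  by_cases hsmall : |S * bf (1, 0) y| ≤ 5 / 2 ∧ |S * bf (0, 1) y| ≤ 5 / 2 ∧
      |S * bf (1, 1) y| ≤ 5 / 2
  · refine le_trans ?_ (moment_sum_ge_of_small hS v y hsmall.1 hsmall.2.1 hsmall.2.2)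
    have : 0 ≤ Real.exp (-(S / 2)) * (qf y * qf v) := by positivity
    linarith
  have hN : qf y ≤ 1 / 3 := by
    have := sq_mul_qf_le (S := 1) (M := 1 / 2) y (by simpa using h1) (by simpa using h2)
      (by simpa using h3)
    linarith
  -- Enough because `1/5 · 1/3 ≤ 3/40`.
  refine le_trans (b := 3 / 40 * (Real.exp (-(S / 2)) * qf v)) ?_ ?_
  · have := mul_le_mul_of_nonneg_right hN (mul_nonneg hE.le hv)
    have h0 := mul_nonneg hE.le hv
    nlinarith
  have hS0 : (0 : ℝ) ≤ S := by linarith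
  have hb3 : bf (1, 1) y = bf (1, 0) y + bf (0, 1) y := by simp [bf]; ring
  have z1 : bf (zc (1, 0)) y = bf (1, 0) y := by simp [zc]
  have z2 : bf (zc (0, 1)) y = bf (0, 1) y := by simp [zc]
  have z3 : bf (zc (1, 1)) y = bf (1, 1) y := by simp [zc]
  have z4 : bf (zc (-1, 0)) y = -bf (1, 0) y := by simp [zc, bf]; ring
  have z5 : bf (zc (0, -1)) y = -bf (0, 1) y := by simp [zc, bf]; ring
  have z6 : bf (zc (-1, -1)) y = -bf (1, 1) y := by simp [zc, bf]; ring
  simp only [abs_mul, abs_of_nonneg hS0] at hsmall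
  rw [hb3] at hsmall h3 z3 z6
  generalize bf (1, 0) y = a at *
  generalize bf (0, 1) y = b at *
  rw [abs_le] at h1 h2 h3
  have key : ∀ m : ℝ, -m ≤ a → a ≤ m → -m ≤ b → b ≤ m → -m ≤ a + b → a + b ≤ m →
      5 / 2 ≤ S * m := by
    intro m m1 m2 m3 m4 m5 m6
    by_contra! h
    exact hsmall ⟨(mul_le_mul_of_nonneg_left (abs_le.2 ⟨m1, m2⟩) hS0).trans h.le,
      (mul_le_mul_of_nonneg_left (abs_le.2 ⟨m3, m4⟩) hS0).trans h.le,
      (mul_le_mul_of_nonneg_left (abs_le.2 ⟨m5, m6⟩) hS0).trans h.le⟩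
  have fin : ∀ k k' : ℤ × ℤ, qf (zc k) = 1 ∧ qf (zc k') = 1 ∧ bf (zc k) (zc k') = -1 / 2 →
      ((0 : ℤ × ℤ) ∉ ({-k, -k', -(k + k')} : Finset (ℤ × ℤ)) ∧
        -k ∉ ({-k', -(k + k')} : Finset (ℤ × ℤ)) ∧ -k' ∉ ({-(k + k')} : Finset (ℤ × ℤ))) →
      (0 ≤ bf (zc k) y ∧ 0 ≤ bf (zc k') y) ∧
        (5 / 2 ≤ S * (bf (zc k) y + bf (zc k') y) ∧ bf (zc k) y + bf (zc k') y ≤ 1 / 2) →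
      3 / 40 * (Real.exp (-(S / 2)) * qf v) ≤
        ∑' k, gaussMoment S v (y + zc k) - ∑' k, gaussMoment S v (zc k) :=
    fun k k' h1 h2 h3 => moment_sum_ge_of_large hS v y k k' h1.1 h1.2.1 h1.2.2 h2 h3.1.1 h3.1.2
      h3.2.1 h3.2.2
  have hq : ∀ k ∈ ({(1, 0), (0, 1), (1, 1), (-1, 0), (0, -1), (-1, -1)} : Set (ℤ × ℤ)),
      qf (zc k) = 1 := by rintro k (rfl | rfl | rfl | rfl | rfl | rfl) <;> norm_num [qf, zc]
  -- The signs of `a`, `b` and `a + b` cut the cell into six sectors; in each, `k` and `k'` are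
  -- shell vectors at angle `2π/3` with nonnegative pairings, and their sum has the largest pairing.
  rcases le_total 0 a with ha | ha <;> rcases le_total 0 b with hb | hb
  · refine fin (1, 0) (0, 1) ⟨hq _ (by simp), hq _ (by simp), by norm_num [bf, zc]⟩ (by decide) ?_
    rw [z1, z2]
    exact ⟨⟨by linarith, by linarith⟩, by apply key <;> linarith, by linarith⟩
  · rcases le_total 0 (a + b) with hab | hab
    · refine fin (1, 1) (0, -1) ⟨hq _ (by simp), hq _ (by simp), by norm_num [bf, zc]⟩
        (by decide) ?_
      rw [z3, z5]
      exact ⟨⟨by linarith, by linarith⟩, by apply key <;> linarith, by linarith⟩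
    · refine fin (1, 0) (-1, -1) ⟨hq _ (by simp), hq _ (by simp), by norm_num [bf, zc]⟩
        (by decide) ?_
      rw [z1, z6]
      exact ⟨⟨by linarith, by linarith⟩, by apply key <;> linarith, by linarith⟩
  · rcases le_total 0 (a + b) with hab | hab
    · refine fin (1, 1) (-1, 0) ⟨hq _ (by simp), hq _ (by simp), by norm_num [bf, zc]⟩
        (by decide) ?_
      rw [z3, z4]
      exact ⟨⟨by linarith, by linarith⟩, by apply key <;> linarith, by linarith⟩
    · refine fin (0, 1) (-1, -1) ⟨hq _ (by simp), hq _ (by simp), by norm_num [bf, zc]⟩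
        (by decide) ?_
      rw [z2, z6]
      exact ⟨⟨by linarith, by linarith⟩, by apply key <;> linarith, by linarith⟩
  · refine fin (-1, 0) (0, -1) ⟨hq _ (by simp), hq _ (by simp), by norm_num [bf, zc]⟩
      (by decide) ?_
    rw [z4, z5]
    exact ⟨⟨by linarith, by linarith⟩, by apply key <;> linarith, by linarith⟩

/-! ### Poisson summation for the hexagonal lattice -/

/-- The quadratic form of the lattice `A₂`. -/
noncomputable def latForm (z : ℤ × ℤ) : ℝ := (z.1 : ℝ) ^ 2 + z.1 * z.2 + (z.2 : ℝ) ^ 2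

/-- The pairing of a lattice point with a vector given by its pairings with the basis. -/
noncomputable def latPair (z : ℤ × ℤ) (v : ℝ × ℝ) : ℝ := z.1 * v.1 + z.2 * v.2

theorem half_le_latForm (z : ℤ × ℤ) : ((z.1 : ℝ) ^ 2 + (z.2 : ℝ) ^ 2) / 2 ≤ latForm z := by
  unfold latForm; nlinarith [sq_nonneg ((z.1 : ℝ) + z.2)]

theorem latForm_nonneg (z : ℤ × ℤ) : 0 ≤ latForm z :=
  le_trans (by positivity) (half_le_latForm z)

theorem latPair_sq_le (z : ℤ × ℤ) (v : ℝ × ℝ) :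
    latPair z v ^ 2 ≤ 2 * (v.1 ^ 2 + v.2 ^ 2) * latForm z := by
  have h1 : latPair z v ^ 2 ≤ ((z.1 : ℝ) ^ 2 + (z.2 : ℝ) ^ 2) * (v.1 ^ 2 + v.2 ^ 2) := by
    unfold latPair; nlinarith [sq_nonneg ((z.1 : ℝ) * v.2 - z.2 * v.1)]
  nlinarith [half_le_latForm z, sq_nonneg v.1, sq_nonneg v.2]

theorem summable_exp_neg_latForm {c : ℝ} (hc : 0 < c) :
    Summable fun z : ℤ × ℤ => Real.exp (-c * latForm z) := by
  refine Summable.of_nonneg_of_le (fun k => (Real.exp_pos _).le) (fun k => ?_)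
    (summable_exp_neg_mul_sq_add_sq (c := c / 2) (by linarith))
  apply Real.exp_le_exp.2
  nlinarith [half_le_latForm k]

theorem summable_latForm_mul_exp {c : ℝ} (hc : 0 < c) :
    Summable fun z : ℤ × ℤ => latForm z * Real.exp (-c * latForm z) :=
  Summable.of_nonneg_of_le (fun k => mul_nonneg (latForm_nonneg _) (Real.exp_pos _).le)
    (fun k => mul_exp_neg_le hc) ((summable_exp_neg_latForm (by linarith : 0 < c / 2)).mul_left _)

/-- The constant in the Poisson summation formula for `A₂`. -/
noncomputable def poissonConst (a : ℝ) : ℝ :=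
  (1 / a ^ (1 / 2 : ℝ)) * (1 / (3 / 4 * a) ^ (1 / 2 : ℝ))

theorem summable_poisson_complex {a : ℝ} (ha : 0 < a) (θ : ℝ × ℝ) :
    Summable fun z : ℤ × ℤ =>
      Complex.exp (-Real.pi * a * latForm z + 2 * Real.pi * Complex.I * latPair z θ) := by
  apply Summable.of_norm
  refine (summable_exp_neg_latForm (c := Real.pi * a) (by positivity)).congr fun z => ?_
  rw [Complex.norm_exp]
  congr 1
  simp [← Complex.ofReal_neg, ← Complex.ofReal_mul]

/-- Two one-dimensional theta transformations, based on `m² + mn + n² = (m + n/2)² + 3/4 n²`: first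
in `m` with parameter `a`, then in `n` with parameter `3a/4`. -/
theorem poisson_complex {a : ℝ} (ha : 0 < a) (θ : ℝ × ℝ) :
    ∑' z : ℤ × ℤ, Complex.exp (-Real.pi * a * latForm z + 2 * Real.pi * Complex.I * latPair z θ) =
      poissonConst a *
        ∑' k : ℤ × ℤ, Complex.exp (-(4 * Real.pi / (3 * a)) * qf (θ - zc k)) := by
  have hsum := summable_poisson_complex ha θ
  set g : ℤ × ℤ → ℂ := fun p => Complex.exp (-Real.pi * (p.1 - θ.1) ^ 2 / a) *
    Complex.exp (-Real.pi * (3 / 4 * a : ℝ) * p.2 ^ 2 +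
      2 * Real.pi * (Complex.I * ((p.1 - θ.1) / 2 + θ.2)) * p.2) with hg
  -- Absolute summability of the half-transformed family justifies exchanging the order of
  -- summation.
  have hgs : Summable g := by
    apply Summable.of_norm
    have h1 : Summable fun n : ℤ => Real.exp (-(Real.pi / a) * ((n : ℝ) - θ.1) ^ 2) := by
      have := (summable_exp_neg_mul_int_sq (c := Real.pi / (2 * a)) (by positivity)).mul_left
        (Real.exp (Real.pi / a * θ.1 ^ 2))
      refine Summable.of_nonneg_of_le (fun k => (Real.exp_pos _).le) (fun n => ?_) this
      rw [← Real.exp_add]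
      apply Real.exp_le_exp.2
      have : -(Real.pi / a) * ((n : ℝ) - θ.1) ^ 2 = Real.pi / a * θ.1 ^ 2 +
        -(Real.pi / (2 * a)) * (n : ℝ) ^ 2 - Real.pi / (2 * a) * ((n : ℝ) - 2 * θ.1) ^ 2 := by
        field_simp; ring
      rw [this]
      have : 0 ≤ Real.pi / (2 * a) * ((n : ℝ) - 2 * θ.1) ^ 2 := by positivity
      linarith
    have h2 := summable_exp_neg_mul_int_sq (c := Real.pi * (3 / 4 * a)) (by positivity)
    refine (h1.mul_of_nonneg h2 (fun n => (Real.exp_pos _).le)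
      (fun n => (Real.exp_pos _).le)).congr fun p => ?_
    rw [hg, norm_mul, Complex.norm_exp, Complex.norm_exp]
    congr 2
    · have : (-Real.pi * (p.1 - θ.1) ^ 2 / a : ℂ) = ((-(Real.pi / a) * ((p.1 : ℝ) - θ.1) ^ 2 : ℝ) : ℂ) := by
        push_cast; ring
      rw [this, Complex.ofReal_re]
    · have : (-Real.pi * (3 / 4 * a : ℝ) * p.2 ^ 2 +
          2 * Real.pi * (Complex.I * ((p.1 - θ.1) / 2 + θ.2)) * p.2 : ℂ) =
          ((-(Real.pi * (3 / 4 * a)) * (p.2 : ℝ) ^ 2 : ℝ) : ℂ) +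
          ((2 * Real.pi * (((p.1 : ℝ) - θ.1) / 2 + θ.2) * p.2 : ℝ) : ℂ) * Complex.I := by
        push_cast; ring
      rw [this, Complex.add_re, Complex.ofReal_re, Complex.re_ofReal_mul, Complex.I_re]; ring
  have hac : (a : ℂ) ≠ 0 := by exact_mod_cast ha.ne'
  -- the sum over the first coordinate
  have step1 : ∀ n : ℤ, ∑' m : ℤ, Complex.exp (-Real.pi * a * latForm (m, n) +
      2 * Real.pi * Complex.I * latPair (m, n) θ) =
      ((1 / a ^ (1 / 2 : ℝ) : ℝ) : ℂ) * ∑' m : ℤ, g (m, n) := by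
    intro n
    have h := Complex.tsum_exp_neg_quadratic (a := a) (by simpa using ha)
      (-(a * n / 2) + Complex.I * θ.1)
    have e : ∀ m : ℤ, Complex.exp (-Real.pi * a * latForm (m, n) +
        2 * Real.pi * Complex.I * latPair (m, n) θ) =
        Complex.exp (-Real.pi * a * n ^ 2 + 2 * Real.pi * Complex.I * θ.2 * n) *
          Complex.exp (-Real.pi * a * m ^ 2 +
            2 * Real.pi * (-(a * n / 2) + Complex.I * θ.1) * m) := by
      intro m
      rw [← Complex.exp_add]
      congr 1
      simp only [latForm, latPair]
      push_cast
      ring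
    simp only [e]
    rw [tsum_mul_left, h, ← mul_assoc, mul_comm (Complex.exp _), mul_assoc, ← tsum_mul_left]
    congr 1
    · rw [Complex.ofReal_div, Complex.ofReal_cpow ha.le]; push_cast; ring
    · congr 1; ext m
      rw [← Complex.exp_add]
      simp only [hg]
      rw [← Complex.exp_add]
      congr 1
      push_cast
      field_simp
      ring_nf
      simp only [Complex.I_sq, show Complex.I ^ 3 = -Complex.I by
        rw [pow_succ, Complex.I_sq]; ring, Complex.I_pow_four]
      ring
  have step2 : ∀ m : ℤ, ∑' n : ℤ, g (m, n) = ((1 / (3 / 4 * a) ^ (1 / 2 : ℝ) : ℝ) : ℂ) *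
      ∑' n : ℤ, Complex.exp (-(4 * Real.pi / (3 * a)) * qf (θ - zc (m, n))) := by
    intro m
    have h := Complex.tsum_exp_neg_quadratic (a := (3 / 4 * a : ℝ))
      (by rw [Complex.ofReal_re]; linarith) (Complex.I * ((m - θ.1) / 2 + θ.2))
    simp only [hg]
    rw [tsum_mul_left, h, ← mul_assoc, mul_comm (Complex.exp _), mul_assoc, ← tsum_mul_left]
    congr 1
    · rw [Complex.ofReal_div, Complex.ofReal_cpow (by linarith)]; push_cast; ring
    · congr 1; ext n
      rw [← Complex.exp_add]
      congr 1
      simp only [qf, zc, Prod.fst_sub, Prod.snd_sub]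
      push_cast
      field_simp
      ring_nf
      simp only [Complex.I_sq, Complex.I_pow_four]
      ring
  have hsum2 : Summable fun k : ℤ × ℤ =>
      Complex.exp (-(4 * Real.pi / (3 * a)) * qf (θ - zc k)) := by
    have h := (Equiv.neg (ℤ × ℤ)).summable_iff.2
      (summable_exp_neg_mul_qf (c := 4 * Real.pi / (3 * a)) (by positivity) θ)
    refine (Complex.ofRealCLM.summable h).congr fun k => ?_
    simp [zc_neg, ← sub_eq_add_neg]
  have hswap := (Equiv.prodComm ℤ ℤ).tsum_eq fun z : ℤ × ℤ =>
    Complex.exp (-Real.pi * a * latForm z + 2 * Real.pi * Complex.I * latPair z θ)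
  refine (hswap.symm.trans ((Equiv.prodComm ℤ ℤ).summable_iff.2 hsum).tsum_prod).trans ?_
  simp only [Function.comp_def, Equiv.prodComm_apply, Prod.swap_prod_mk]
  rw [tsum_congr step1, tsum_mul_left]
  have : ∑' n : ℤ, ∑' m : ℤ, g (m, n) = ∑' m : ℤ, ∑' n : ℤ, g (m, n) :=
    hgs.tsum_comm (f := fun m n => g (m, n))
  rw [this, tsum_congr step2, tsum_mul_left, hsum2.tsum_prod, poissonConst]
  push_cast
  ring

/-- The real part at `a = S/(2π)`. The parameters `S` and `T = 16π²/(3S)` are dual, with `S T =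
16π²/3`. -/
theorem poisson_real {S : ℝ} (hS : 0 < S) (θ : ℝ × ℝ) :
    ∑' z : ℤ × ℤ, Real.exp (-(S / 2) * latForm z) * Real.cos (2 * Real.pi * latPair z θ) =
      poissonConst (S / (2 * Real.pi)) *
        ∑' k : ℤ × ℤ, Real.exp (-(16 * Real.pi ^ 2 / (3 * S) / 2) * qf (θ + zc k)) := by
  have ha : 0 < S / (2 * Real.pi) := by positivity
  have h := poisson_complex ha θ
  have h1 := (Equiv.neg (ℤ × ℤ)).tsum_eq fun k : ℤ × ℤ =>
    Real.exp (-(16 * Real.pi ^ 2 / (3 * S) / 2) * qf (θ + zc k))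
  rw [← h1]
  have hre := congrArg Complex.re h
  have hsum := summable_poisson_complex ha θ
  rw [Complex.re_tsum hsum, Complex.re_ofReal_mul] at hre
  have hl : ∀ z : ℤ × ℤ, (Complex.exp (-Real.pi * (S / (2 * Real.pi) : ℝ) * latForm z +
        2 * Real.pi * Complex.I * latPair z θ)).re =
      Real.exp (-(S / 2) * latForm z) * Real.cos (2 * Real.pi * latPair z θ) := by
    intro z
    have : (-Real.pi * (S / (2 * Real.pi) : ℝ) * latForm z +
        2 * Real.pi * Complex.I * latPair z θ : ℂ) = ((-(S / 2) * latForm z : ℝ) : ℂ) +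
        ((2 * Real.pi * latPair z θ : ℝ) : ℂ) * Complex.I := by
      push_cast
      field_simp
    rw [this, Complex.exp_re]
    simp
  have hr : ∑' k : ℤ × ℤ, Complex.exp (-(4 * Real.pi / (3 * (S / (2 * Real.pi) : ℝ))) *
      qf (θ - zc k)) = ((∑' k : ℤ × ℤ,
        Real.exp (-(16 * Real.pi ^ 2 / (3 * S) / 2) * qf (θ + zc (-k))) : ℝ) : ℂ) := by
    rw [Complex.ofReal_tsum]
    congr 1; ext k
    rw [zc_neg, ← sub_eq_add_neg, Complex.ofReal_exp]
    congr 1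
    push_cast
    field_simp
    ring
  rw [hr, Complex.ofReal_re, tsum_congr hl] at hre
  exact hre

/-! ### The second moment version of the Poisson summation formula -/

theorem tendsto_cos_secondDiff (c : ℝ) :
    Tendsto (fun t : ℝ => 2 * (Real.cos (c * t) - 1) / t ^ 2) (𝓝[≠] 0) (𝓝 (-c ^ 2)) := by
  have h1 : HasDerivAt (fun t : ℝ => Real.sin (c / 2 * t)) (c / 2) 0 := by
    have := (Real.hasDerivAt_sin (c / 2 * 0)).comp (0 : ℝ) ((hasDerivAt_id (0 : ℝ)).const_mul (c / 2))
    convert! this using 1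
    simp
  have h2 := (hasDerivAt_iff_tendsto_slope.1 h1).pow 2 |>.const_mul (-4)
  refine (h2.congr' ?_).trans (le_of_eq (by congr 1; ring))
  filter_upwards [self_mem_nhdsWithin] with t ht
  have ht : t ≠ 0 := ht
  have : Real.cos (c * t) = 1 - 2 * Real.sin (c / 2 * t) ^ 2 := by
    rw [show c * t = 2 * (c / 2 * t) by ring, Real.cos_two_mul, Real.cos_sq']; ring
  rw [this, slope_def_field]
  simp
  field_simp
  ring

theorem tendsto_gauss_secondDiff (A B : ℝ) :
    Tendsto (fun t : ℝ => 2 * (Real.exp (-A * t ^ 2) * Real.cosh (B * t) - 1) / t ^ 2) (𝓝[≠] 0)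
      (𝓝 (B ^ 2 - 2 * A)) := by
  have h1 : HasDerivAt (fun t : ℝ => Real.sinh (B / 2 * t)) (B / 2) 0 := by
    have := (Real.hasDerivAt_sinh (B / 2 * 0)).comp (0 : ℝ) ((hasDerivAt_id (0 : ℝ)).const_mul (B / 2))
    convert! this using 1
    simp
  have h2 := (hasDerivAt_iff_tendsto_slope.1 h1).pow 2 |>.const_mul 4
  have h3 : HasDerivAt (fun u : ℝ => Real.exp (-A * u)) (-A) 0 := by
    have := (Real.hasDerivAt_exp (-A * 0)).comp (0 : ℝ) ((hasDerivAt_id (0 : ℝ)).const_mul (-A))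
    convert! this using 1
    simp
  have hsq : Tendsto (fun t : ℝ => t ^ 2) (𝓝[≠] 0) (𝓝[≠] 0) := by
    refine tendsto_nhdsWithin_iff.2 ⟨?_, ?_⟩
    · have : Tendsto (fun t : ℝ => t ^ 2) (𝓝 0) (𝓝 (0 ^ 2)) := (continuous_pow 2).tendsto 0
      rw [zero_pow two_ne_zero] at this
      exact this.mono_left nhdsWithin_le_nhds
    · filter_upwards [self_mem_nhdsWithin] with t ht
      exact pow_ne_zero 2 ht
  have h4 := ((hasDerivAt_iff_tendsto_slope.1 h3).comp hsq).const_mul 2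
  have h5 : Tendsto (fun t : ℝ => Real.exp (-A * t ^ 2)) (𝓝[≠] 0) (𝓝 1) := by
    have : Tendsto (fun t : ℝ => Real.exp (-A * t ^ 2)) (𝓝 0) (𝓝 (Real.exp (-A * 0 ^ 2))) :=
      Continuous.tendsto (by fun_prop) 0
    rw [zero_pow two_ne_zero, mul_zero, Real.exp_zero] at this
    exact this.mono_left nhdsWithin_le_nhds
  refine (((h5.mul h2).add h4).congr' ?_).trans (le_of_eq (by congr 1; ring))
  filter_upwards [self_mem_nhdsWithin] with t ht
  have ht : t ≠ 0 := ht
  have : Real.cosh (B * t) = 1 + 2 * Real.sinh (B / 2 * t) ^ 2 := by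
    rw [show B * t = 2 * (B / 2 * t) by ring, Real.cosh_two_mul, Real.cosh_sq]; ring
  rw [this, slope_def_field]
  simp [slope_def_field]
  field_simp
  ring

/-- A domination of the second difference quotients, used to pass to the limit under the sum. -/
theorem abs_gauss_secondDiff_le {A B t : ℝ} (hA : 0 ≤ A) (ht : t ≠ 0) :
    |2 * (Real.exp (-A * t ^ 2) * Real.cosh (B * t) - 1) / t ^ 2| ≤
      2 * A + B ^ 2 * Real.exp (B ^ 2 * t ^ 2 / 2) := by
  have ht2 : 0 < t ^ 2 := by positivity
  rw [abs_div, abs_of_pos ht2, div_le_iff₀ ht2, abs_mul, abs_of_pos (by norm_num : (0 : ℝ) < 2)]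
  have h1 := Real.one_le_cosh (B * t)
  have h2 := Real.cosh_le_exp_half_sq (B * t)
  have h3 : Real.exp (-A * t ^ 2) ≤ 1 := Real.exp_le_one_iff.2 (by nlinarith)
  have h4 := Real.add_one_le_exp (-A * t ^ 2)
  have h5 : Real.exp (B ^ 2 * t ^ 2 / 2) - 1 ≤ B ^ 2 * t ^ 2 / 2 * Real.exp (B ^ 2 * t ^ 2 / 2) := by
    have := Real.add_one_le_exp (-(B ^ 2 * t ^ 2 / 2))
    have h6 : Real.exp (-(B ^ 2 * t ^ 2 / 2)) * Real.exp (B ^ 2 * t ^ 2 / 2) = 1 := by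
      rw [← Real.exp_add]; simp
    nlinarith [Real.exp_pos (B ^ 2 * t ^ 2 / 2)]
  rw [mul_pow] at h2
  have h6 : 0 ≤ B ^ 2 * t ^ 2 * Real.exp (B ^ 2 * t ^ 2 / 2) := by positivity
  have h7 : |Real.exp (-A * t ^ 2) * Real.cosh (B * t) - 1| ≤
      A * t ^ 2 + B ^ 2 * t ^ 2 / 2 * Real.exp (B ^ 2 * t ^ 2 / 2) := by
    rw [abs_le]
    constructor
    · nlinarith [Real.exp_pos (-A * t ^ 2)]
    · nlinarith [mul_nonneg hA ht2.le]
  nlinarith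

theorem latPair_add (z : ℤ × ℤ) (v w : ℝ × ℝ) : latPair z (v + w) = latPair z v + latPair z w := by
  simp [latPair]; ring

theorem latPair_smul (z : ℤ × ℤ) (t : ℝ) (v : ℝ × ℝ) : latPair z (t • v) = t * latPair z v := by
  simp [latPair]; ring

theorem bf_smul_left (t : ℝ) (a c : ℝ × ℝ) : bf (t • a) c = t * bf a c := by
  simp [bf]; ring

theorem qf_smul (t : ℝ) (a : ℝ × ℝ) : qf (t • a) = t ^ 2 * qf a := by
  simp [qf]; ring

theorem summable_exp_latForm_mul {c : ℝ} (hc : 0 < c) {g : ℤ × ℤ → ℝ} {C : ℝ}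
    (hg : ∀ z, |g z| ≤ C) : Summable fun z => Real.exp (-c * latForm z) * g z := by
  refine Summable.of_norm_bounded ((summable_exp_neg_latForm hc).mul_right C) fun z => ?_
  rw [norm_mul, Real.norm_eq_abs, Real.norm_eq_abs, abs_of_pos (Real.exp_pos _)]
  exact mul_le_mul_of_nonneg_left (hg z) (Real.exp_pos _).le

theorem summable_exp_latForm_mul_sq {c : ℝ} (hc : 0 < c) (v : ℝ × ℝ) {g : ℤ × ℤ → ℝ} {C : ℝ}
    (hg : ∀ z, |g z| ≤ C) :
    Summable fun z => Real.exp (-c * latForm z) * (latPair z v ^ 2 * g z) := by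
  refine Summable.of_norm_bounded ((summable_latForm_mul_exp hc).mul_left
    (2 * (v.1 ^ 2 + v.2 ^ 2) * C)) fun z => ?_
  rw [norm_mul, norm_mul, Real.norm_eq_abs, Real.norm_eq_abs, Real.norm_eq_abs,
    abs_of_pos (Real.exp_pos _), abs_of_nonneg (sq_nonneg _)]
  have h := mul_le_mul (latPair_sq_le z v) (hg z) (abs_nonneg _)
    (mul_nonneg (by positivity) (latForm_nonneg z))
  have := mul_le_mul_of_nonneg_left h (Real.exp_pos (-c * latForm z)).le
  linarith

/-- The second derivative of `poisson_real` in direction `v`. It is obtained as the limit of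
symmetric second differences by dominated convergence, so no termwise differentiation of the series
is needed. -/
theorem poisson_secondMoment {S : ℝ} (hS : 0 < S) (θ v : ℝ × ℝ) :
    -(4 * Real.pi ^ 2) * ∑' z : ℤ × ℤ, Real.exp (-(S / 2) * latForm z) *
        (latPair z v ^ 2 * Real.cos (2 * Real.pi * latPair z θ)) =
      poissonConst (S / (2 * Real.pi)) *
        ∑' k : ℤ × ℤ, Real.exp (-(16 * Real.pi ^ 2 / (3 * S) / 2) * qf (θ + zc k)) *
          ((16 * Real.pi ^ 2 / (3 * S)) ^ 2 * bf (θ + zc k) v ^ 2 -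
            16 * Real.pi ^ 2 / (3 * S) * qf v) := by
  set T := 16 * Real.pi ^ 2 / (3 * S) with hT
  have hT0 : 0 < T := by positivity
  set f : ℤ × ℤ → ℝ := fun z => Real.exp (-(S / 2) * latForm z)
  set K := poissonConst (S / (2 * Real.pi))
  have hf : ∀ θ : ℝ × ℝ, Summable fun z => f z * Real.cos (2 * Real.pi * latPair z θ) := fun θ =>
    summable_exp_latForm_mul (by linarith) (C := 1) fun z => Real.abs_cos_le_one _
  have hg := fun θ => summable_exp_neg_mul_qf (c := T / 2) (by linarith) θ
  -- the second differences agree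
  have hdiff : ∀ t : ℝ, ∑' z, f z * (Real.cos (2 * Real.pi * latPair z θ) *
        (2 * (Real.cos (2 * Real.pi * latPair z v * t) - 1) / t ^ 2)) =
      K * ∑' k, Real.exp (-(T / 2) * qf (θ + zc k)) *
        (2 * (Real.exp (-(T / 2 * qf v) * t ^ 2) * Real.cosh (T * bf (θ + zc k) v * t) - 1)
          / t ^ 2) := by
    intro t
    have h1 : ∀ z, f z * (Real.cos (2 * Real.pi * latPair z θ) *
        (2 * (Real.cos (2 * Real.pi * latPair z v * t) - 1) / t ^ 2)) =
        (f z * Real.cos (2 * Real.pi * latPair z (θ + t • v)) +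
          f z * Real.cos (2 * Real.pi * latPair z (θ + (-t) • v)) -
          2 * (f z * Real.cos (2 * Real.pi * latPair z θ))) * (t ^ 2)⁻¹ := by
      intro z
      rw [latPair_add, latPair_add, latPair_smul, latPair_smul, mul_add, mul_add, Real.cos_add,
        Real.cos_add, show 2 * Real.pi * (-t * latPair z v) = -(2 * Real.pi * latPair z v * t) by ring,
        show 2 * Real.pi * (t * latPair z v) = 2 * Real.pi * latPair z v * t by ring,
        Real.cos_neg, Real.sin_neg]
      ring
    have h2 : ∀ k, Real.exp (-(T / 2) * qf (θ + zc k)) *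
        (2 * (Real.exp (-(T / 2 * qf v) * t ^ 2) * Real.cosh (T * bf (θ + zc k) v * t) - 1)
          / t ^ 2) = (Real.exp (-(T / 2) * qf (θ + t • v + zc k)) +
            Real.exp (-(T / 2) * qf (θ + (-t) • v + zc k)) -
            2 * Real.exp (-(T / 2) * qf (θ + zc k))) * (t ^ 2)⁻¹ := by
      intro k
      have e1 : ∀ t : ℝ, Real.exp (-(T / 2) * qf (θ + t • v + zc k)) =
          Real.exp (-(T / 2) * qf (θ + zc k)) * (Real.exp (-(T / 2 * qf v) * t ^ 2) *
            Real.exp (-(T * bf (θ + zc k) v * t))) := by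
        intro t
        rw [← Real.exp_add, ← Real.exp_add,
          show θ + t • v + zc k = (θ + zc k) + t • v by abel, qf_add, qf_smul,
          bf_comm _ (t • v), bf_smul_left, bf_comm v]
        ring_nf
      rw [e1, e1, Real.cosh_eq]
      ring_nf
    simp only [h1, h2]
    rw [tsum_mul_right, tsum_mul_right, Summable.tsum_sub ((hf _).add (hf _)) ((hf _).mul_left 2),
      Summable.tsum_add (hf _) (hf _), Summable.tsum_sub ((hg _).add (hg _)) ((hg _).mul_left 2),
      Summable.tsum_add (hg _) (hg _), tsum_mul_left, tsum_mul_left, poisson_real hS,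
      poisson_real hS, poisson_real hS]
    ring
  have hL : Tendsto (fun t : ℝ => ∑' z, f z * (Real.cos (2 * Real.pi * latPair z θ) *
        (2 * (Real.cos (2 * Real.pi * latPair z v * t) - 1) / t ^ 2))) (𝓝[≠] 0)
      (𝓝 (∑' z, f z * (Real.cos (2 * Real.pi * latPair z θ) *
        (-(2 * Real.pi * latPair z v) ^ 2)))) := by
    have hs : Summable fun z => (4 * Real.pi ^ 2) * (f z * (latPair z v ^ 2 * 1)) :=
      (summable_exp_latForm_mul_sq (by linarith) v (g := fun _ => 1) (C := 1) (by simp)).mul_left _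
    refine tendsto_tsum_of_dominated_convergence hs (fun z => ?_) ?_
    · exact ((tendsto_cos_secondDiff _).const_mul _).const_mul _
    · filter_upwards [self_mem_nhdsWithin] with t ht z
      have ht : t ≠ 0 := ht
      rw [norm_mul, norm_mul, Real.norm_eq_abs, Real.norm_eq_abs, Real.norm_eq_abs,
        abs_of_pos (Real.exp_pos _)]
      have h1 : |2 * (Real.cos (2 * Real.pi * latPair z v * t) - 1) / t ^ 2| ≤
          4 * Real.pi ^ 2 * latPair z v ^ 2 := by
        have ht2 : 0 < t ^ 2 := by positivity
        rw [abs_div, abs_of_pos ht2, div_le_iff₀ ht2, abs_mul, abs_two,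
          abs_of_nonpos (by linarith [Real.cos_le_one (2 * Real.pi * latPair z v * t)])]
        have := Real.one_sub_sq_div_two_le_cos (x := 2 * Real.pi * latPair z v * t)
        linarith
      have h2 := mul_le_mul (Real.abs_cos_le_one (2 * Real.pi * latPair z θ)) h1 (abs_nonneg _)
        zero_le_one
      have := mul_le_mul_of_nonneg_left h2 (Real.exp_pos (-(S / 2) * latForm z)).le
      simp only [f]
      linarith
  have hR : Tendsto (fun t : ℝ => ∑' k, Real.exp (-(T / 2) * qf (θ + zc k)) *
        (2 * (Real.exp (-(T / 2 * qf v) * t ^ 2) * Real.cosh (T * bf (θ + zc k) v * t) - 1)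
          / t ^ 2)) (𝓝[≠] 0)
      (𝓝 (∑' k, Real.exp (-(T / 2) * qf (θ + zc k)) *
        ((T * bf (θ + zc k) v) ^ 2 - 2 * (T / 2 * qf v)))) := by
    have hs : Summable fun k : ℤ × ℤ => Real.exp (-(T / 2) * qf (θ + zc k)) * (2 * (T / 2 * qf v)) +
        T ^ 2 * qf v * (qf (θ + zc k) * Real.exp (-(T / 4) * qf (θ + zc k))) :=
      ((hg θ).mul_right _).add ((summable_qf_mul_exp (by linarith) θ).mul_left _)
    refine tendsto_tsum_of_dominated_convergence hs (fun k => ?_) ?_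
    · exact (tendsto_gauss_secondDiff _ _).const_mul _
    -- For such `t`, half of the Gaussian exponent absorbs the growth `exp(B²t²/2)`.
    · have hev : ∀ᶠ t : ℝ in 𝓝[≠] 0, 2 * T * qf v * t ^ 2 < 1 := by
        have : Tendsto (fun t : ℝ => 2 * T * qf v * t ^ 2) (𝓝 0) (𝓝 (2 * T * qf v * 0 ^ 2)) :=
          Continuous.tendsto (by fun_prop) 0
        simp at this
        exact (this.mono_left nhdsWithin_le_nhds).eventually (gt_mem_nhds one_pos)
      filter_upwards [self_mem_nhdsWithin, hev] with t ht htv k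
      have hqv := qf_nonneg v
      have hqk := qf_nonneg (θ + zc k)
      rw [norm_mul, Real.norm_eq_abs, Real.norm_eq_abs, abs_of_pos (Real.exp_pos _)]
      have h1 := abs_gauss_secondDiff_le (A := T / 2 * qf v) (B := T * bf (θ + zc k) v) (t := t)
        (by positivity) ht
      have h2 := bf_sq_le (θ + zc k) v
      have h3 : Real.exp (-(T / 2) * qf (θ + zc k)) *
          Real.exp ((T * bf (θ + zc k) v) ^ 2 * t ^ 2 / 2) ≤
          Real.exp (-(T / 4) * qf (θ + zc k)) := by
        rw [← Real.exp_add]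
        apply Real.exp_le_exp.2
        have h4 : T ^ 2 * t ^ 2 * bf (θ + zc k) v ^ 2 ≤ T ^ 2 * t ^ 2 * (qf (θ + zc k) * qf v) :=
          mul_le_mul_of_nonneg_left h2 (by positivity)
        have h5 : T * qf (θ + zc k) * (2 * T * qf v * t ^ 2) ≤ T * qf (θ + zc k) * 1 :=
          mul_le_mul_of_nonneg_left htv.le (by positivity)
        nlinarith
      have h6 := mul_le_mul_of_nonneg_left h1 (Real.exp_pos (-(T / 2) * qf (θ + zc k))).le
      refine h6.trans ?_
      rw [mul_add]
      refine add_le_add le_rfl ?_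
      have h7 := mul_le_mul h2 h3 (by positivity) (by positivity)
      have := mul_le_mul_of_nonneg_left h7 (sq_nonneg T)
      linarith
  have huniq := tendsto_nhds_unique hL ((hR.const_mul K).congr fun t => (hdiff t).symm)
  rw [← tsum_mul_left]
  refine Eq.trans ?_ (huniq.trans ?_)
  · congr 1; ext z; simp only [f]; ring
  · congr 2; ext k; ring

/-! ### The dynamical matrix and its dual form -/

/-- The dynamical matrix of the Gaussian interaction on `A₂`, as a quadratic form. -/
noncomputable def dynForm (S : ℝ) (θ v : ℝ × ℝ) : ℝ :=
  ∑' z : ℤ × ℤ, Real.exp (-(S / 2) * latForm z) * ((1 - Real.cos (2 * Real.pi * latPair z θ)) *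
    (3 / 4 * S ^ 2 * latPair z v ^ 2 - S * qf v))

/-- The term `-S qf v` cancels exactly against the `T qf v` produced by differentiating the dual
Gaussian, because `3/4 S² T / (4π²) = S`. Only pure second moments remain. -/
theorem dynForm_eq {S : ℝ} (hS : 0 < S) (θ v : ℝ × ℝ) :
    dynForm S θ v = 16 * Real.pi ^ 2 / 3 * poissonConst (S / (2 * Real.pi)) *
      (∑' k, gaussMoment (16 * Real.pi ^ 2 / (3 * S)) v (θ + zc k) -
        ∑' k, gaussMoment (16 * Real.pi ^ 2 / (3 * S)) v (zc k)) := by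
  set T := 16 * Real.pi ^ 2 / (3 * S) with hT
  have hT0 : 0 < T := by positivity
  have hS2 : 0 < S / 2 := by linarith
  have hc : ∀ (θ : ℝ × ℝ) z, |Real.cos (2 * Real.pi * latPair z θ)| ≤ 1 :=
    fun θ z => Real.abs_cos_le_one _
  have s1 := fun θ => summable_exp_latForm_mul hS2 (hc θ)
  have s2 := fun θ => summable_exp_latForm_mul_sq hS2 v (hc θ)
  have hM : ∀ θ : ℝ × ℝ, ∑' k : ℤ × ℤ, Real.exp (-(T / 2) * qf (θ + zc k)) *
      (T ^ 2 * bf (θ + zc k) v ^ 2 - T * qf v) = T ^ 2 * ∑' k, gaussMoment T v (θ + zc k) -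
        T * qf v * ∑' k, Real.exp (-(T / 2) * qf (θ + zc k)) := by
    intro θ
    rw [← tsum_mul_left, ← tsum_mul_left, ← Summable.tsum_sub
      ((summable_gaussMoment hT0 v θ).mul_left _)
      ((summable_exp_neg_mul_qf (by linarith) θ).mul_left _)]
    congr 1; ext k
    rw [gaussMoment]; ring
  have p1 := fun θ => poisson_real hS θ
  have p2 := fun θ => poisson_secondMoment hS θ v
  simp only [← hT, hM] at p1 p2
  have hD : dynForm S θ v = 3 / 4 * S ^ 2 *
      (∑' z : ℤ × ℤ, Real.exp (-(S / 2) * latForm z) *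
        (latPair z v ^ 2 * Real.cos (2 * Real.pi * latPair z 0)) -
      ∑' z : ℤ × ℤ, Real.exp (-(S / 2) * latForm z) *
        (latPair z v ^ 2 * Real.cos (2 * Real.pi * latPair z θ))) - S * qf v *
      (∑' z : ℤ × ℤ, Real.exp (-(S / 2) * latForm z) * Real.cos (2 * Real.pi * latPair z 0) -
      ∑' z : ℤ × ℤ, Real.exp (-(S / 2) * latForm z) * Real.cos (2 * Real.pi * latPair z θ)) := by
    rw [← Summable.tsum_sub (s1 0) (s1 θ), ← Summable.tsum_sub (s2 0) (s2 θ), ← tsum_mul_left,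
      ← tsum_mul_left, ← Summable.tsum_sub (((s2 0).sub (s2 θ)).mul_left _)
      (((s1 0).sub (s1 θ)).mul_left _), dynForm]
    congr 1; ext z
    simp [latPair]
    ring
  have hpi : (4 * Real.pi ^ 2) ≠ 0 := by positivity
  have e1 : ∀ x y : ℝ, -(4 * Real.pi ^ 2) * x = y → x = -y / (4 * Real.pi ^ 2) := by
    intro x y h; rw [← h]; field_simp
  rw [hD, p1, p1, e1 _ _ (p2 0), e1 _ _ (p2 θ), hT]
  simp only [zero_add]
  field_simp
  ring

/-- The bound `S ≤ 21/4` is just what makes `T ≥ 10`. The prefactor, at least `5`, cancels the `1/5`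
of `moment_sum_ge`. -/
theorem dynForm_ge {S : ℝ} (hS : 0 < S) (hS' : S ≤ 21 / 4) (θ v : ℝ × ℝ)
    (h1 : |bf (1, 0) θ| ≤ 1 / 2) (h2 : |bf (0, 1) θ| ≤ 1 / 2) (h3 : |bf (1, 1) θ| ≤ 1 / 2) :
    Real.exp (-(8 * Real.pi ^ 2 / (3 * S))) * (qf θ * qf v) ≤ dynForm S θ v := by
  have hpi := Real.pi_gt_d2
  have hT : 10 ≤ 16 * Real.pi ^ 2 / (3 * S) := by
    rw [le_div_iff₀ (by positivity)]
    nlinarith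
  have h := moment_sum_ge hT v θ h1 h2 h3
  have hK : 1 ≤ poissonConst (S / (2 * Real.pi)) := by
    have ha : 0 < S / (2 * Real.pi) := by positivity
    have ha1 : S / (2 * Real.pi) ≤ 1 := by
      rw [div_le_one (by positivity)]; linarith
    rw [poissonConst]
    have l1 : 1 ≤ 1 / (S / (2 * Real.pi)) ^ (1 / 2 : ℝ) := by
      rw [one_le_div (by positivity)]
      exact Real.rpow_le_one ha.le ha1 (by norm_num)
    have l2 : 1 ≤ 1 / (3 / 4 * (S / (2 * Real.pi))) ^ (1 / 2 : ℝ) := by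
      rw [one_le_div (by positivity)]
      exact Real.rpow_le_one (by positivity) (by linarith) (by norm_num)
    nlinarith
  have hc : 5 ≤ 16 * Real.pi ^ 2 / 3 * poissonConst (S / (2 * Real.pi)) := by nlinarith
  rw [dynForm_eq hS]
  have hq : 0 ≤ Real.exp (-(16 * Real.pi ^ 2 / (3 * S) / 2)) * (qf θ * qf v) :=
    mul_nonneg (Real.exp_pos _).le (mul_nonneg (qf_nonneg _) (qf_nonneg _))
  have e : -(8 * Real.pi ^ 2 / (3 * S)) = -(16 * Real.pi ^ 2 / (3 * S) / 2) := by ring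
  rw [e]
  have := mul_le_mul hc h (by linarith) (by linarith)
  linarith

/-! ### Fourier weights of the displacement differences -/

/-- The weight `1 - cos (2π x·ω)` of a frequency in the direction of a lattice point. -/
noncomputable def weight (θ : ℝ × ℝ) (z : ℤ × ℤ) : ℝ := 1 - Real.cos (2 * Real.pi * latPair z θ)

/-- The first shell of `A₂`, in coordinates. -/
def shell : Finset (ℤ × ℤ) := {(1, 0), (-1, 0), (0, 1), (0, -1), (1, -1), (-1, 1)}

theorem sum_shell (g : ℤ × ℤ → ℝ) : ∑ z ∈ shell, g z = (g (1, 0) + g (-1, 0)) +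
    (g (0, 1) + g (0, -1)) + (g (1, -1) + g (-1, 1)) := by
  simp [shell]; ring

/-- The total weight of the first shell. -/
noncomputable def shellWeight (θ : ℝ × ℝ) : ℝ := ∑ z ∈ shell, weight θ z

theorem weight_nonneg (θ : ℝ × ℝ) (z : ℤ × ℤ) : 0 ≤ weight θ z := by
  unfold weight; linarith [Real.cos_le_one (2 * Real.pi * latPair z θ)]

theorem weight_neg (θ : ℝ × ℝ) (z : ℤ × ℤ) : weight θ (-z) = weight θ z := by
  have : latPair (-z) θ = -latPair z θ := by simp [latPair]; ring
  rw [weight, weight, this, mul_neg, Real.cos_neg]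

theorem weight_eq_sin (θ : ℝ × ℝ) (z : ℤ × ℤ) :
    weight θ z = 2 * Real.sin (Real.pi * latPair z θ) ^ 2 := by
  rw [weight, show 2 * Real.pi * latPair z θ = 2 * (Real.pi * latPair z θ) by ring,
    Real.cos_two_mul, Real.cos_sq']
  ring

theorem weight_le_sq (θ : ℝ × ℝ) (z : ℤ × ℤ) :
    weight θ z ≤ 2 * Real.pi ^ 2 * latPair z θ ^ 2 := by
  have := Real.one_sub_sq_div_two_le_cos (x := 2 * Real.pi * latPair z θ)
  unfold weight
  linarith

theorem shellWeight_eq (θ : ℝ × ℝ) :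
    shellWeight θ = 2 * (weight θ (1, 0) + weight θ (0, 1) + weight θ (1, -1)) := by
  have h1 := weight_neg θ (1, 0)
  have h2 := weight_neg θ (0, 1)
  have h3 := weight_neg θ (1, -1)
  simp at h1 h2 h3
  rw [shellWeight, sum_shell, h1, h2, h3]; ring

theorem shellWeight_nonneg (θ : ℝ × ℝ) : 0 ≤ shellWeight θ :=
  Finset.sum_nonneg fun z _ => weight_nonneg θ z

theorem shellWeight_le (θ : ℝ × ℝ) : shellWeight θ ≤ 8 * Real.pi ^ 2 * qf θ := by
  rw [shellWeight_eq]
  have h1 := weight_le_sq θ (1, 0)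
  have h2 := weight_le_sq θ (0, 1)
  have h3 := weight_le_sq θ (1, -1)
  simp [latPair] at h1 h2 h3
  unfold qf
  nlinarith

theorem sin_nat_mul_sq_le (n : ℕ) (x : ℝ) : |Real.sin (n * x)| ≤ n * |Real.sin x| := by
  induction n with
  | zero => simp
  | succ n ih =>
    rw [Nat.cast_succ, add_mul, one_mul, Real.sin_add]
    refine (abs_add_le _ _).trans ?_
    rw [abs_mul, abs_mul, add_mul, one_mul]
    have h1 := mul_le_mul ih (Real.abs_cos_le_one x) (abs_nonneg _) (by positivity)
    have h2 := mul_le_mul_of_nonneg_right (Real.abs_cos_le_one (n * x)) (abs_nonneg (Real.sin x))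
    linarith

theorem sin_int_mul_sq_le (m : ℤ) (x : ℝ) :
    Real.sin (m * x) ^ 2 ≤ (m : ℝ) ^ 2 * Real.sin x ^ 2 := by
  have h : |Real.sin (m * x)| ≤ |(m : ℝ)| * |Real.sin x| := by
    have := sin_nat_mul_sq_le m.natAbs x
    rw [Nat.cast_natAbs, Int.cast_abs] at this
    refine le_trans (le_of_eq ?_) this
    rcases abs_choice (m : ℝ) with h | h
    · rw [h]
    · rw [h, neg_mul, Real.sin_neg, abs_neg]
  rw [← mul_pow]
  exact sq_le_sq.2 (by rwa [abs_mul])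

/-- The weight in any direction is controlled by the weight of the first shell. -/
theorem weight_le (θ : ℝ × ℝ) (z : ℤ × ℤ) :
    weight θ z ≤ max ((z.1 : ℝ) ^ 2) ((z.2 : ℝ) ^ 2) * shellWeight θ := by
  have h0 := weight_nonneg θ (1, -1)
  have h1 : weight θ z ≤ 2 * ((z.1 : ℝ) ^ 2 * weight θ (1, 0) + (z.2 : ℝ) ^ 2 * weight θ (0, 1)) := by
    simp only [weight_eq_sin]
    have e : Real.pi * latPair z θ = z.1 * (Real.pi * latPair (1, 0) θ) +
        z.2 * (Real.pi * latPair (0, 1) θ) := by simp [latPair]; ring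
    rw [e, Real.sin_add]
    have h1 := sin_int_mul_sq_le z.1 (Real.pi * latPair (1, 0) θ)
    have h2 := sin_int_mul_sq_le z.2 (Real.pi * latPair (0, 1) θ)
    have h3 := Real.sin_sq_add_cos_sq (z.1 * (Real.pi * latPair (1, 0) θ))
    have h4 := Real.sin_sq_add_cos_sq (z.2 * (Real.pi * latPair (0, 1) θ))
    generalize Real.sin (z.1 * (Real.pi * latPair (1, 0) θ)) = s1 at *
    generalize Real.sin (z.2 * (Real.pi * latPair (0, 1) θ)) = s2 at *
    generalize Real.cos (z.1 * (Real.pi * latPair (1, 0) θ)) = c1 at *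
    generalize Real.cos (z.2 * (Real.pi * latPair (0, 1) θ)) = c2 at *
    have h5 : (s1 * c2 + c1 * s2) ^ 2 ≤ 2 * (s1 ^ 2 * c2 ^ 2 + c1 ^ 2 * s2 ^ 2) := by
      nlinarith [sq_nonneg (s1 * c2 - c1 * s2)]
    have h6 : s1 ^ 2 * c2 ^ 2 ≤ s1 ^ 2 * 1 := mul_le_mul_of_nonneg_left
      (by nlinarith [sq_nonneg s2]) (sq_nonneg _)
    have h7 : c1 ^ 2 * s2 ^ 2 ≤ 1 * s2 ^ 2 := mul_le_mul_of_nonneg_right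
      (by nlinarith [sq_nonneg s1]) (sq_nonneg _)
    linarith
  have h2 := mul_le_mul_of_nonneg_right (le_max_left ((z.1 : ℝ) ^ 2) ((z.2 : ℝ) ^ 2))
    (weight_nonneg θ (1, 0))
  have h3 := mul_le_mul_of_nonneg_right (le_max_right ((z.1 : ℝ) ^ 2) ((z.2 : ℝ) ^ 2))
    (weight_nonneg θ (0, 1))
  have h4 : 0 ≤ max ((z.1 : ℝ) ^ 2) ((z.2 : ℝ) ^ 2) * weight θ (1, -1) :=
    mul_nonneg (le_max_of_le_left (sq_nonneg _)) h0
  rw [shellWeight_eq]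
  linarith

/-- A binary quadratic form whose coefficients satisfy Heron's inequality is nonnegative. -/
theorem heron_form_nonneg {a b c : ℝ} (ha : 0 ≤ a) (hb : 0 ≤ b) (hc : 0 ≤ c)
    (h : (c - a - b) ^ 2 ≤ 4 * (a * b)) (x y : ℝ) :
    0 ≤ (2 * a + 2 * c - b) * x ^ 2 + (2 * b + 2 * c - a) * y ^ 2 +
      (a + b - 5 * c) * (x * y) := by
  have h1 : 0 ≤ 2 * a + 2 * c - b := by
    by_contra! h1
    nlinarith [sq_nonneg (a - c)]
  have h2 : 0 ≤ 2 * b + 2 * c - a := by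
    by_contra! h1
    nlinarith [sq_nonneg (b - c)]
  -- The difference of the two sides is `9 (4ab - (c - a - b)²)`.
  have h3 : (a + b - 5 * c) ^ 2 ≤ 4 * ((2 * a + 2 * c - b) * (2 * b + 2 * c - a)) := by
    nlinarith
  generalize 2 * a + 2 * c - b = p at *
  generalize 2 * b + 2 * c - a = q at *
  generalize a + b - 5 * c = r at *
  rcases h1.eq_or_lt with h4 | h4
  · subst h4
    have : r = 0 := by nlinarith
    subst this
    nlinarith [mul_nonneg h2 (sq_nonneg y)]
  · have : 0 ≤ p * (p * x ^ 2 + q * y ^ 2 + r * (x * y)) := by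
      nlinarith [sq_nonneg (2 * p * x + r * y), mul_nonneg (sub_nonneg.2 h3) (sq_nonneg y)]
    exact nonneg_of_mul_nonneg_right this h4

/-- A Korn type inequality for the first shell of the hexagonal lattice. -/
theorem shell_rigidity (θ v : ℝ × ℝ) :
    1 / 3 * (shellWeight θ * qf v) ≤ ∑ z ∈ shell, weight θ z * latPair z v ^ 2 := by
  have n1 := weight_neg θ (1, 0)
  have n2 := weight_neg θ (0, 1)
  have n3 := weight_neg θ (1, -1)
  simp at n1 n2 n3
  rw [sum_shell, n1, n2, n3, shellWeight_eq]
  simp only [weight_eq_sin, latPair, qf]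
  push_cast
  have e1 : Real.pi * (1 * θ.1 + 0 * θ.2) = Real.pi * θ.1 := by ring
  have e2 : Real.pi * (0 * θ.1 + 1 * θ.2) = Real.pi * θ.2 := by ring
  have e3 : Real.pi * (1 * θ.1 + -1 * θ.2) = Real.pi * θ.1 - Real.pi * θ.2 := by ring
  rw [e1, e2, e3, Real.sin_sub]
  have h3 := Real.sin_sq_add_cos_sq (Real.pi * θ.1)
  have h4 := Real.sin_sq_add_cos_sq (Real.pi * θ.2)
  generalize Real.sin (Real.pi * θ.1) = s1 at *
  generalize Real.sin (Real.pi * θ.2) = s2 at *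
  generalize Real.cos (Real.pi * θ.1) = c1 at *
  generalize Real.cos (Real.pi * θ.2) = c2 at *
  obtain ⟨x, y⟩ := v
  simp only
  set s3 := s1 * c2 - c1 * s2 with hs3
  -- The three sines obey the law of cosines, `s3² - s1² - s2² = -2 s1 s2 cos`, with the cosine of
  -- the difference of the angles.
  have heron : (s3 ^ 2 - s1 ^ 2 - s2 ^ 2) ^ 2 ≤ 4 * (s1 ^ 2 * s2 ^ 2) := by
    have : s3 ^ 2 - s1 ^ 2 - s2 ^ 2 = -2 * s1 * s2 * (c1 * c2 + s1 * s2) := by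
      rw [hs3]; linear_combination (s1 ^ 2) * h4 + s2 ^ 2 * h3 
    rw [this]
    have h5 : (c1 * c2 + s1 * s2) ^ 2 ≤ 1 := by
      have : (c1 * c2 + s1 * s2) ^ 2 + (s1 * c2 - c1 * s2) ^ 2 = 1 := by
        have : (c1 * c2 + s1 * s2) ^ 2 + (s1 * c2 - c1 * s2) ^ 2 =
          (s1 ^ 2 + c1 ^ 2) * (s2 ^ 2 + c2 ^ 2) := by ring
        rw [this, h3, h4, one_mul]
      nlinarith [sq_nonneg (s1 * c2 - c1 * s2)]
    have := mul_le_mul_of_nonneg_left h5 (mul_nonneg (sq_nonneg s1) (sq_nonneg s2))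
    linarith
  -- The difference of the two sides of the claim is `4/3` of this form.
  have hq := heron_form_nonneg (sq_nonneg s1) (sq_nonneg s2) (sq_nonneg s3) heron x y
  nlinarith

/-! ### Lattice points beyond the first shell -/

/-- The points of `A₂` outside of the first shell, up to the third one. -/
def outerPoints : Finset (ℤ × ℤ) :=
  {(1, 1), (-1, -1), (2, -1), (-2, 1), (1, -2), (-1, 2), (2, 0), (-2, 0), (0, 2), (0, -2),
    (2, -2), (-2, 2)}

theorem seven_le_latForm {z : ℤ × ℤ} (h0 : z ≠ 0) (h1 : z ∉ shell) (h2 : z ∉ outerPoints) :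
    7 ≤ latForm z := by
  obtain ⟨m, n⟩ := z
  have h : (7 : ℤ) ≤ m ^ 2 + m * n + n ^ 2 := by
    by_contra! h
    have hm : m ^ 2 < 9 := by nlinarith [sq_nonneg (m + 2 * n)]
    have hn : n ^ 2 < 9 := by nlinarith [sq_nonneg (2 * m + n)]
    have hm1 : -3 < m ∧ m < 3 := abs_lt.1 (abs_lt_of_sq_lt_sq (by linarith) (by norm_num))
    have hn1 : -3 < n ∧ n < 3 := abs_lt.1 (abs_lt_of_sq_lt_sq (by linarith) (by norm_num))
    obtain ⟨h5, h6⟩ := hm1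
    obtain ⟨h3, h4⟩ := hn1
    interval_cases m <;> interval_cases n <;> simp_all [shell, outerPoints]
  have : ((7 : ℤ) : ℝ) ≤ ((m ^ 2 + m * n + n ^ 2 : ℤ) : ℝ) := Int.cast_le.2 h
  push_cast at this
  simpa [latForm] using this

theorem max_sq_le_latForm (z : ℤ × ℤ) :
    max ((z.1 : ℝ) ^ 2) ((z.2 : ℝ) ^ 2) ≤ 4 / 3 * latForm z := by
  unfold latForm
  apply max_le
  · nlinarith [sq_nonneg ((z.1 : ℝ) + 2 * z.2)]
  · nlinarith [sq_nonneg (2 * (z.1 : ℝ) + z.2)]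

theorem exp_neg_nat_le (n : ℕ) : Real.exp (-n) ≤ 1 / (2.718 : ℝ) ^ n := by
  rw [Real.exp_neg, ← one_div]
  apply one_div_le_one_div_of_le (by positivity)
  rw [← mul_one (n : ℝ), Real.exp_nat_mul]
  gcongr
  exact le_trans (by norm_num) Real.exp_one_gt_d9.le

/-- The exponent `S/2 (q - 1)` is at least `8 + q + 5/8 (q - 7)`; the three parts give the small
constant, the summable factor, and control of the polynomial. -/
theorem far_term_le {S q : ℝ} (hS : 21 / 4 ≤ S) (hq : 7 ≤ q) :
    Real.exp (-(S / 2) * q) * (4 / 3 * q) ≤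
      Real.exp (-(S / 2)) * (1 / 250 * Real.exp (-q)) := by
  have h1 : 4 / 3 * q ≤ 28 / 3 * Real.exp (5 / 8 * (q - 7)) := by
    have := Real.add_one_le_exp (5 / 8 * (q - 7))
    linarith
  have h2 : Real.exp (-(S / 2) * q) ≤
      Real.exp (-(S / 2)) * (Real.exp (-8) * (Real.exp (-q) * Real.exp (-(5 / 8 * (q - 7))))) := by
    rw [← Real.exp_add, ← Real.exp_add, ← Real.exp_add]
    apply Real.exp_le_exp.2
    nlinarith
  have h3 : Real.exp (-8) ≤ 1 / 2500 := by
    have := exp_neg_nat_le 8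
    norm_num at this
    linarith
  have h4 : Real.exp (-(5 / 8 * (q - 7))) * Real.exp (5 / 8 * (q - 7)) = 1 := by
    rw [← Real.exp_add]; simp
  have h5 := mul_le_mul h2 h1 (by linarith) (by positivity)
  refine h5.trans ?_
  have h6 : Real.exp (-(S / 2)) * (Real.exp (-8) * (Real.exp (-q) *
      Real.exp (-(5 / 8 * (q - 7))))) * (28 / 3 * Real.exp (5 / 8 * (q - 7))) =
      Real.exp (-(S / 2)) * (Real.exp (-q) * (28 / 3 * Real.exp (-8))) *
        (Real.exp (-(5 / 8 * (q - 7))) * Real.exp (5 / 8 * (q - 7))) := by ring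
  rw [h6, h4, mul_one]
  refine mul_le_mul_of_nonneg_left ?_ (Real.exp_pos _).le
  nlinarith [Real.exp_pos (-q)]

theorem summable_exp_mul_max {S : ℝ} (hS : 0 < S) : Summable fun z : ℤ × ℤ =>
    Real.exp (-(S / 2) * latForm z) * max ((z.1 : ℝ) ^ 2) ((z.2 : ℝ) ^ 2) := by
  refine Summable.of_nonneg_of_le (fun z => mul_nonneg (Real.exp_pos _).le
    (le_max_of_le_left (sq_nonneg _))) (fun z => ?_)
    ((summable_latForm_mul_exp (c := S / 2) (by linarith)).mul_left (4 / 3))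
  have := mul_le_mul_of_nonneg_left (max_sq_le_latForm z) (Real.exp_pos (-(S / 2) * latForm z)).le
  linarith

/-- The lattice points outside of the first shell contribute little. -/
theorem far_sum_le {S : ℝ} (hS : 21 / 4 ≤ S) :
    ∑' z : ℤ × ℤ, Real.exp (-(S / 2) * latForm z) * max ((z.1 : ℝ) ^ 2) ((z.2 : ℝ) ^ 2) ≤
      ∑ z ∈ shell, Real.exp (-(S / 2) * latForm z) * max ((z.1 : ℝ) ^ 2) ((z.2 : ℝ) ^ 2) +
      Real.exp (-(S / 2)) * (1 / 5) := by
  set h : ℤ × ℤ → ℝ := fun z =>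
    Real.exp (-(S / 2) * latForm z) * max ((z.1 : ℝ) ^ 2) ((z.2 : ℝ) ^ 2) with hh
  have hs : Summable h := summable_exp_mul_max (by linarith)
  rw [← hs.sum_add_tsum_subtype_compl (shell ∪ insert 0 outerPoints)]
  have hd : Disjoint shell (insert 0 outerPoints) := by decide
  have hd0 : (0 : ℤ × ℤ) ∉ outerPoints := by decide
  have h00 : h 0 = 0 := by simp [hh]
  rw [Finset.sum_union hd, Finset.sum_insert hd0, h00]
  have h1 : ∑ z ∈ outerPoints, h z ≤ Real.exp (-(S / 2)) * (3 / 20) := by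
    -- Six points have form `3`, with maxima `1, 1, 4, 4, 4, 4`; six have form `4`, all with maximum
    -- `4`.
    have : ∑ z ∈ outerPoints, h z = 18 * Real.exp (-(S / 2) * 3) + 24 * Real.exp (-(S / 2) * 4) := by
      simp [outerPoints, hh, latForm]
      norm_num
      ring
    rw [this]
    have e1 : Real.exp (-(S / 2) * 3) ≤ Real.exp (-(S / 2)) * Real.exp (-(5 : ℕ)) := by
      rw [← Real.exp_add]; apply Real.exp_le_exp.2; push_cast; linarith
    have e2 : Real.exp (-(S / 2) * 4) ≤ Real.exp (-(S / 2)) * Real.exp (-(7 : ℕ)) := by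
      rw [← Real.exp_add]; apply Real.exp_le_exp.2; push_cast; linarith
    have e3 : 18 * Real.exp (-(5 : ℕ)) + 24 * Real.exp (-(7 : ℕ)) ≤ 3 / 20 := by
      have := exp_neg_nat_le 5
      have := exp_neg_nat_le 7
      norm_num at *
      linarith
    have := mul_le_mul_of_nonneg_left e3 (Real.exp_pos (-(S / 2))).le
    linarith
  have hs' := summable_exp_neg_mul_sq_add_sq (c := 1 / 2) (by norm_num)
  have h2 : ∑' z : {z // z ∉ shell ∪ insert 0 outerPoints}, h z ≤
      ∑' z : {z // z ∉ shell ∪ insert 0 outerPoints}, Real.exp (-(S / 2)) * (1 / 250) *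
        Real.exp (-(1 / 2) * (((z : ℤ × ℤ).1 : ℝ) ^ 2 + ((z : ℤ × ℤ).2 : ℝ) ^ 2)) := by
    refine Summable.tsum_le_tsum (fun z => ?_) (hs.subtype _) ((hs'.subtype _).mul_left _)
    have hz := z.2
    simp only [Finset.mem_union, Finset.mem_insert, not_or] at hz
    have h3 := far_term_le hS (seven_le_latForm hz.2.1 hz.1 hz.2.2)
    have h4 := mul_le_mul_of_nonneg_left (max_sq_le_latForm z)
      (Real.exp_pos (-(S / 2) * latForm z)).le
    have h5 : Real.exp (-latForm z) ≤
        Real.exp (-(1 / 2) * (((z : ℤ × ℤ).1 : ℝ) ^ 2 + ((z : ℤ × ℤ).2 : ℝ) ^ 2)) := by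
      apply Real.exp_le_exp.2
      linarith [half_le_latForm z]
    have h6 := mul_le_mul_of_nonneg_left h5
      (by positivity : 0 ≤ Real.exp (-(S / 2)) * (1 / 250))
    simp only [hh]
    linarith
  have h3 : ∑' z : {z // z ∉ shell ∪ insert 0 outerPoints}, Real.exp (-(S / 2)) * (1 / 250) *
        Real.exp (-(1 / 2) * (((z : ℤ × ℤ).1 : ℝ) ^ 2 + ((z : ℤ × ℤ).2 : ℝ) ^ 2)) ≤
      Real.exp (-(S / 2)) * (9 / 250) := by
    rw [tsum_mul_left]
    have h6 := Summable.tsum_subtype_le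
      (fun k : ℤ × ℤ => Real.exp (-(1 / 2) * ((k.1 : ℝ) ^ 2 + (k.2 : ℝ) ^ 2)))
      {z | z ∉ shell ∪ insert 0 outerPoints} (fun k => (Real.exp_pos _).le) hs'
    have h7 := mul_le_mul_of_nonneg_left (h6.trans tsum_exp_neg_sq_add_sq_le)
      (by positivity : 0 ≤ Real.exp (-(S / 2)) * (1 / 250))
    refine h7.trans (le_of_eq ?_)
    ring
  have := Real.exp_pos (-(S / 2))
  linarith

/-! ### Coordinates on the hexagonal lattice -/

theorem rStar_pos : 0 < rStar := by unfold rStar; positivity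

theorem rStar_sq : rStar ^ 2 = 2 / √3 := by
  unfold rStar; exact Real.sq_sqrt (by positivity)

theorem rStar_sq_sq : (rStar ^ 2) ^ 2 = 4 / 3 := by
  rw [rStar_sq, div_pow, Real.sq_sqrt (by norm_num)]; norm_num

theorem rStar_sq_bounds : 1 ≤ rStar ^ 2 ∧ rStar ^ 2 ≤ 6 / 5 := by
  have h := rStar_sq_sq
  have h0 := sq_nonneg rStar
  constructor <;> nlinarith

theorem rStar_sq_mul_sqrt : rStar ^ 2 * √3 = 2 := by
  rw [rStar_sq]; field_simp

/-- The pairings of a vector with the basis of `A₂`. -/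
noncomputable def coord (v : Plane) : ℝ × ℝ := (inner ℝ latSigma v, inner ℝ latTau v)

theorem coord_fst (v : Plane) : (coord v).1 = rStar * v 0 := by
  simp [coord, latSigma, PiLp.inner_apply, Fin.sum_univ_two]; ring

theorem coord_snd (v : Plane) :
    (coord v).2 = rStar * (1 / 2) * v 0 + rStar * (√3 / 2) * v 1 := by
  simp [coord, latTau, PiLp.inner_apply, Fin.sum_univ_two]; ring

theorem norm_sq_eq (v : Plane) : ‖v‖ ^ 2 = v 0 ^ 2 + v 1 ^ 2 := by
  rw [EuclideanSpace.real_norm_sq_eq, Fin.sum_univ_two]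

/-- Pairings with `σ, τ` are coordinates in the dual basis, whose Gram form is `r⋆² qf` because `r⋆⁴
= 4/3`. -/
theorem norm_sq_eq_qf (v : Plane) : ‖v‖ ^ 2 = rStar ^ 2 * qf (coord v) := by
  rw [norm_sq_eq, qf, coord_fst, coord_snd]
  have h := rStar_sq_sq
  have h3 : √3 ^ 2 = 3 := Real.sq_sqrt (by norm_num)
  linear_combination (-(3 / 4) * (v 0 ^ 2 + v 1 ^ 2)) * h -
    (rStar ^ 4 * v 1 ^ 2 / 4) * h3

/-- The lattice point with coordinates `z`. -/
noncomputable def pt (z : ℤ × ℤ) : Plane := z.1 • latSigma + z.2 • latTau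

theorem pt_mem (z : ℤ × ℤ) : pt z ∈ A2 :=
  add_mem (zsmul_mem (AddSubgroup.subset_closure (by simp)) _)
    (zsmul_mem (AddSubgroup.subset_closure (by simp)) _)

theorem pt_add (z z' : ℤ × ℤ) : pt (z + z') = pt z + pt z' := by
  simp only [pt, Prod.fst_add, Prod.snd_add, add_smul]; abel

theorem pt_zero : pt 0 = 0 := by simp [pt]

theorem inner_pt (z : ℤ × ℤ) (v : Plane) : inner ℝ (pt z) v = latPair z (coord v) := by
  rw [pt, inner_add_left, ← Int.cast_smul_eq_zsmul ℝ, ← Int.cast_smul_eq_zsmul ℝ,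
    real_inner_smul_left, real_inner_smul_left]
  rfl

theorem pt_apply_zero (z : ℤ × ℤ) : pt z 0 = rStar * (z.1 + z.2 / 2) := by
  rw [pt, ← Int.cast_smul_eq_zsmul ℝ, ← Int.cast_smul_eq_zsmul ℝ]
  simp [latSigma, latTau]; ring

theorem pt_apply_one (z : ℤ × ℤ) : pt z 1 = rStar * (√3 / 2 * z.2) := by
  rw [pt, ← Int.cast_smul_eq_zsmul ℝ, ← Int.cast_smul_eq_zsmul ℝ]
  simp [latSigma, latTau]; ring

theorem norm_pt_sq (z : ℤ × ℤ) : ‖pt z‖ ^ 2 = rStar ^ 2 * latForm z := by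
  rw [norm_sq_eq, pt_apply_zero, pt_apply_one, latForm]
  have h3 : √3 ^ 2 = 3 := Real.sq_sqrt (by norm_num)
  linear_combination (rStar ^ 2 * z.2 ^ 2 / 4) * h3

theorem latForm_eq_zero {z : ℤ × ℤ} (h : latForm z = 0) : z = 0 := by
  have h1 := half_le_latForm z
  have h2 : (z.1 : ℝ) ^ 2 = 0 := by nlinarith [sq_nonneg (z.1 : ℝ), sq_nonneg (z.2 : ℝ)]
  have h3 : (z.2 : ℝ) ^ 2 = 0 := by nlinarith [sq_nonneg (z.1 : ℝ), sq_nonneg (z.2 : ℝ)]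
  ext
  · simpa using h2
  · simpa using h3

/-- The coordinates on `A₂`, as an isomorphism of groups. -/
noncomputable def latHom : ℤ × ℤ →+ A2 where
  toFun z := ⟨pt z, pt_mem z⟩
  map_zero' := Subtype.ext pt_zero
  map_add' z z' := Subtype.ext (pt_add z z')

theorem latHom_bijective : Function.Bijective latHom := by
  constructor
  · rw [injective_iff_map_eq_zero]
    intro z hz
    have h : pt z = 0 := congrArg Subtype.val hz
    have h1 := norm_pt_sq z
    rw [h, norm_zero] at h1
    have := rStar_sq_bounds.1
    exact latForm_eq_zero (by nlinarith [latForm_nonneg z])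
  · rintro ⟨x, hx⟩
    have : ∃ z, pt z = x := by
      refine AddSubgroup.closure_induction (p := fun x _ => ∃ z, pt z = x) ?_ ?_ ?_ ?_ hx
      · rintro x (rfl | rfl)
        · exact ⟨(1, 0), by simp [pt]⟩
        · exact ⟨(0, 1), by simp [pt]⟩
      · exact ⟨0, pt_zero⟩
      · rintro x y _ _ ⟨z, rfl⟩ ⟨z', rfl⟩
        exact ⟨z + z', pt_add z z'⟩
      · rintro x _ ⟨z, rfl⟩
        exact ⟨-z, by simp [pt, add_comm]⟩
    obtain ⟨z, hz⟩ := this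
    exact ⟨z, Subtype.ext hz⟩

noncomputable def latEquiv : ℤ × ℤ ≃+ A2 := AddEquiv.ofBijective latHom latHom_bijective

theorem latEquiv_coe (z : ℤ × ℤ) : ((latEquiv z : A2) : Plane) = pt z := rfl

theorem norm_pt_eq_rStar_iff (z : ℤ × ℤ) : ‖pt z‖ = rStar ↔ z ∈ shell := by
  have h1 : ‖pt z‖ = rStar ↔ latForm z = 1 := by
    rw [← sq_eq_sq₀ (norm_nonneg _) rStar_pos.le, norm_pt_sq]
    have := rStar_sq_bounds.1
    constructor
    · intro h; nlinarith
    · intro h; rw [h, mul_one]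
  rw [h1]
  constructor
  · intro h
    obtain ⟨m, n⟩ := z
    have h : m ^ 2 + m * n + n ^ 2 = 1 := by
      unfold latForm at h; exact_mod_cast h
    have hm : m ^ 2 < 4 := by nlinarith [sq_nonneg (m + 2 * n)]
    have hn : n ^ 2 < 4 := by nlinarith [sq_nonneg (2 * m + n)]
    have hm1 : -2 < m ∧ m < 2 := abs_lt.1 (abs_lt_of_sq_lt_sq (by linarith) (by norm_num))
    have hn1 : -2 < n ∧ n < 2 := abs_lt.1 (abs_lt_of_sq_lt_sq (by linarith) (by norm_num))
    obtain ⟨h5, h6⟩ := hm1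
    obtain ⟨h3, h4⟩ := hn1
    interval_cases m <;> interval_cases n <;> simp_all [shell]
  · intro h
    simp only [shell, Finset.mem_insert, Finset.mem_singleton] at h
    rcases h with rfl | rfl | rfl | rfl | rfl | rfl <;> norm_num [latForm]

theorem firstShell_eq : firstShell = latEquiv '' (shell : Set (ℤ × ℤ)) := by
  ext x
  obtain ⟨z, rfl⟩ := latEquiv.surjective x
  simp only [firstShell, Set.mem_ofPred_eq, latEquiv_coe, norm_pt_eq_rStar_iff]
  simp

/-! ### The cell of the reciprocal lattice -/

/-- The rotation by the angle `π/2`. -/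
noncomputable def rot (u : Plane) : Plane := !₂[-u 1, u 0]

theorem rot_zero_apply (u : Plane) : rot u 0 = -u 1 := by simp [rot]

theorem rot_one_apply (u : Plane) : rot u 1 = u 0 := by simp [rot]

theorem mem_dualCell_iff (ω : Plane) : ω ∈ dualCell ↔ ∃ u ∈ hexCell, rot u = ω := Iff.rfl

theorem hexCell_inner_le {u : Plane} (hu : u ∈ hexCell) (z : ℤ × ℤ) :
    2 * inner ℝ (pt z) u ≤ rStar ^ 2 * latForm z := by
  have h := hu _ (pt_mem z)
  have h1 : ‖u‖ ^ 2 ≤ ‖u - pt z‖ ^ 2 := by gcongr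
  rw [norm_sub_sq_real, norm_pt_sq, real_inner_comm] at h1
  linarith

/-- The quarter turn, with a scaling by `√3/2` in these coordinates, takes shell vectors of `A₂` to
shell vectors of the reciprocal lattice. The bisector conditions of the Voronoi cell carry over, and
`r⋆²√3 = 2` normalises the bound. -/
theorem bf_le_of_mem_dualCell {ω : Plane} (hω : ω ∈ dualCell) :
    |bf (1, 0) (coord ω)| ≤ 1 / 2 ∧ |bf (0, 1) (coord ω)| ≤ 1 / 2 ∧
      |bf (1, 1) (coord ω)| ≤ 1 / 2 := by
  obtain ⟨u, hu, rfl⟩ := (mem_dualCell_iff ω).1 hω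
  have h3 : √3 ^ 2 = 3 := Real.sq_sqrt (by norm_num)
  have h30 : 0 < √3 := by positivity
  have hr := rStar_sq_mul_sqrt
  have key : ∀ z ∈ shell, -(√3 / 2 * inner ℝ (pt z) u) ≤ 1 / 2 ∧
      √3 / 2 * inner ℝ (pt z) u ≤ 1 / 2 := by
    intro z hz
    have hQ : latForm z = 1 := by
      have h1 := (norm_pt_eq_rStar_iff z).2 hz
      have h2 := norm_pt_sq z
      rw [h1] at h2
      have := rStar_sq_bounds.1
      nlinarith
    have h1 := hexCell_inner_le hu z
    have h2 := hexCell_inner_le hu (-z)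
    have h4 : pt (-z) = -pt z := by simp [pt, add_comm]
    have h5 : latForm (-z) = latForm z := by simp [latForm]
    rw [h4, inner_neg_left, h5] at h2
    rw [hQ, mul_one] at h1 h2
    constructor <;> nlinarith
  have e1 : bf (1, 0) (coord (rot u)) = -(√3 / 2 * inner ℝ (pt (0, 1)) u) := by
    rw [inner_pt]; simp only [bf, latPair, coord_fst, coord_snd, rot_zero_apply, rot_one_apply]
    push_cast
    linear_combination (rStar * u 1 / 4) * h3
  have e2 : bf (0, 1) (coord (rot u)) = √3 / 2 * inner ℝ (pt (1, 0)) u := by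
    rw [inner_pt]; simp only [bf, latPair, coord_fst, coord_snd, rot_zero_apply, rot_one_apply]
    push_cast
    ring
  have e3 : bf (1, 1) (coord (rot u)) = √3 / 2 * inner ℝ (pt (1, -1)) u := by
    rw [inner_pt]; simp only [bf, latPair, coord_fst, coord_snd, rot_zero_apply, rot_one_apply]
    push_cast
    linear_combination (rStar * u 1 / 4) * h3
  have k1 := key (0, 1) (by decide)
  have k2 := key (1, 0) (by decide)
  have k3 := key (1, -1) (by decide)
  rw [e1, e2, e3, abs_le, abs_le, abs_le]
  exact ⟨⟨by linarith, by linarith⟩, ⟨by linarith, by linarith⟩, ⟨by linarith, by linarith⟩⟩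

/-- Jordan's inequality on either side of `1/2`; at `t = 2/3` the bound `2(1 - t) ≥ t` is an
equality. -/
theorem abs_le_abs_sin_pi_mul {t : ℝ} (ht : |t| ≤ 2 / 3) : |t| ≤ |Real.sin (Real.pi * t)| := by
  wlog h0 : 0 ≤ t generalizing t
  · have := this (t := -t) (by rwa [abs_neg]) (by linarith)
    rwa [abs_neg, mul_neg, Real.sin_neg, abs_neg] at this
  rw [abs_of_nonneg h0] at *
  have hpi := Real.pi_pos
  refine le_trans ?_ (le_abs_self _)
  rcases le_total t (1 / 2) with h | h
  · have := Real.mul_le_sin (x := Real.pi * t) (by positivity) (by nlinarith)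
    have e : 2 / Real.pi * (Real.pi * t) = 2 * t := by field_simp
    linarith
  · have := Real.mul_le_sin (x := Real.pi * (1 - t)) (mul_nonneg hpi.le (by linarith)) (by nlinarith)
    have e : 2 / Real.pi * (Real.pi * (1 - t)) = 2 * (1 - t) := by field_simp
    have e2 : Real.sin (Real.pi * t) = Real.sin (Real.pi * (1 - t)) := by
      rw [mul_sub, mul_one, Real.sin_pi_sub]
    rw [e2]
    linarith

/-- In the cell the frequency pairs with each shell vector to at most `2/3` in absolute value, so
every sine is bounded below linearly. This is what compares `SM` with `FS`. -/
theorem qf_le_shellWeight {θ : ℝ × ℝ} (h1 : |bf (1, 0) θ| ≤ 1 / 2) (h2 : |bf (0, 1) θ| ≤ 1 / 2)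
    (h3 : |bf (1, 1) θ| ≤ 1 / 2) : 8 * qf θ ≤ shellWeight θ := by
  have key : ∀ z : ℤ × ℤ, |latPair z θ| ≤ 2 / 3 → 2 * latPair z θ ^ 2 ≤ weight θ z := by
    intro z hz
    rw [weight_eq_sin]
    have := sq_le_sq.2 (abs_le_abs_sin_pi_mul hz)
    linarith
  rw [abs_le] at h1 h2 h3
  simp only [bf] at h1 h2 h3
  have k1 := key (1, 0) (by rw [abs_le]; simp [latPair]; constructor <;> linarith)
  have k2 := key (0, 1) (by rw [abs_le]; simp [latPair]; constructor <;> linarith)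
  have k3 := key (1, -1) (by rw [abs_le]; simp [latPair]; constructor <;> linarith)
  rw [shellWeight_eq]
  simp [latPair] at k1 k2 k3
  unfold qf
  nlinarith

theorem finite_setOf_latForm_le (C : ℝ) : {z : ℤ × ℤ | latForm z ≤ C}.Finite := by
  refine ((Set.finite_Icc (-⌈2 * C⌉) ⌈2 * C⌉).prod (Set.finite_Icc (-⌈2 * C⌉) ⌈2 * C⌉)).subset ?_
  rintro z (hz : latForm z ≤ C)
  have h := half_le_latForm z
  have key : ∀ m : ℤ, (m : ℝ) ^ 2 ≤ 2 * C → m ∈ Set.Icc (-⌈2 * C⌉) ⌈2 * C⌉ := by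
    intro m hm
    have h1 : ((m ^ 2 : ℤ) : ℝ) ≤ ⌈2 * C⌉ := by push_cast; exact hm.trans (Int.le_ceil _)
    have h2 : m ^ 2 ≤ ⌈2 * C⌉ := by exact_mod_cast h1
    constructor <;> nlinarith [Int.le_self_sq m, Int.le_self_sq (-m)]
  exact ⟨key _ (by nlinarith [sq_nonneg (z.2 : ℝ)]), key _ (by nlinarith [sq_nonneg (z.1 : ℝ)])⟩

theorem exists_nearest (u : Plane) : ∃ z : ℤ × ℤ, ∀ z', ‖u - pt z‖ ≤ ‖u - pt z'‖ := by
  have hfin : {z : ℤ × ℤ | ‖u - pt z‖ ≤ ‖u‖}.Finite := by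
    refine (finite_setOf_latForm_le (4 * ‖u‖ ^ 2)).subset fun z (hz : ‖u - pt z‖ ≤ ‖u‖) => ?_
    have h1 : ‖pt z‖ ≤ 2 * ‖u‖ := by
      have := norm_sub_norm_le (pt z) u
      rw [norm_sub_rev] at this
      linarith
    have h2 : ‖pt z‖ ^ 2 ≤ (2 * ‖u‖) ^ 2 := by gcongr
    rw [norm_pt_sq] at h2
    have := mul_le_mul_of_nonneg_right rStar_sq_bounds.1 (latForm_nonneg z)
    simp only [Set.mem_ofPred_eq]
    linarith
  have h0 : (0 : ℤ × ℤ) ∈ {z : ℤ × ℤ | ‖u - pt z‖ ≤ ‖u‖} := by simp [pt_zero]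
  obtain ⟨z, hz, hmin⟩ := Set.exists_min_image _ (fun z => ‖u - pt z‖) hfin ⟨0, h0⟩
  refine ⟨z, fun z' => ?_⟩
  by_cases h : ‖u - pt z'‖ ≤ ‖u‖
  · exact hmin z' h
  · exact le_trans hz (not_le.1 h).le

/-- Every frequency is equivalent to one in the cell of the reciprocal lattice. -/
theorem exists_mem_dualCell (θ : ℝ × ℝ) :
    ∃ ω ∈ dualCell, ∃ k : ℤ × ℤ, coord ω = θ + zc k := by
  have hr := rStar_sq_mul_sqrt
  have hr0 := rStar_pos.ne'
  -- Chosen so that `coord (rot u) = θ`; subtracting the nearest lattice point from `u` moves `θ` by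
  -- a reciprocal lattice vector.
  set u : Plane := !₂[(θ.2 - θ.1 / 2) * 2 / (rStar * √3), -(θ.1 / rStar)] with hu
  have u0 : u 0 = (θ.2 - θ.1 / 2) * 2 / (rStar * √3) := by simp [hu]
  have u1 : u 1 = -(θ.1 / rStar) := by simp [hu]
  obtain ⟨z, hz⟩ := exists_nearest u
  refine ⟨rot (u - pt z), ⟨u - pt z, ?_, rfl⟩, (z.2, -z.1), ?_⟩
  · intro x hx
    obtain ⟨z', hz'⟩ := latEquiv.surjective ⟨x, hx⟩
    have hx' : pt z' = x := congrArg Subtype.val hz'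
    rw [← hx', sub_sub, ← pt_add]
    exact hz _
  · ext
    · rw [coord_fst, rot_zero_apply, PiLp.sub_apply, u1, pt_apply_one]
      simp only [zc, Prod.fst_add]
      field_simp
      linear_combination (z.2 : ℝ) * hr
    · rw [coord_snd, rot_zero_apply, rot_one_apply, PiLp.sub_apply, PiLp.sub_apply, u0, u1,
        pt_apply_zero, pt_apply_one]
      simp only [zc, Prod.snd_add]
      field_simp
      push_cast
      linear_combination (-2 * (z.1 : ℝ)) * hr

/-! ### Fourier analysis of periodic perturbations -/

/-- The phases of the character at `σ` and `τ` are the pairings of a frequency with the basis.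
Moving it into the cell by the reciprocal lattice changes no cosine. -/
theorem exists_frequency {L : AddSubgroup A2} [L.FiniteIndex] (χ : AddChar (A2 ⧸ L) ℂ) :
    ∃ ω ∈ dualCell, ∀ x : A2, (χ (QuotientAddGroup.mk x)).re =
      Real.cos (2 * Real.pi * inner ℝ (x : Plane) ω) := by
  have hnorm : ∀ q, ‖χ q‖ = 1 := fun q => AddChar.norm_apply χ q
  have harg : ∀ q, χ q = Complex.exp ((2 * Real.pi * (Complex.arg (χ q) / (2 * Real.pi)) : ℝ) *
      Complex.I) := by
    intro q
    rw [mul_div_cancel₀ _ (by positivity : (2 * Real.pi) ≠ 0)]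
    conv_lhs => rw [← Complex.norm_mul_exp_arg_mul_I (χ q), hnorm]
    simp
  set s : A2 ⧸ L := QuotientAddGroup.mk (latEquiv (1, 0)) with hs
  set t : A2 ⧸ L := QuotientAddGroup.mk (latEquiv (0, 1)) with ht
  obtain ⟨φ₁, hφ₁⟩ : ∃ φ : ℝ, χ s = Complex.exp ((2 * Real.pi * φ : ℝ) * Complex.I) := ⟨_, harg s⟩
  obtain ⟨φ₂, hφ₂⟩ : ∃ φ : ℝ, χ t = Complex.exp ((2 * Real.pi * φ : ℝ) * Complex.I) := ⟨_, harg t⟩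
  obtain ⟨ω, hω, k, hk⟩ := exists_mem_dualCell (φ₁, φ₂)
  refine ⟨ω, hω, fun x => ?_⟩
  obtain ⟨z, rfl⟩ := latEquiv.surjective x
  rw [latEquiv_coe, inner_pt, hk, latPair_add]
  have hz : (QuotientAddGroup.mk (latEquiv z) : A2 ⧸ L) = z.1 • s + z.2 • t := by
    rw [hs, ht, ← QuotientAddGroup.mk_zsmul, ← QuotientAddGroup.mk_zsmul, ← QuotientAddGroup.mk_add,
      ← map_zsmul, ← map_zsmul, ← map_add]
    simp
  rw [hz, AddChar.map_add_eq_mul, AddChar.map_zsmul_eq_zpow, AddChar.map_zsmul_eq_zpow, hφ₁,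
    hφ₂, ← Complex.exp_int_mul, ← Complex.exp_int_mul, ← Complex.exp_add]
  have hcos : ∀ y : ℝ, Real.cos (2 * Real.pi * (y + latPair z (zc k))) = Real.cos (2 * Real.pi * y) := by
    intro y
    have : latPair z (zc k) = ((z.1 * k.1 + z.2 * k.2 : ℤ) : ℝ) := by simp [latPair, zc]
    rw [this, mul_add, mul_comm (2 * Real.pi) ((_ : ℤ) : ℝ), Real.cos_add_int_mul_two_pi]
  rw [hcos]
  have e : ∀ x y : ℝ, ((z.1 : ℂ) * (((2 * Real.pi * x : ℝ) : ℂ) * Complex.I) +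
      (z.2 : ℂ) * (((2 * Real.pi * y : ℝ) : ℂ) * Complex.I)) =
      ((2 * Real.pi * latPair z (x, y) : ℝ) : ℂ) * Complex.I := by
    intro x y; simp only [latPair]; push_cast; ring
  rw [e, Complex.exp_ofReal_mul_I_re]

theorem periodMean_eq_sum (L : AddSubgroup A2) [Fintype (A2 ⧸ L)] (g : A2 → ℝ) :
    periodMean L g = (Fintype.card (A2 ⧸ L) : ℝ)⁻¹ * ∑ q : A2 ⧸ L, g q.out := by
  rw [periodMean, finsum_eq_sum_of_fintype, AddSubgroup.index, Nat.card_eq_fintype_card]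

theorem IsPeriodic.apply_eq {L : AddSubgroup A2} {p : A2 → Plane} (hp : IsPeriodic L p) {x y : A2}
    (h : (QuotientAddGroup.mk x : A2 ⧸ L) = QuotientAddGroup.mk y) : p x = p y := by
  rw [QuotientAddGroup.eq] at h
  have := hp x _ h
  rwa [add_neg_cancel_left, eq_comm] at this

theorem IsPeriodic.apply_out_add {L : AddSubgroup A2} {p : A2 → Plane} (hp : IsPeriodic L p)
    (q : A2 ⧸ L) (x : A2) : p (q.out + x) = p (q + (x : A2 ⧸ L)).out := by
  apply hp.apply_eq
  rw [QuotientAddGroup.mk_add, QuotientAddGroup.out_eq', QuotientAddGroup.out_eq']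

open scoped ComplexConjugate in
/-- The Fourier expansion of a correlation of two functions on a finite abelian group. -/
theorem correlation_eq_sum {Q : Type*} [AddCommGroup Q] [Fintype Q] (f g : Q → ℝ) (y : Q) :
    (((Fintype.card Q : ℝ)⁻¹ * ∑ q, f (q + y) * g q : ℝ) : ℂ) =
      ∑ χ : AddChar Q ℂ, χ y * (((Fintype.card Q : ℂ)⁻¹ * ∑ q, χ (-q) * f q) *
        conj ((Fintype.card Q : ℂ)⁻¹ * ∑ q, χ (-q) * g q)) := by
  classical
  have hN : (Fintype.card Q : ℂ) ≠ 0 := by exact_mod_cast Fintype.card_ne_zero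
  have h1 : ∀ χ : AddChar Q ℂ, χ y * (((Fintype.card Q : ℂ)⁻¹ * ∑ q, χ (-q) * f q) *
        conj ((Fintype.card Q : ℂ)⁻¹ * ∑ q, χ (-q) * g q)) =
      (Fintype.card Q : ℂ)⁻¹ ^ 2 * ∑ q', ∑ q, (f q * g q' : ℂ) * χ (y - q + q') := by
    intro χ
    rw [map_mul, map_sum, map_inv₀, Complex.conj_natCast]
    have : ∑ q', ∑ q, (f q * g q' : ℂ) * χ (y - q + q') =
        χ y * ((∑ q, χ (-q) * f q) * ∑ q', conj (χ (-q') * g q')) := by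
      rw [Finset.sum_mul_sum, Finset.sum_comm, Finset.mul_sum]
      refine Finset.sum_congr rfl fun q _ => ?_
      rw [Finset.mul_sum]
      refine Finset.sum_congr rfl fun q' _ => ?_
      rw [map_mul, Complex.conj_ofReal, ← AddChar.map_neg_eq_conj, neg_neg, AddChar.map_add_eq_mul,
        sub_eq_add_neg, AddChar.map_add_eq_mul]
      ring
    rw [this]; ring
  simp only [h1]
  rw [← Finset.mul_sum, Finset.sum_comm]
  have h2 : ∀ q', ∑ χ : AddChar Q ℂ, ∑ q, (f q * g q' : ℂ) * χ (y - q + q') =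
      Fintype.card Q * (f (q' + y) * g q') := by
    intro q'
    rw [Finset.sum_comm]
    simp only [← Finset.mul_sum, AddChar.sum_apply_eq_ite]
    rw [Finset.sum_eq_single (q' + y)]
    · rw [if_pos (by abel)]; ring
    · intro q _ hq
      rw [if_neg, mul_zero]
      intro h
      apply hq
      rw [eq_comm, ← sub_eq_zero, ← h]; abel
    · simp
  simp only [h2]
  rw [← Finset.mul_sum]
  push_cast
  field_simp

/-- The spectral decomposition of a periodic perturbation. -/
theorem exists_modes {L : AddSubgroup A2} [L.FiniteIndex] {p : A2 → Plane} (hp : IsPeriodic L p) :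
    ∃ (J : Type) (_ : Fintype J) (ω a : J → Plane), (∀ j, ω j ∈ dualCell) ∧
      ∀ (x : A2) (i k : Fin 2), autocorr L p x i k =
        ∑ j, Real.cos (2 * Real.pi * inner ℝ (x : Plane) (ω j)) * (a j i * a j k) := by
  classical
  have : Fintype (A2 ⧸ L) := Fintype.ofFinite _
  choose ω hω hcos using fun χ : AddChar (A2 ⧸ L) ℂ => exists_frequency χ
  set F : Fin 2 → AddChar (A2 ⧸ L) ℂ → ℂ := fun i χ =>
    (Fintype.card (A2 ⧸ L) : ℂ)⁻¹ * ∑ q : A2 ⧸ L, χ (-q) * (p q.out i : ℂ) with hF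
  -- Each character contributes a Hermitian rank one matrix `F F*`, whose real part is the sum of
  -- two real rank one matrices, from the real and the imaginary part of `F`. The symmetrisation in
  -- `autocorr` removes the sine terms.
  refine ⟨AddChar (A2 ⧸ L) ℂ × Fin 2, inferInstance, fun j => ω j.1,
    fun j => !₂[![(F 0 j.1).re, (F 0 j.1).im] j.2, ![(F 1 j.1).re, (F 1 j.1).im] j.2],
    fun j => hω _, fun x i k => ?_⟩
  have hcorr : ∀ i k, periodMean L (fun x' => p (x + x') i * p x' k) =
      (∑ χ, χ (x : A2 ⧸ L) * (F i χ * (starRingEnd ℂ) (F k χ))).re := by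
    intro i k
    have := correlation_eq_sum (fun q : A2 ⧸ L => p q.out i) (fun q : A2 ⧸ L => p q.out k)
      (x : A2 ⧸ L)
    rw [← this, Complex.ofReal_re, periodMean_eq_sum]
    congr 1
    refine Finset.sum_congr rfl fun q _ => ?_
    rw [add_comm x, hp.apply_out_add]
  have hsym : autocorr L p x i k = 1 / 2 * (periodMean L (fun x' => p (x + x') i * p x' k) +
      periodMean L (fun x' => p (x + x') k * p x' i)) := by
    simp only [autocorr, Matrix.of_apply, periodMean_eq_sum]
    rw [← mul_add, ← Finset.sum_add_distrib, ← Finset.mul_sum]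
    ring
  rw [hsym, hcorr, hcorr, Fintype.sum_prod_type, ← Complex.add_re, ← Finset.sum_add_distrib,
    Complex.re_sum, Finset.mul_sum]
  refine Finset.sum_congr rfl fun χ _ => ?_
  simp only [← hcos χ x, Fin.sum_univ_two]
  generalize χ (x : A2 ⧸ L) = c
  fin_cases i <;> fin_cases k <;>
    simp [Complex.mul_re, Complex.mul_im] <;> ring

/-! ### Averages over a period -/

/-- The displacement of `x' + x` relative to `x'`. -/
def disp (p : A2 → Plane) (x x' : A2) : Plane := p (x' + x) - p x'

theorem isPeriodic_disp {L : AddSubgroup A2} {p : A2 → Plane} (hp : IsPeriodic L p) (x : A2) :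
    IsPeriodic L (disp p x) := by
  intro x' y hy
  simp only [disp]
  rw [hp x' y hy, add_right_comm, hp _ y hy]

section
variable {L : AddSubgroup A2} [L.FiniteIndex]

theorem periodMean_add (f g : A2 → ℝ) :
    periodMean L (fun x => f x + g x) = periodMean L f + periodMean L g := by
  have : Fintype (A2 ⧸ L) := Fintype.ofFinite _
  simp only [periodMean_eq_sum, Finset.sum_add_distrib, mul_add]

theorem periodMean_const_mul (c : ℝ) (g : A2 → ℝ) :
    periodMean L (fun x => c * g x) = c * periodMean L g := by
  have : Fintype (A2 ⧸ L) := Fintype.ofFinite _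
  simp only [periodMean_eq_sum, ← Finset.mul_sum]
  ring

theorem periodMean_sub (f g : A2 → ℝ) :
    periodMean L (fun x => f x - g x) = periodMean L f - periodMean L g := by
  have : Fintype (A2 ⧸ L) := Fintype.ofFinite _
  simp only [periodMean_eq_sum, Finset.sum_sub_distrib, mul_sub]

theorem periodMean_sum {ι : Type*} (s : Finset ι) (f : ι → A2 → ℝ) :
    periodMean L (fun x => ∑ i ∈ s, f i x) = ∑ i ∈ s, periodMean L (f i) := by
  have : Fintype (A2 ⧸ L) := Fintype.ofFinite _
  simp only [periodMean_eq_sum]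
  rw [Finset.sum_comm, Finset.mul_sum]

theorem periodMean_const (c : ℝ) : periodMean L (fun _ => c) = c := by
  have : Fintype (A2 ⧸ L) := Fintype.ofFinite _
  have h : (Fintype.card (A2 ⧸ L) : ℝ) ≠ 0 := by exact_mod_cast Fintype.card_ne_zero
  simp only [periodMean_eq_sum, Finset.sum_const, Finset.card_univ, nsmul_eq_mul]
  field_simp

theorem periodMean_mono {f g : A2 → ℝ} (h : ∀ x, f x ≤ g x) : periodMean L f ≤ periodMean L g := by
  have : Fintype (A2 ⧸ L) := Fintype.ofFinite _
  simp only [periodMean_eq_sum]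
  gcongr with q
  exact h _

theorem periodMean_nonneg {f : A2 → ℝ} (h : ∀ x, 0 ≤ f x) : 0 ≤ periodMean L f := by
  have := periodMean_mono (L := L) h
  rwa [periodMean_const] at this

theorem periodMean_shift {g : A2 → ℝ} (hg : ∀ x, ∀ y ∈ L, g (x + y) = g x) (x : A2) :
    periodMean L (fun x' => g (x' + x)) = periodMean L g := by
  have : Fintype (A2 ⧸ L) := Fintype.ofFinite _
  simp only [periodMean_eq_sum]
  congr 1
  have hg' : ∀ {x y : A2}, (QuotientAddGroup.mk x : A2 ⧸ L) = QuotientAddGroup.mk y →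
      g x = g y := by
    intro x y h
    rw [QuotientAddGroup.eq] at h
    have := hg x _ h
    rwa [add_neg_cancel_left, eq_comm] at this
  rw [← Equiv.sum_comp (Equiv.addRight (x : A2 ⧸ L)) (fun q => g q.out)]
  refine Finset.sum_congr rfl fun q _ => hg' ?_
  rw [QuotientAddGroup.mk_add, QuotientAddGroup.out_eq', QuotientAddGroup.out_eq']
  rfl

/-- Translation invariance of the mean. This removes the first order term from the expansion of the
energy. -/
theorem IsPeriodic.periodMean_disp {p : A2 → Plane} (hp : IsPeriodic L p) (x : A2) (v : Plane) :
    periodMean L (fun x' => inner ℝ v (disp p x x')) = 0 := by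
  simp only [disp, inner_sub_right]
  rw [periodMean_sub, periodMean_shift (g := fun x' => inner ℝ v (p x')), sub_self]
  intro x y hy
  simp only [hp x y hy]

theorem autocorr_bilin (p : A2 → Plane) (x : A2) (v : Plane) :
    periodMean L (fun x' => inner ℝ v (p (x' + x)) * inner ℝ v (p x')) =
      ∑ i, ∑ k, v i * v k * autocorr L p x i k := by
  simp only [autocorr, Matrix.of_apply, Fin.sum_univ_two, ← periodMean_const_mul, ← periodMean_add]
  congr 1
  funext x'
  rw [add_comm x' x]
  simp only [PiLp.inner_apply, Fin.sum_univ_two, RCLike.inner_apply, conj_trivial]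
  ring

theorem IsPeriodic.mean_sq_disp {p : A2 → Plane} (hp : IsPeriodic L p) (x : A2) (v : Plane) :
    periodMean L (fun x' => inner ℝ v (disp p x x') ^ 2) =
      2 * ∑ i, ∑ k, v i * v k * (autocorr L p 0 i k - autocorr L p x i k) := by
  have h1 := autocorr_bilin (L := L) p x v
  have h2 := autocorr_bilin (L := L) p 0 v
  have h3 : periodMean L (fun x' => inner ℝ v (p (x' + x)) * inner ℝ v (p (x' + x))) =
      periodMean L (fun x' => inner ℝ v (p x') * inner ℝ v (p x')) :=
    periodMean_shift (g := fun x' => inner ℝ v (p x') * inner ℝ v (p x'))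
      (fun x y hy => by simp only [hp x y hy]) x
  simp only [add_zero] at h2
  have h4 : periodMean L (fun x' => inner ℝ v (disp p x x') ^ 2) =
      periodMean L (fun x' => inner ℝ v (p (x' + x)) * inner ℝ v (p (x' + x))) +
      periodMean L (fun x' => inner ℝ v (p x') * inner ℝ v (p x')) -
      2 * periodMean L (fun x' => inner ℝ v (p (x' + x)) * inner ℝ v (p x')) := by
    rw [← periodMean_const_mul, ← periodMean_add, ← periodMean_sub]
    congr 1
    funext x'
    rw [disp, inner_sub_right]
    ring
  rw [h4, h3, h2, h1]
  simp only [mul_sub, Finset.sum_sub_distrib]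
  ring

theorem IsPeriodic.mean_norm_sq_disp {p : A2 → Plane} (hp : IsPeriodic L p) (x : A2) :
    periodMean L (fun x' => ‖disp p x x'‖ ^ 2) =
      2 * ∑ i, (autocorr L p 0 i i - autocorr L p x i i) := by
  have h0 := hp.mean_sq_disp x !₂[1, 0]
  have h1 := hp.mean_sq_disp x !₂[0, 1]
  simp only [norm_sq_eq, periodMean_add, Fin.sum_univ_two]
  simp [PiLp.inner_apply, Fin.sum_univ_two] at h0 h1
  rw [h0, h1]
  ring

end

theorem FS_eq_sum (L : AddSubgroup A2) [L.FiniteIndex] (p : A2 → Plane) :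
    FS L p = ∑ z ∈ shell, periodMean L (fun x' => ‖disp p (latEquiv z) x'‖ ^ 2) := by
  have : Fintype (A2 ⧸ L) := Fintype.ofFinite _
  rw [FS, firstShell_eq, finsum_mem_image latEquiv.injective.injOn, finsum_mem_coe_finset]
  refine Finset.sum_congr rfl fun z _ => ?_
  rw [relDisp, integral_smul_measure, Measure.sum_fintype, integral_finsetSum_measure]
  · simp only [integral_dirac, periodMean_eq_sum, disp]
    rw [AddSubgroup.index, Nat.card_eq_fintype_card]
    simp
  · intro q _
    exact integrable_dirac (by simp)

/-- The spectral form of the moments of the relative displacements. -/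
theorem IsPeriodic.exists_spectral_moments {L : AddSubgroup A2} [L.FiniteIndex] {p : A2 → Plane}
    (hp : IsPeriodic L p) :
    ∃ (J : Type) (_ : Fintype J) (θ ν : J → ℝ × ℝ),
      (∀ j, |bf (1, 0) (θ j)| ≤ 1 / 2 ∧ |bf (0, 1) (θ j)| ≤ 1 / 2 ∧ |bf (1, 1) (θ j)| ≤ 1 / 2) ∧
      (∀ z, periodMean L (fun x' => ‖disp p (latEquiv z) x'‖ ^ 2) =
        ∑ j, 2 * weight (θ j) z * (rStar ^ 2 * qf (ν j))) ∧
      (∀ z, periodMean L (fun x' => inner ℝ (pt z) (disp p (latEquiv z) x') ^ 2) =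
        ∑ j, 2 * weight (θ j) z * latPair z (ν j) ^ 2) := by
  obtain ⟨J, hJ, ω, a, hω, h⟩ := exists_modes hp
  refine ⟨J, hJ, fun j => coord (ω j), fun j => coord (a j), fun j => bf_le_of_mem_dualCell (hω j),
    fun z => ?_, fun z => ?_⟩
  · rw [hp.mean_norm_sq_disp, Finset.mul_sum]
    simp only [h, ← Finset.sum_sub_distrib, Finset.mul_sum]
    rw [Finset.sum_comm]
    refine Finset.sum_congr rfl fun j _ => ?_
    rw [← norm_sq_eq_qf, norm_sq_eq, latEquiv_coe, inner_pt, weight]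
    simp [Fin.sum_univ_two]
    ring
  · rw [hp.mean_sq_disp]
    simp only [h, ← Finset.sum_sub_distrib, Finset.mul_sum]
    have : ∀ F : Fin 2 → Fin 2 → J → ℝ, ∑ i, ∑ k, ∑ j, F i k j = ∑ j, ∑ i, ∑ k, F i k j := by
      intro F
      simp [Fin.sum_univ_two, Finset.sum_add_distrib]
    rw [this]
    refine Finset.sum_congr rfl fun j _ => ?_
    rw [← inner_pt, latEquiv_coe, inner_pt z (ω j), weight]
    simp [Fin.sum_univ_two, PiLp.inner_apply]
    ring

/-! ### Counting lattice points in disks -/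

theorem finite_setOf_norm_pt_le (ρ : ℝ) : {z : ℤ × ℤ | ‖pt z‖ ≤ ρ}.Finite := by
  refine (finite_setOf_latForm_le (ρ ^ 2)).subset fun z (hz : ‖pt z‖ ≤ ρ) => ?_
  have h : ‖pt z‖ ^ 2 ≤ ρ ^ 2 := by gcongr
  rw [norm_pt_sq] at h
  have := mul_le_mul_of_nonneg_right rStar_sq_bounds.1 (latForm_nonneg z)
  simp only [Set.mem_ofPred_eq]
  linarith

/-- The coordinates of the lattice points in the disk of radius `ρ`. -/
noncomputable def ballFin (ρ : ℝ) : Finset (ℤ × ℤ) := (finite_setOf_norm_pt_le ρ).toFinset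

theorem mem_ballFin {ρ : ℝ} {z : ℤ × ℤ} : z ∈ ballFin ρ ↔ ‖pt z‖ ≤ ρ := by
  simp [ballFin]

/-- The linear map taking real coordinates to vectors. -/
noncomputable def latLin : (Fin 2 → ℝ) →ₗ[ℝ] Plane :=
  (LinearMap.toSpanSingleton ℝ Plane latSigma).comp (LinearMap.proj 0) +
    (LinearMap.toSpanSingleton ℝ Plane latTau).comp (LinearMap.proj 1)

theorem latLin_apply (v : Fin 2 → ℝ) : latLin v = v 0 • latSigma + v 1 • latTau := by
  simp [latLin]

theorem norm_latLin_sq (v : Fin 2 → ℝ) :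
    ‖latLin v‖ ^ 2 = rStar ^ 2 * (v 0 ^ 2 + v 0 * v 1 + v 1 ^ 2) := by
  rw [norm_sq_eq, latLin_apply]
  simp [latSigma, latTau]
  have h3 : √3 ^ 2 = 3 := Real.sq_sqrt (by norm_num)
  linear_combination (rStar ^ 2 * v 1 ^ 2 / 4) * h3

open scoped Pointwise in
-- Points of `ℤ²` are counted in dilates of a convex body, the preimage of the unit disk under
-- `latLin`; the limit is its area.
theorem exists_tendsto_card_ballFin :
    ∃ V : ℝ, 0 < V ∧ Tendsto (fun ρ : ℝ => ((ballFin ρ).card : ℝ) / ρ ^ 2) atTop (𝓝 V) := by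
  set s : Set (Fin 2 → ℝ) := {v | ‖latLin v‖ ≤ 1} with hs
  have hcont : Continuous latLin := latLin.continuous_of_finiteDimensional
  have hs' : s = latLin ⁻¹' Metric.closedBall 0 1 := by ext; simp [hs]
  have hconv : Convex ℝ s := by
    rw [hs']; exact (convex_closedBall _ _).linear_preimage _
  have hclosed : IsClosed s := isClosed_le (by fun_prop) continuous_const
  have hbdd : Bornology.IsBounded s := by
    refine (Metric.isBounded_closedBall (x := (0 : Fin 2 → ℝ)) (r := 2)).subset fun v hv => ?_
    have hv : ‖latLin v‖ ≤ 1 := hv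
    have h1 : ‖latLin v‖ ^ 2 ≤ 1 := by
      calc ‖latLin v‖ ^ 2 ≤ 1 ^ 2 := by gcongr
        _ = 1 := one_pow 2
    rw [norm_latLin_sq] at h1
    have h2 := rStar_sq_bounds.1
    have h3 : 0 ≤ v 0 ^ 2 + v 0 * v 1 + v 1 ^ 2 := by nlinarith [sq_nonneg (v 0 + v 1)]
    have h4 : v 0 ^ 2 + v 0 * v 1 + v 1 ^ 2 ≤ 1 := by nlinarith
    rw [mem_closedBall_zero_iff, pi_norm_le_iff_of_nonneg (by norm_num)]
    intro i
    rw [Real.norm_eq_abs]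
    apply abs_le_of_sq_le_sq _ (by norm_num)
    fin_cases i
    · simp only [Fin.zero_eta]; nlinarith [sq_nonneg (v 0 + 2 * v 1)]
    · simp only [Fin.mk_one]; nlinarith [sq_nonneg (2 * v 0 + v 1)]
  have hstar : ∀ ⦃x y : ℝ⦄, 0 < x → x ≤ y → x • s ⊆ y • s := by
    rintro x y hx hxy _ ⟨v, hv, rfl⟩
    have hy : 0 < y := hx.trans_le hxy
    refine ⟨(x / y) • v, ?_, ?_⟩
    · have hv : ‖latLin v‖ ≤ 1 := hv
      change ‖latLin ((x / y) • v)‖ ≤ 1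
      rw [map_smul, norm_smul, Real.norm_of_nonneg (by positivity)]
      have : x / y ≤ 1 := (div_le_one hy).2 hxy
      nlinarith [norm_nonneg (latLin v)]
    · simp only [smul_smul]
      congr 1
      field_simp
  have hpos : 0 < volume.real s := by
    rw [measureReal_def, ENNReal.toReal_pos_iff]
    refine ⟨?_, hbdd.measure_lt_top⟩
    have hopen : IsOpen {v : Fin 2 → ℝ | ‖latLin v‖ < 1} :=
      isOpen_lt (by fun_prop) continuous_const
    refine (hopen.measure_pos volume ⟨0, by simp⟩).trans_le (measure_mono ?_)
    intro v hv
    exact (show ‖latLin v‖ < 1 from hv).le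
  refine ⟨_, hpos, ?_⟩
  have h := tendsto_card_div_pow_atTop_volume' s hbdd hclosed.measurableSet
    (hconv.addHaar_frontier _) hstar
  refine h.congr' ?_
  filter_upwards [eventually_gt_atTop 0] with x hx
  rw [Fintype.card_fin]
  congr 2
  have hinj : Function.Injective fun z : ℤ × ℤ => x⁻¹ • ![(z.1 : ℝ), (z.2 : ℝ)] := by
    intro z z' h
    have h := smul_right_injective _ (inv_ne_zero hx.ne') h
    have h0 := congrFun h 0
    have h1 := congrFun h 1
    simp at h0 h1
    exact Prod.ext h0 h1
  rw [Nat.card_coe_set_eq, ← Set.ncard_coe_finset,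
    ← Set.ncard_image_of_injective (ballFin x : Set (ℤ × ℤ)) hinj]
  congr 1
  have key : ∀ z : ℤ × ℤ, latLin (x⁻¹ • ![(z.1 : ℝ), (z.2 : ℝ)]) = x⁻¹ • pt z := by
    intro z
    rw [map_smul, latLin_apply, pt, ← Int.cast_smul_eq_zsmul ℝ, ← Int.cast_smul_eq_zsmul ℝ]
    simp
  have key2 : ∀ z : ℤ × ℤ, ‖x⁻¹ • pt z‖ ≤ 1 ↔ ‖pt z‖ ≤ x := by
    intro z
    rw [norm_smul, Real.norm_of_nonneg (by positivity), inv_mul_le_iff₀ hx, mul_one]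
  ext v
  simp only [Set.mem_inter_iff, Set.mem_image, Finset.mem_coe, mem_ballFin]
  constructor
  · rintro ⟨hv, w, hw, rfl⟩
    have hw := (Module.Basis.mem_span_iff_repr_mem ℤ (Pi.basisFun ℝ (Fin 2)) w).1 hw
    simp only [Pi.basisFun_repr] at hw
    obtain ⟨m, hm⟩ := hw 0
    obtain ⟨n, hn⟩ := hw 1
    have hw' : w = ![(m : ℝ), (n : ℝ)] := by
      ext i; fin_cases i
      · simpa using hm.symm
      · simpa using hn.symm
    refine ⟨(m, n), ?_, by simp [hw']⟩
    have hv : ‖latLin (x⁻¹ • w)‖ ≤ 1 := hv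
    rw [hw'] at hv
    rw [← key2, ← key]
    exact hv
  · rintro ⟨z, hz, rfl⟩
    refine ⟨?_, _, ?_, rfl⟩
    · change ‖latLin _‖ ≤ 1
      rw [key, key2]; exact hz
    · refine (Module.Basis.mem_span_iff_repr_mem ℤ (Pi.basisFun ℝ (Fin 2)) _).2 fun i => ?_
      simp only [Pi.basisFun_repr]
      fin_cases i
      · exact ⟨z.1, by simp⟩
      · exact ⟨z.2, by simp⟩

/-- Boundary layers of bounded width are negligible. -/
theorem tendsto_card_ballFin_ratio (K : ℝ) :
    Tendsto (fun ρ : ℝ => ((ballFin (ρ - K)).card : ℝ) / ((ballFin (ρ + 1)).card : ℝ)) atTop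
      (𝓝 1) := by
  obtain ⟨V, hV, h⟩ := exists_tendsto_card_ballFin
  have h1 := h.comp (tendsto_atTop_add_const_right atTop (-K) tendsto_id)
  have h2 := h.comp (tendsto_atTop_add_const_right atTop 1 tendsto_id)
  have h3 : Tendsto (fun ρ : ℝ => (ρ - K) / (ρ + 1)) atTop (𝓝 1) := by
    have : Tendsto (fun ρ : ℝ => 1 - (K + 1) / (ρ + 1)) atTop (𝓝 (1 - 0)) :=
      tendsto_const_nhds.sub
        (tendsto_const_nhds.div_atTop (tendsto_atTop_add_const_right atTop 1 tendsto_id))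
    rw [sub_zero] at this
    refine this.congr' ?_
    filter_upwards [eventually_gt_atTop 0] with ρ hρ
    field_simp
    ring
  have h4 := (h1.div h2 hV.ne').mul (h3.pow 2)
  rw [div_self hV.ne', one_pow, one_mul] at h4
  refine h4.congr' ?_
  filter_upwards [eventually_gt_atTop 0, eventually_gt_atTop K] with ρ hρ hK
  have e1 : ρ + 1 ≠ 0 := by positivity
  have e2 : ρ - K ≠ 0 := by linarith
  simp only [Pi.div_apply, Function.comp_apply, id_eq, ← sub_eq_add_neg]
  by_cases h0 : ((ballFin (ρ + 1)).card : ℝ) = 0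
  · simp [h0]
  field_simp

/-! ### Comparison of energies -/

theorem gaussPotential_nonneg (α r : ℝ) : 0 ≤ gaussPotential α r := (Real.exp_pos _).le

theorem energy_quotient_eq {φ : ℤ × ℤ → Plane} (hφ : Function.Injective φ) (f : ℝ → ℝ) {r : ℝ}
    {S : Finset (ℤ × ℤ)} (hS : ∀ z, z ∈ S ↔ ‖φ z‖ ≤ r) :
    (∑ᶠ q ∈ (Set.range φ ∩ Metric.closedBall 0 r).offDiag, f ‖q.1 - q.2‖) /
      ((Set.range φ ∩ Metric.closedBall 0 r).ncard : ℝ) =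
    (∑ y ∈ S, ∑ x ∈ S, if x = y then 0 else f ‖φ x - φ y‖) / (S.card : ℝ) := by
  classical
  have hset : Set.range φ ∩ Metric.closedBall 0 r = ((S.map ⟨φ, hφ⟩ : Finset Plane) : Set Plane) := by
    ext v
    simp only [Set.mem_inter_iff, Set.mem_range, mem_closedBall_zero_iff, Finset.coe_map,
      Function.Embedding.coeFn_mk, Set.mem_image, Finset.mem_coe, hS]
    constructor
    · rintro ⟨⟨z, rfl⟩, h⟩; exact ⟨z, h, rfl⟩
    · rintro ⟨z, h, rfl⟩; exact ⟨⟨z, rfl⟩, h⟩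
  rw [hset, Set.ncard_coe_finset, Finset.card_map, ← Finset.coe_offDiag, finsum_mem_coe_finset]
  congr 1
  have h1 : ∑ q ∈ (S.map ⟨φ, hφ⟩).offDiag, f ‖q.1 - q.2‖ =
      ∑ q ∈ S.offDiag, f ‖φ q.1 - φ q.2‖ := by
    symm
    refine Finset.sum_bij (fun q _ => (φ q.1, φ q.2)) ?_ ?_ ?_ ?_
    · rintro ⟨x, y⟩ h
      rw [Finset.mem_offDiag] at h ⊢
      simpa [hφ.eq_iff] using h
    · rintro ⟨x, y⟩ _ ⟨x', y'⟩ _ h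
      simpa [hφ.eq_iff] using h
    · rintro ⟨a, b⟩ h
      simp only [Finset.mem_offDiag, Finset.mem_map, Function.Embedding.coeFn_mk] at h
      obtain ⟨⟨x, hx, rfl⟩, ⟨y, hy, rfl⟩, hne⟩ := h
      exact ⟨(x, y), by simpa [hx, hy] using fun e => hne (congrArg φ e), rfl⟩
    · intro _ _; rfl
  rw [h1, Finset.sum_comm, ← Finset.sum_product' S S (fun x y => if x = y then 0 else f ‖φ x - φ y‖),
    Finset.sum_ite, Finset.sum_const_zero, zero_add]
  refine Finset.sum_congr ?_ fun _ _ => rfl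
  ext ⟨x, y⟩
  simp [Finset.mem_offDiag, and_assoc]

/-- The interaction with a lattice point, omitting the origin. -/
noncomputable def latticePotential (α : ℝ) (z : ℤ × ℤ) : ℝ :=
  if z = 0 then 0 else gaussPotential α ‖pt z‖

theorem gaussPotential_norm_pt (α : ℝ) (z : ℤ × ℤ) :
    gaussPotential α ‖pt z‖ = Real.exp (-(Real.pi * α * rStar ^ 2 * latForm z)) := by
  rw [gaussPotential, norm_pt_sq]; ring_nf

theorem latticePotential_nonneg (α : ℝ) (z : ℤ × ℤ) : 0 ≤ latticePotential α z := by
  unfold latticePotential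
  split_ifs
  · exact le_rfl
  · exact gaussPotential_nonneg _ _

theorem summable_gaussPotential {α : ℝ} (hα : 0 < α) :
    Summable fun z : ℤ × ℤ => gaussPotential α ‖pt z‖ := by
  have h := summable_exp_neg_latForm (c := Real.pi * α * rStar ^ 2)
    (mul_pos (mul_pos Real.pi_pos hα) (pow_pos rStar_pos 2))
  refine h.congr fun z => ?_
  rw [gaussPotential_norm_pt]
  ring_nf

theorem summable_latticePotential {α : ℝ} (hα : 0 < α) : Summable (latticePotential α) := by
  refine (summable_gaussPotential hα).of_nonneg_of_le (latticePotential_nonneg α) fun z => ?_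
  unfold latticePotential
  split_ifs
  · exact gaussPotential_nonneg _ _
  · exact le_rfl

theorem range_pt : Set.range pt = (A2 : Set Plane) := by
  ext x
  constructor
  · rintro ⟨z, rfl⟩; exact pt_mem z
  · intro hx
    obtain ⟨z, hz⟩ := latEquiv.surjective ⟨x, hx⟩
    exact ⟨z, congrArg Subtype.val hz⟩

theorem pt_injective : Function.Injective pt := by
  intro z z' h
  exact latEquiv.injective (Subtype.ext h)

theorem pt_sub (z z' : ℤ × ℤ) : pt (z - z') = pt z - pt z' := by
  rw [eq_sub_iff_add_eq, ← pt_add, sub_add_cancel]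

/-- Every particle in a disk sees at most the full lattice sum, so the bound holds at each radius
before any limit. -/
theorem gaussEnergy_A2_le {α : ℝ} (hα : 0 < α) :
    gaussEnergy α (A2 : Set Plane) ≤ ((∑' z, latticePotential α z : ℝ) : EReal) := by
  rw [gaussEnergy, energy]
  have hT : 0 ≤ ∑' z, latticePotential α z := tsum_nonneg (latticePotential_nonneg α)
  refine (liminf_le_liminf (v := fun _ => ((∑' z, latticePotential α z : ℝ) : EReal))
    (Eventually.of_forall fun r => ?_)).trans (liminf_const _).le
  rw [EReal.coe_le_coe_iff, ← range_pt, energy_quotient_eq pt_injective (S := ballFin r)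
    _ (fun z => mem_ballFin)]
  refine div_le_of_le_mul₀ (Nat.cast_nonneg _) hT ?_
  have : ∀ y ∈ ballFin r, (∑ x ∈ ballFin r, if x = y then 0 else
      gaussPotential α ‖pt x - pt y‖) ≤ ∑' z, latticePotential α z := by
    intro y _
    rw [← Equiv.tsum_eq (Equiv.subRight y)]
    refine le_trans (le_of_eq (Finset.sum_congr rfl fun x _ => ?_))
      (((Equiv.subRight y).summable_iff.2 (summable_latticePotential hα)).sum_le_tsum (ballFin r)
        fun z _ => latticePotential_nonneg α _)
    simp [latticePotential, sub_eq_zero, pt_sub]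
  calc _ ≤ ∑ y ∈ ballFin r, ∑' z, latticePotential α z := Finset.sum_le_sum this
    _ = _ := by rw [Finset.sum_const, nsmul_eq_mul, mul_comm]

/-- By positivity only the pairs with offset in `F` are kept. Particles deep inside the disk have
all these partners in the disk, and averaging over a large disk reproduces the mean over the period.
-/
theorem le_gaussEnergy_perturbedLattice {L : AddSubgroup A2} [L.FiniteIndex] {p : A2 → Plane}
    (hp : IsPeriodic L p) (hsmall : ∀ x, ‖p x‖ ≤ 1 / 4) (α : ℝ) {F : Finset (ℤ × ℤ)}
    (hF : 0 ∉ F) :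
    ((∑ w ∈ F, periodMean L (fun x' => gaussPotential α ‖pt w + disp p (latEquiv w) x'‖) : ℝ) :
      EReal) ≤ gaussEnergy α (perturbedLattice p) := by
  classical
  have : Fintype (A2 ⧸ L) := Fintype.ofFinite _
  set φ : ℤ × ℤ → Plane := fun z => pt z + p (latEquiv z) with hφ
  have hdiff : ∀ w y : ℤ × ℤ, φ (w + y) - φ y = pt w + disp p (latEquiv w) (latEquiv y) := by
    intro w y
    simp only [hφ, disp, pt_add, map_add, add_comm (latEquiv w) (latEquiv y)]
    abel
  have hrange : perturbedLattice p = Set.range φ := by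
    ext v
    constructor
    · rintro ⟨x, rfl⟩
      obtain ⟨z, rfl⟩ := latEquiv.surjective x
      exact ⟨z, rfl⟩
    · rintro ⟨z, rfl⟩
      exact ⟨latEquiv z, rfl⟩
  -- Distinct lattice points are at distance at least `1`, while two displacements differ by at most
  -- `1/2`.
  have hinj : Function.Injective φ := by
    intro z z' h
    have h1 : pt (z - z') = p (latEquiv z') - p (latEquiv z) := by
      simp only [hφ] at h
      rw [pt_sub, sub_eq_sub_iff_add_eq_add, h, add_comm]
    have h2 : ‖pt (z - z')‖ ≤ 1 / 2 := by
      rw [h1]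
      refine (norm_sub_le _ _).trans ?_
      linarith [hsmall (latEquiv z'), hsmall (latEquiv z)]
    have h3 : ‖pt (z - z')‖ ^ 2 ≤ (1 / 2) ^ 2 := by gcongr
    rw [norm_pt_sq] at h3
    have h4 : latForm (z - z') ≤ 1 / 4 := by
      have := mul_le_mul_of_nonneg_right rStar_sq_bounds.1 (latForm_nonneg (z - z'))
      linarith
    have h5 := half_le_latForm (z - z')
    have key : ∀ m : ℤ, (m : ℝ) ^ 2 ≤ 1 / 2 → m = 0 := by
      intro m hm
      have : (m ^ 2 : ℤ) < 1 := by
        have : ((m ^ 2 : ℤ) : ℝ) < 1 := by push_cast; linarith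
        exact_mod_cast this
      nlinarith [sq_nonneg m, pow_eq_zero_iff (two_ne_zero) |>.1 (le_antisymm (by omega) (sq_nonneg m))]
    have k1 := key (z - z').1 (by nlinarith [sq_nonneg ((z - z').2 : ℝ)])
    have k2 := key (z - z').2 (by nlinarith [sq_nonneg ((z - z').1 : ℝ)])
    exact sub_eq_zero.1 (Prod.ext k1 k2)
  set g : A2 → ℝ := fun x' => ∑ w ∈ F, gaussPotential α ‖pt w + disp p (latEquiv w) x'‖ with hg
  have hg0 : ∀ x, 0 ≤ g x := fun x => Finset.sum_nonneg fun _ _ => gaussPotential_nonneg _ _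
  have hgper : ∀ x, ∀ y ∈ L, g (x + y) = g x := by
    intro x y hy
    simp only [hg]
    refine Finset.sum_congr rfl fun w _ => ?_
    rw [isPeriodic_disp hp (latEquiv w) x y hy]
  rw [← periodMean_sum]
  change ((periodMean L g : ℝ) : EReal) ≤ _
  have hG0 : 0 ≤ periodMean L g := periodMean_nonneg hg0
  obtain ⟨M, hM0, hM⟩ : ∃ M, 0 ≤ M ∧ ∀ w ∈ F, ‖pt w‖ ≤ M := by
    obtain ⟨M, hM⟩ := (F.image fun w => ‖pt w‖).exists_le
    exact ⟨max M 0, le_max_right _ _,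
      fun w hw => (hM _ (Finset.mem_image_of_mem _ hw)).trans (le_max_left _ _)⟩
  obtain ⟨T, hT⟩ : ∃ T, ∀ q : A2 ⧸ L, ‖((q.out : A2) : Plane)‖ ≤ T := by
    obtain ⟨T, hT⟩ := (Finset.univ.image fun q : A2 ⧸ L => ‖((q.out : A2) : Plane)‖).exists_le
    exact ⟨T, fun q => hT _ (Finset.mem_image_of_mem _ (Finset.mem_univ q))⟩
  -- averaging over the translates of a disk
  have havg : ∀ ρ : ℝ, (ballFin (ρ - T)).card * periodMean L g ≤
      ∑ y ∈ ballFin ρ, g (latEquiv y) := by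
    intro ρ
    have h1 : ((ballFin (ρ - T)).card : ℝ) * periodMean L g =
        periodMean L (fun x' => ∑ x ∈ ballFin (ρ - T), g (x' + latEquiv x)) := by
      refine (((periodMean_sum _ fun x x' => g (x' + latEquiv x)).trans
        (Finset.sum_congr rfl fun x _ => periodMean_shift hgper (latEquiv x))).trans ?_).symm
      rw [Finset.sum_const, nsmul_eq_mul]
    rw [h1, ← periodMean_const (L := L) (∑ y ∈ ballFin ρ, g (latEquiv y)), periodMean_eq_sum,
      periodMean_eq_sum]
    gcongr with q _
    obtain ⟨t, ht⟩ := latEquiv.surjective q.out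
    have htT := hT q
    rw [← ht, latEquiv_coe] at htT
    rw [← ht]
    simp only [← map_add]
    have e : ∑ x ∈ ballFin (ρ - T), g (latEquiv (t + x)) =
        ∑ y ∈ (ballFin (ρ - T)).map (addLeftEmbedding t), g (latEquiv y) := by
      rw [Finset.sum_map]; rfl
    rw [e]
    refine Finset.sum_le_sum_of_subset_of_nonneg ?_ fun _ _ _ => hg0 _
    intro y hy
    rw [Finset.mem_map] at hy
    obtain ⟨x, hx, rfl⟩ := hy
    rw [mem_ballFin] at hx ⊢
    simp only [addLeftEmbedding_apply, pt_add]
    refine (norm_add_le _ _).trans ?_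
    linarith
  -- The margins are `1` for the displacements, `M` for the offsets in `F`, and `T` for the
  -- translations by representatives of the period.
  have hlim : Tendsto (fun r : ℝ => ((((ballFin (r - (1 + M + T))).card : ℝ) /
      ((ballFin (r + 1)).card : ℝ) * periodMean L g : ℝ) : EReal)) atTop
      (𝓝 ((periodMean L g : ℝ) : EReal)) := by
    have := (tendsto_card_ballFin_ratio (1 + M + T)).mul_const (periodMean L g)
    rw [one_mul] at this
    exact (continuous_coe_real_ereal.tendsto _).comp this
  rw [gaussEnergy, energy, ← hlim.liminf_eq]
  refine liminf_le_liminf ?_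
  filter_upwards [eventually_ge_atTop 1] with r hr
  set S : Finset (ℤ × ℤ) := (ballFin (r + 1)).filter fun z => ‖φ z‖ ≤ r with hSdef
  have hS : ∀ z, z ∈ S ↔ ‖φ z‖ ≤ r := by
    intro z
    rw [hSdef, Finset.mem_filter, mem_ballFin, and_iff_right_iff_imp]
    intro h
    have h1 : pt z = φ z - p (latEquiv z) := by simp [hφ]
    rw [h1]
    refine (norm_sub_le _ _).trans ?_
    linarith [hsmall (latEquiv z)]
  have hsub : ∀ z, ‖pt z‖ ≤ r - 1 → z ∈ S := by
    intro z hz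
    rw [hS]
    refine (norm_add_le _ _).trans ?_
    linarith [hsmall (latEquiv z)]
  rw [EReal.coe_le_coe_iff, hrange, energy_quotient_eq hinj _ hS]
  have hScard : 0 < (S.card : ℝ) := by
    have : (0 : ℤ × ℤ) ∈ S := hsub 0 (by rw [pt_zero, norm_zero]; linarith)
    exact_mod_cast Finset.card_pos.2 ⟨0, this⟩
  have hScard' : (S.card : ℝ) ≤ (ballFin (r + 1)).card := by
    exact_mod_cast Finset.card_le_card (Finset.filter_subset _ _)
  have hnum : ((ballFin (r - (1 + M + T))).card : ℝ) * periodMean L g ≤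
      ∑ y ∈ S, ∑ x ∈ S, if x = y then 0 else gaussPotential α ‖φ x - φ y‖ := by
    have hnn : ∀ x y : ℤ × ℤ, 0 ≤ if x = y then 0 else gaussPotential α ‖φ x - φ y‖ := by
      intro x y
      split_ifs
      · exact le_rfl
      · exact gaussPotential_nonneg _ _
    have h1 := havg (r - (1 + M))
    rw [show r - (1 + M) - T = r - (1 + M + T) by ring] at h1
    refine h1.trans ?_
    have hpair : ∀ y ∈ ballFin (r - (1 + M)), g (latEquiv y) ≤
        ∑ x ∈ S, if x = y then 0 else gaussPotential α ‖φ x - φ y‖ := by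
      intro y hy
      rw [mem_ballFin] at hy
      have h2 : g (latEquiv y) = ∑ x ∈ F.map (addRightEmbedding y),
          if x = y then 0 else gaussPotential α ‖φ x - φ y‖ := by
        rw [Finset.sum_map]
        refine Finset.sum_congr rfl fun w hw => ?_
        have : w ≠ 0 := fun h => hF (h ▸ hw)
        rw [addRightEmbedding_apply, hdiff, if_neg (by simpa using this)]
      rw [h2]
      refine Finset.sum_le_sum_of_subset_of_nonneg ?_ fun _ _ _ => hnn _ _
      intro x hx
      rw [Finset.mem_map] at hx
      obtain ⟨w, hw, rfl⟩ := hx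
      apply hsub
      rw [addRightEmbedding_apply, pt_add]
      refine (norm_add_le _ _).trans ?_
      linarith [hM w hw]
    refine (Finset.sum_le_sum hpair).trans ?_
    refine Finset.sum_le_sum_of_subset_of_nonneg ?_ fun _ _ _ =>
      Finset.sum_nonneg fun _ _ => hnn _ _
    intro y hy
    rw [mem_ballFin] at hy
    apply hsub
    linarith
  rw [div_mul_eq_mul_div]
  calc _ ≤ (((ballFin (r - (1 + M + T))).card : ℝ) * periodMean L g) / S.card := by
        gcongr
    _ ≤ _ := by gcongr

/-- Termwise lower bounds of the perturbed energy can be summed up. -/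
theorem tsum_le_gaussEnergy_sub {L : AddSubgroup A2} [L.FiniteIndex] {p : A2 → Plane}
    (hp : IsPeriodic L p) (hsmall : ∀ x, ‖p x‖ ≤ 1 / 4) {α : ℝ} (hα : 0 < α) {d : ℤ × ℤ → ℝ}
    (hd : Summable d) (hd0 : d 0 = 0)
    (h : ∀ z, gaussPotential α ‖pt z‖ + d z ≤
      periodMean L (fun x' => gaussPotential α ‖pt z + disp p (latEquiv z) x'‖)) :
    ((∑' z, d z : ℝ) : EReal) ≤
      gaussEnergy α (perturbedLattice p) - gaussEnergy α (A2 : Set Plane) := by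
  classical
  have hsum := (summable_latticePotential hα).add hd
  have hlow : ((∑' z, (latticePotential α z + d z) : ℝ) : EReal) ≤
      gaussEnergy α (perturbedLattice p) := by
    refine le_of_tendsto ((continuous_coe_real_ereal.tendsto _).comp hsum.hasSum)
      (Eventually.of_forall fun F => ?_)
    refine le_trans ?_ (le_gaussEnergy_perturbedLattice hp hsmall α (F.notMem_erase 0))
    rw [Function.comp_apply, EReal.coe_le_coe_iff, ← Finset.sum_erase F (a := (0 : ℤ × ℤ))
      (by simp [latticePotential, hd0])]
    refine Finset.sum_le_sum fun z hz => ?_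
    rw [latticePotential, if_neg (Finset.ne_of_mem_erase hz)]
    exact h z
  have := EReal.sub_le_sub hlow (gaussEnergy_A2_le hα)
  rwa [← EReal.coe_sub, (summable_latticePotential hα).tsum_add hd, add_sub_cancel_left] at this

/-! ### Spectral measures -/

theorem isPosSemidef_dirac (ω : dualCell) (v : Fin 2 → ℝ) (A : Set dualCell) :
    (VectorMeasure.dirac ω (Matrix.vecMulVec v v) A).PosSemidef := by
  by_cases h : MeasurableSet A ∧ ω ∈ A
  · rw [VectorMeasure.dirac_apply_of_mem h.1 h.2]
    simpa using Matrix.posSemidef_vecMulVec_self_star v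
  · have : VectorMeasure.dirac ω (Matrix.vecMulVec v v) A = 0 := if_neg h
    rw [this]
    exact Matrix.PosSemidef.zero

/-- The matrix valued measure with finitely many atoms of rank one. -/
noncomputable def atomicMeasure {J : Type} [Fintype J] (ω : J → dualCell) (v : J → Fin 2 → ℝ) :
    PSDMeasure where
  toVectorMeasure := ∑ j, VectorMeasure.dirac (ω j) (Matrix.vecMulVec (v j) (v j))
  posSemidef A _ := by
    rw [← FunLike.coeAddMonoidHom_apply, map_sum, Finset.sum_apply]
    exact Matrix.posSemidef_sum _ fun j _ => isPosSemidef_dirac _ _ _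

theorem atomicMeasure_integral {J : Type} [Fintype J] (ω : J → dualCell) (v : J → Fin 2 → ℝ)
    (g : dualCell → ℝ) (i k : Fin 2) :
    (atomicMeasure ω v).integral g i k = ∑ j, g (ω j) * (v j i * v j k) := by
  have h1 : (atomicMeasure ω v).entry i k =
      ∑ j, VectorMeasure.dirac (ω j) (v j i * v j k) := by
    change VectorMeasure.mapRangeHom (Matrix.entryAddMonoidHom ℝ i k) (continuous_entryHom i k)
      (∑ j, VectorMeasure.dirac (ω j) (Matrix.vecMulVec (v j) (v j))) = _
    rw [map_sum]
    refine Finset.sum_congr rfl fun j _ => ?_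
    ext A hA
    change VectorMeasure.mapRange _ _ (continuous_entryHom i k) A = _
    rw [VectorMeasure.mapRange_apply]
    by_cases hω : ω j ∈ A
    · simp [VectorMeasure.dirac_apply_of_mem hA hω, Matrix.vecMulVec_apply]
    · simp [VectorMeasure.dirac_apply_of_notMem hω]
  rw [PSDMeasure.integral, Matrix.of_apply, h1, VectorMeasure.integral_finsetSum_vectorMeasure]
  · simp [VectorMeasure.integral_dirac]
  · intro j _
    change MeasureTheory.Integrable _ _
    rw [VectorMeasure.variation_dirac]
    exact (integrable_dirac (by simp)).smul_measure enorm_ne_top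

theorem IsPeriodic.exists_isSpectralMeasure {L : AddSubgroup A2} [L.FiniteIndex] {p : A2 → Plane}
    (hp : IsPeriodic L p) : ∃ μ : PSDMeasure, IsSpectralMeasure L p μ := by
  obtain ⟨J, hJ, ω, a, hω, h⟩ := exists_modes hp
  refine ⟨atomicMeasure (fun j => ⟨ω j, hω j⟩) (fun j i => a j i), fun x => ?_⟩
  ext i k
  rw [atomicMeasure_integral, h]

/-- The diagonal components of a positive semidefinite measure are measures. -/
theorem PSDMeasure.exists_measure (μ : PSDMeasure) (a : Fin 2) :
    ∃ m : Measure dualCell, IsFiniteMeasure m ∧ ∀ g : dualCell → ℝ,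
      μ.integral g a a = ∫ ω, g ω ∂m := by
  have h0 : 0 ≤[Set.univ] μ.entry a a := by
    rw [VectorMeasure.restrict_univ, VectorMeasure.restrict_univ]
    intro A hA
    rw [μ.entry_apply]
    exact (μ.posSemidef A hA).diag_nonneg
  refine ⟨(μ.entry a a).toMeasureOfZeroLE Set.univ MeasurableSet.univ h0, inferInstance,
    fun g => ?_⟩
  rw [← VectorMeasure.integral_toSignedMeasure,
    SignedMeasure.toMeasureOfZeroLE_toSignedMeasure, PSDMeasure.integral, Matrix.of_apply]
  congr 1
  ext
  simp

/-- Only the diagonal entries of `μ` enter, and these are finite positive measures. For any spectral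
measure `FS` is twice the integral of the shell weight against their sum, so no uniqueness is
needed. -/
theorem SM_bounds {L : AddSubgroup A2} [L.FiniteIndex] {p : A2 → Plane} (hp : IsPeriodic L p)
    {μ : PSDMeasure} (hμ : IsSpectralMeasure L p μ) : 0 ≤ SM μ ∧ SM μ ≤ FS L p := by
  choose m hfin hm using μ.exists_measure
  have hbdd : ∀ ω : dualCell, ‖(ω : Plane)‖ ^ 2 ≤ shellWeight (coord ω) := by
    intro ω
    obtain ⟨h1, h2, h3⟩ := bf_le_of_mem_dualCell ω.2
    have := qf_le_shellWeight h1 h2 h3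
    have hq := qf_nonneg (coord (ω : Plane))
    rw [norm_sq_eq_qf]
    nlinarith [rStar_sq_bounds.2]
  have hcos : ∀ a (x : Plane), Integrable (fun ω : dualCell =>
      Real.cos (2 * Real.pi * inner ℝ x (ω : Plane))) (m a) := fun a x =>
    Integrable.of_bound (by fun_prop) 1 (ae_of_all _ fun ω => Real.abs_cos_le_one _)
  have hint : ∀ a z, Integrable (fun ω : dualCell => weight (coord (ω : Plane)) z) (m a) := by
    intro a z
    simp only [weight, ← inner_pt]
    exact (integrable_const _).sub (hcos a _)
  have hFS : FS L p = ∑ a, 2 * ∫ ω, shellWeight (coord (ω : Plane)) ∂(m a) := by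
    rw [FS_eq_sum]
    simp only [shellWeight, integral_finsetSum _ (fun z _ => hint _ z)]
    simp only [Finset.mul_sum]
    rw [Finset.sum_comm]
    refine Finset.sum_congr rfl fun z _ => ?_
    rw [hp.mean_norm_sq_disp, ← Finset.mul_sum]
    congr 1
    refine Finset.sum_congr rfl fun a _ => ?_
    rw [hμ, hμ, hm, hm, ← integral_sub (hcos a _) (hcos a _)]
    refine integral_congr_ae (ae_of_all _ fun ω => ?_)
    simp [weight, latEquiv_coe, inner_pt]
  have hSM : SM μ = ∑ a, ∫ ω, ‖(ω : Plane)‖ ^ 2 ∂(m a) := by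
    rw [SM, Matrix.trace]
    exact Finset.sum_congr rfl fun a _ => hm a _
  have hnn : ∀ a, 0 ≤ ∫ ω, ‖((ω : dualCell) : Plane)‖ ^ 2 ∂(m a) := fun a =>
    integral_nonneg fun ω => sq_nonneg _
  rw [hSM, hFS]
  refine ⟨Finset.sum_nonneg fun a _ => hnn a, Finset.sum_le_sum fun a _ => ?_⟩
  have hSint : Integrable (fun ω : dualCell => shellWeight (coord (ω : Plane))) (m a) := by
    unfold shellWeight
    exact integrable_finsetSum _ fun z _ => hint a z
  have h1 : ∫ ω, ‖((ω : dualCell) : Plane)‖ ^ 2 ∂(m a) ≤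
      ∫ ω, shellWeight (coord (ω : Plane)) ∂(m a) :=
    integral_mono_of_nonneg (ae_of_all _ fun ω => sq_nonneg _) hSint (ae_of_all _ hbdd)
  linarith [hnn a]

/-! ### Moments of the relative displacements -/

/-- The mean square of the relative displacement in a lattice direction. -/
noncomputable def msd (L : AddSubgroup A2) (p : A2 → Plane) (z : ℤ × ℤ) : ℝ :=
  periodMean L fun x' => ‖disp p (latEquiv z) x'‖ ^ 2

/-- The mean square of the longitudinal part of the relative displacement, times `|x|²`. -/
noncomputable def longMsd (L : AddSubgroup A2) (p : A2 → Plane) (z : ℤ × ℤ) : ℝ :=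
  periodMean L fun x' => inner ℝ (pt z) (disp p (latEquiv z) x') ^ 2

section
variable {L : AddSubgroup A2} [L.FiniteIndex] {p : A2 → Plane}

theorem msd_nonneg (z : ℤ × ℤ) : 0 ≤ msd L p z := periodMean_nonneg fun _ => sq_nonneg _

theorem msd_zero : msd L p 0 = 0 := by
  simp [msd, disp, periodMean_const]

theorem FS_eq_sum_msd : FS L p = ∑ z ∈ shell, msd L p z := FS_eq_sum L p

theorem FS_nonneg : 0 ≤ FS L p := by
  rw [FS_eq_sum_msd]; exact Finset.sum_nonneg fun z _ => msd_nonneg z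

theorem IsPeriodic.exists_modes_msd (hp : IsPeriodic L p) :
    ∃ (J : Type) (_ : Fintype J) (θ ν : J → ℝ × ℝ),
      (∀ j, |bf (1, 0) (θ j)| ≤ 1 / 2 ∧ |bf (0, 1) (θ j)| ≤ 1 / 2 ∧ |bf (1, 1) (θ j)| ≤ 1 / 2) ∧
      (∀ z, msd L p z = ∑ j, 2 * weight (θ j) z * (rStar ^ 2 * qf (ν j))) ∧
      (∀ z, longMsd L p z = ∑ j, 2 * weight (θ j) z * latPair z (ν j) ^ 2) ∧
      FS L p = ∑ j, 2 * shellWeight (θ j) * (rStar ^ 2 * qf (ν j)) := by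
  obtain ⟨J, hJ, θ, ν, hθ, hV, hP⟩ := hp.exists_spectral_moments
  refine ⟨J, hJ, θ, ν, hθ, hV, hP, ?_⟩
  rw [FS_eq_sum]
  simp only [hV, shellWeight, Finset.mul_sum, Finset.sum_mul]
  rw [Finset.sum_comm]

theorem IsPeriodic.msd_le (hp : IsPeriodic L p) (z : ℤ × ℤ) :
    msd L p z ≤ max ((z.1 : ℝ) ^ 2) ((z.2 : ℝ) ^ 2) * FS L p := by
  obtain ⟨J, hJ, θ, ν, -, hV, -, hFS⟩ := hp.exists_modes_msd
  rw [hV, hFS, Finset.mul_sum]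
  refine Finset.sum_le_sum fun j _ => ?_
  have h1 := weight_le (θ j) z
  have h2 : 0 ≤ 2 * (rStar ^ 2 * qf (ν j)) := by have := qf_nonneg (ν j); positivity
  have := mul_le_mul_of_nonneg_right h1 h2
  linarith

theorem IsPeriodic.FS_le_longMsd (hp : IsPeriodic L p) :
    rStar ^ 2 / 4 * FS L p ≤ ∑ z ∈ shell, longMsd L p z := by
  obtain ⟨J, hJ, θ, ν, -, -, hP, hFS⟩ := hp.exists_modes_msd
  simp only [hP]
  rw [hFS, Finset.sum_comm, Finset.mul_sum]
  refine Finset.sum_le_sum fun j _ => ?_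
  have h1 := shell_rigidity (θ j) (ν j)
  have h2 : ∑ z ∈ shell, 2 * weight (θ j) z * latPair z (ν j) ^ 2 =
      2 * ∑ z ∈ shell, weight (θ j) z * latPair z (ν j) ^ 2 := by
    rw [Finset.mul_sum]; exact Finset.sum_congr rfl fun z _ => by ring
  rw [h2]
  have h3 : rStar ^ 2 / 4 * (2 * shellWeight (θ j) * (rStar ^ 2 * qf (ν j))) =
      (rStar ^ 2) ^ 2 / 2 * (shellWeight (θ j) * qf (ν j)) := by ring
  rw [h3, rStar_sq_sq]
  linarith

theorem IsPeriodic.norm_le_pertSize (hp : IsPeriodic L p) (x : A2) : ‖p x‖ ≤ pertSize p := by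
  refine le_ciSup (f := fun x => ‖p x‖) ?_ x
  refine ((Set.finite_range fun q : A2 ⧸ L => ‖p q.out‖).subset ?_).bddAbove
  rintro _ ⟨x, rfl⟩
  refine ⟨(x : A2 ⧸ L), ?_⟩
  simp only
  rw [hp.apply_eq (QuotientAddGroup.out_eq' (x : A2 ⧸ L))]

theorem norm_disp_le {δ : ℝ} (h : ∀ x, ‖p x‖ ≤ δ) (x x' : A2) : ‖disp p x x'‖ ≤ 2 * δ := by
  refine (norm_sub_le _ _).trans ?_
  linarith [h (x' + x), h x']

/-! ### Mean interaction energies -/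

/-- The exponent of the relative change of the interaction of two particles. -/
noncomputable def dispExp (α : ℝ) (x u : Plane) : ℝ :=
  2 * Real.pi * α * inner ℝ x u + Real.pi * α * ‖u‖ ^ 2

theorem gaussPotential_add (α : ℝ) (x u : Plane) :
    gaussPotential α ‖x + u‖ = gaussPotential α ‖x‖ * Real.exp (-dispExp α x u) := by
  rw [gaussPotential, gaussPotential, ← Real.exp_add, norm_add_sq_real, dispExp]
  ring_nf

/-- Averaging a pointwise lower bound for the exponential; the part linear in the displacement has
mean zero. -/
theorem mean_gaussPotential_ge (hp : IsPeriodic L p) (α : ℝ) (z : ℤ × ℤ) (A B : ℝ)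
    (h : ∀ x', 1 - dispExp α (pt z) (disp p (latEquiv z) x') +
        A * inner ℝ (pt z) (disp p (latEquiv z) x') ^ 2 - B * ‖disp p (latEquiv z) x'‖ ^ 2 ≤
      Real.exp (-dispExp α (pt z) (disp p (latEquiv z) x'))) :
    gaussPotential α ‖pt z‖ +
        gaussPotential α ‖pt z‖ * (A * longMsd L p z - (Real.pi * α + B) * msd L p z) ≤
      periodMean L (fun x' => gaussPotential α ‖pt z + disp p (latEquiv z) x'‖) := by
  simp only [gaussPotential_add]
  rw [periodMean_const_mul]
  have h1 := periodMean_mono (L := L) h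
  have h2 : periodMean L (fun x' => 1 - dispExp α (pt z) (disp p (latEquiv z) x') +
        A * inner ℝ (pt z) (disp p (latEquiv z) x') ^ 2 - B * ‖disp p (latEquiv z) x'‖ ^ 2) =
      1 - (2 * Real.pi * α * periodMean L (fun x' => inner ℝ (pt z) (disp p (latEquiv z) x')) +
        Real.pi * α * msd L p z) + A * longMsd L p z - B * msd L p z := by
    simp only [dispExp, periodMean_add, periodMean_sub, periodMean_const_mul, periodMean_const, msd,
      longMsd]
  rw [h2, hp.periodMean_disp] at h1
  have := mul_le_mul_of_nonneg_left h1 (gaussPotential_nonneg α ‖pt z‖)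
  linarith

/-! ### Rigidity from the first shell -/

theorem latForm_of_mem_shell {z : ℤ × ℤ} (hz : z ∈ shell) : latForm z = 1 := by
  simp only [shell, Finset.mem_insert, Finset.mem_singleton] at hz
  rcases hz with rfl | rfl | rfl | rfl | rfl | rfl <;> norm_num [latForm]

theorem gaussPotential_norm_pt' (α : ℝ) (z : ℤ × ℤ) : gaussPotential α ‖pt z‖ =
    Real.exp (-(2 * Real.pi * α * rStar ^ 2 / 2) * latForm z) := by
  rw [gaussPotential_norm_pt]; ring_nf

theorem gaussPotential_of_mem_shell (α : ℝ) {z : ℤ × ℤ} (hz : z ∈ shell) :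
    gaussPotential α ‖pt z‖ = Real.exp (-(Real.pi * α * rStar ^ 2)) := by
  rw [gaussPotential_norm_pt, latForm_of_mem_shell hz, mul_one]

theorem summable_gaussPotential_mul_msd (hp : IsPeriodic L p) {α : ℝ} (hα : 0 < α) :
    Summable fun z => gaussPotential α ‖pt z‖ * msd L p z := by
  have hS : 0 < 2 * Real.pi * α * rStar ^ 2 := by have := rStar_pos; positivity
  refine ((summable_exp_mul_max hS).mul_right (FS L p)).of_nonneg_of_le
    (fun z => mul_nonneg (gaussPotential_nonneg _ _) (msd_nonneg z)) fun z => ?_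
  rw [gaussPotential_norm_pt']
  exact (mul_le_mul_of_nonneg_left (hp.msd_le z) (Real.exp_pos _).le).trans (mul_assoc _ _ _).ge

/-- The shell contributes exactly `FS` times its weight, and all other points at most one fifth of
that. -/
theorem tsum_gaussPotential_mul_msd_le (hp : IsPeriodic L p) {α : ℝ}
    (hS : 21 / 4 ≤ 2 * Real.pi * α * rStar ^ 2) :
    ∑' z, gaussPotential α ‖pt z‖ * msd L p z ≤
      6 / 5 * Real.exp (-(Real.pi * α * rStar ^ 2)) * FS L p := by
  have hα : 0 < α := by
    have h1 : 0 < 2 * Real.pi * rStar ^ 2 := by have := rStar_pos; positivity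
    by_contra hα
    nlinarith
  have hS0 : 0 < 2 * Real.pi * α * rStar ^ 2 := by linarith
  set h : ℤ × ℤ → ℝ := fun z => gaussPotential α ‖pt z‖ * max ((z.1 : ℝ) ^ 2) ((z.2 : ℝ) ^ 2)
    with hh
  have hsum : Summable h := by
    simp only [hh, gaussPotential_norm_pt']; exact summable_exp_mul_max hS0
  have hfar : ∑' z, h z ≤ ∑ z ∈ shell, h z + Real.exp (-(Real.pi * α * rStar ^ 2)) * (1 / 5) := by
    have := far_sum_le hS
    simp only [hh, gaussPotential_norm_pt']
    refine this.trans (le_of_eq ?_)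
    ring_nf
  -- On the shell this correction replaces the crude majorant `h z * FS` by the true term.
  set e : ℤ × ℤ → ℝ := fun z =>
    if z ∈ shell then gaussPotential α ‖pt z‖ * msd L p z - h z * FS L p else 0 with he
  have he0 : ∀ z ∉ shell, e z = 0 := fun z hz => if_neg hz
  have hesum : HasSum e (∑ z ∈ shell, e z) := hasSum_sum_of_ne_finset_zero he0
  have hle : ∀ z, gaussPotential α ‖pt z‖ * msd L p z ≤ h z * FS L p + e z := by
    intro z
    by_cases hz : z ∈ shell
    · simp [he, hz]
    · rw [he0 z hz, add_zero, hh, mul_assoc]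
      exact mul_le_mul_of_nonneg_left (hp.msd_le z) (gaussPotential_nonneg _ _)
  have h1 := (summable_gaussPotential_mul_msd hp hα).tsum_le_tsum hle
    ((hsum.mul_right _).add hesum.summable)
  rw [(hsum.mul_right _).tsum_add hesum.summable, tsum_mul_right, hesum.tsum_eq] at h1
  have h2 : ∑ z ∈ shell, e z = Real.exp (-(Real.pi * α * rStar ^ 2)) * FS L p -
      (∑ z ∈ shell, h z) * FS L p := by
    rw [FS_eq_sum_msd, Finset.mul_sum, Finset.sum_mul, ← Finset.sum_sub_distrib]
    refine Finset.sum_congr rfl fun z hz => ?_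
    rw [he]
    simp only [hz, if_true]
    rw [gaussPotential_of_mem_shell α hz, FS_eq_sum_msd]
  have h3 := mul_le_mul_of_nonneg_right hfar (FS_nonneg (L := L) (p := p))
  rw [h2] at h1
  linarith

/-- The energy gain when the first shell dominates. -/
theorem energy_gap_of_shell (hp : IsPeriodic L p) (hsmall : ∀ x, ‖p x‖ ≤ 1 / 4) {α κ η γ : ℝ}
    (hS : 21 / 4 ≤ 2 * Real.pi * α * rStar ^ 2)
    (hγ : γ ≤ κ * (2 * Real.pi * α * rStar ^ 2) / 4 - 3 / 5 - η) (hκ : 0 ≤ κ)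
    (hshell : ∀ z ∈ shell, ∀ x', 1 - dispExp α (pt z) (disp p (latEquiv z) x') +
        κ * (2 * Real.pi * α * inner ℝ (pt z) (disp p (latEquiv z) x')) ^ 2 -
        η * (2 * Real.pi * α * ‖disp p (latEquiv z) x'‖ ^ 2) ≤
      Real.exp (-dispExp α (pt z) (disp p (latEquiv z) x'))) :
    ((Real.exp (-(Real.pi * α * rStar ^ 2)) * (2 * Real.pi * α * γ * FS L p) : ℝ) : EReal) ≤
      gaussEnergy α (perturbedLattice p) - gaussEnergy α (A2 : Set Plane) := by
  have hα : 0 < α := by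
    have h1 : 0 < 2 * Real.pi * rStar ^ 2 := by have := rStar_pos; positivity
    by_contra hα
    nlinarith
  set E := Real.exp (-(Real.pi * α * rStar ^ 2)) with hE
  set e : ℤ × ℤ → ℝ := fun z => if z ∈ shell then
    E * (κ * (2 * Real.pi * α) ^ 2 * longMsd L p z - η * (2 * Real.pi * α) * msd L p z) else 0
    with he
  have he0 : ∀ z ∉ shell, e z = 0 := fun z hz => if_neg hz
  have hesum : HasSum e (∑ z ∈ shell, e z) := hasSum_sum_of_ne_finset_zero he0
  have hmsum := (summable_gaussPotential_mul_msd hp hα).mul_left (-(Real.pi * α))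
  have key := tsum_le_gaussEnergy_sub hp hsmall hα (hmsum.add hesum.summable) ?_ ?_
  · refine le_trans ?_ key
    rw [EReal.coe_le_coe_iff, hmsum.tsum_add hesum.summable, tsum_mul_left, hesum.tsum_eq]
    -- The factor `πα · 6/5 = 2πα · 3/5` is the source of the `3/5` in `hγ`.
    have h1 := mul_le_mul_of_nonneg_left (tsum_gaussPotential_mul_msd_le hp hS)
      (by positivity : 0 ≤ Real.pi * α)
    have h2 : ∑ z ∈ shell, e z = E * (κ * (2 * Real.pi * α) ^ 2 * ∑ z ∈ shell, longMsd L p z -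
        η * (2 * Real.pi * α) * FS L p) := by
      rw [FS_eq_sum_msd, Finset.mul_sum, Finset.mul_sum, ← Finset.sum_sub_distrib, Finset.mul_sum]
      refine Finset.sum_congr rfl fun z hz => ?_
      simp only [he, hz, if_true]
    have h3 := mul_le_mul_of_nonneg_left hp.FS_le_longMsd
      (by positivity : 0 ≤ E * (κ * (2 * Real.pi * α) ^ 2))
    have h4 := mul_le_mul_of_nonneg_right hγ
      (mul_nonneg (by positivity : 0 ≤ E * (2 * Real.pi * α)) (FS_nonneg (L := L) (p := p)))
    rw [h2]
    linarith
  · have : (0 : ℤ × ℤ) ∉ shell := by decide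
    simp [he0 0 this, msd_zero]
  · intro z
    by_cases hz : z ∈ shell
    · have := mean_gaussPotential_ge hp α z (κ * (2 * Real.pi * α) ^ 2) (η * (2 * Real.pi * α))
        (fun x' => by
          have := hshell z hz x'
          linarith)
      simp only [he, hz, if_true]
      rw [gaussPotential_of_mem_shell α hz] at this ⊢
      linarith
    -- Off the shell, `exp(-y) ≥ 1 - y` suffices.
    · have := mean_gaussPotential_ge hp α z 0 0 (fun x' => by
        have := Real.add_one_le_exp (-dispExp α (pt z) (disp p (latEquiv z) x'))
        linarith)
      rw [he0 z hz]
      linarith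

end

/-! ### Low and intermediate temperatures -/

theorem rStar_le : rStar ≤ 11 / 10 :=
  abs_le_of_sq_le_sq' (by nlinarith [rStar_sq_bounds.2]) (by norm_num) |>.2

theorem abs_inner_pt_shell_le {z : ℤ × ℤ} (hz : z ∈ shell) (u : Plane) :
    |inner ℝ (pt z) u| ≤ 11 / 10 * ‖u‖ := by
  refine (abs_real_inner_le_norm _ _).trans ?_
  rw [(norm_pt_eq_rStar_iff z).2 hz]
  exact mul_le_mul_of_nonneg_right rStar_le (norm_nonneg _)

/-- A lower bound for `exp (-(a + b))` with a prescribed fraction of the quadratic term. -/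
theorem exp_neg_add_ge {a b Y t : ℝ} (hY : |a + b| ≤ Y) (ht : 0 < t) :
    1 - (a + b) + (1 - t) / (2 + Y) * a ^ 2 - (1 / t - 1) / (2 + Y) * b ^ 2 ≤
      Real.exp (-(a + b)) := by
  refine le_trans ?_ (exp_neg_ge_pade (a + b))
  have h0 := abs_nonneg (a + b)
  have h1 : (a + b) ^ 2 / (2 + Y) ≤ (a + b) ^ 2 / (2 + |a + b|) := by gcongr
  have h2 : (1 - t) * a ^ 2 - (1 / t - 1) * b ^ 2 ≤ (a + b) ^ 2 := by
    have : 0 ≤ (t * a + b) ^ 2 / t := by positivity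
    have e : (t * a + b) ^ 2 / t = t * a ^ 2 + 2 * a * b + 1 / t * b ^ 2 := by field_simp; ring
    nlinarith
  have h3 : ((1 - t) * a ^ 2 - (1 / t - 1) * b ^ 2) / (2 + Y) ≤ (a + b) ^ 2 / (2 + Y) := by
    have : 0 ≤ Y := h0.trans hY
    gcongr
  rw [sub_div] at h3
  rw [div_mul_eq_mul_div, div_mul_eq_mul_div]
  linarith

section
variable {L : AddSubgroup A2} [L.FiniteIndex] {p : A2 → Plane}

/-- The energy gain at low temperature. -/
theorem energy_gap_of_large (hp : IsPeriodic L p) {α : ℝ} (hα : 100 ≤ α)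
    (hsize : pertSize p ≤ α⁻¹) :
    ((Real.exp (-(Real.pi * α * rStar ^ 2)) * FS L p : ℝ) : EReal) ≤
      gaussEnergy α (perturbedLattice p) - gaussEnergy α (A2 : Set Plane) := by
  have hpx : ∀ x, ‖p x‖ ≤ α⁻¹ := fun x => (hp.norm_le_pertSize x).trans hsize
  have hαinv : α⁻¹ ≤ 1 / 100 := by
    rw [one_div]; exact inv_anti₀ (by norm_num) hα
  have hα0 : 0 < α := by linarith
  have hpi := Real.pi_gt_d2
  have hpi' := Real.pi_lt_d2
  have hr := rStar_sq_bounds.1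
  have hS : 600 ≤ 2 * Real.pi * α * rStar ^ 2 := by nlinarith [mul_pos Real.pi_pos hα0]
  -- Since `α‖u‖ ≤ 2`, the exponent stays below `16`, and `1/36 = (1 - 1/2)/(2 + 16)`. The loss of
  -- quadratic coefficient is harmless as `S ≥ 600`.
  have key := energy_gap_of_shell hp (fun x => (hpx x).trans (by linarith)) (α := α)
    (κ := 1 / 36) (η := 1 / 4) (γ := 1) (by linarith) (by linarith) (by norm_num) ?_
  · refine le_trans ?_ key
    rw [EReal.coe_le_coe_iff]
    refine mul_le_mul_of_nonneg_left ?_ (Real.exp_pos _).le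
    have h1 : 1 ≤ 2 * Real.pi * α * 1 := by nlinarith
    nlinarith [FS_nonneg (L := L) (p := p)]
  · intro z hz x'
    set u := disp p (latEquiv z) x'
    have hu : ‖u‖ ≤ 2 * α⁻¹ := norm_disp_le hpx _ _
    have hi := abs_inner_pt_shell_le hz u
    have hu0 := norm_nonneg u
    have hαu : α * ‖u‖ ≤ 2 := by
      have := mul_le_mul_of_nonneg_left hu hα0.le
      rwa [mul_left_comm, mul_inv_cancel₀ hα0.ne', mul_one] at this
    have hu' : ‖u‖ ≤ 1 / 50 := by linarith
    have hb : Real.pi * α * ‖u‖ ^ 2 ≤ 1 / 5 := by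
      have : Real.pi * (α * ‖u‖) * ‖u‖ ≤ 3.15 * 2 * (1 / 50) := by gcongr
      nlinarith
    have hb0 : 0 ≤ Real.pi * α * ‖u‖ ^ 2 := by positivity
    have ha : |2 * Real.pi * α * inner ℝ (pt z) u| ≤ 14 := by
      rw [abs_mul, abs_of_pos (by positivity : 0 < 2 * Real.pi * α)]
      have h1 : 2 * Real.pi * α * |inner ℝ (pt z) u| ≤ 2 * Real.pi * α * (11 / 10 * ‖u‖) := by
        gcongr
      have h2 : Real.pi * (α * ‖u‖) ≤ 3.15 * 2 := by gcongr
      nlinarith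
    have hY : |2 * Real.pi * α * inner ℝ (pt z) u + Real.pi * α * ‖u‖ ^ 2| ≤ 16 := by
      refine (abs_add_le _ _).trans ?_
      rw [abs_of_nonneg hb0]
      linarith
    have h := exp_neg_add_ge hY (t := 1 / 2) (by norm_num)
    rw [dispExp]
    refine le_trans ?_ h
    nlinarith

/-- The energy gain at intermediate temperatures. -/
theorem energy_gap_of_medium (hp : IsPeriodic L p) {α : ℝ} (hα : α ≤ 100)
    (hS : 21 / 4 ≤ 2 * Real.pi * α * rStar ^ 2) (hsize : pertSize p ≤ 1 / 1000000) :
    ((Real.exp (-400) / 20 * FS L p : ℝ) : EReal) ≤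
      gaussEnergy α (perturbedLattice p) - gaussEnergy α (A2 : Set Plane) := by
  have hpx : ∀ x, ‖p x‖ ≤ 1 / 1000000 := fun x => (hp.norm_le_pertSize x).trans hsize
  have hpi := Real.pi_gt_d2
  have hpi' := Real.pi_lt_d2
  have hr := rStar_sq_bounds.1
  have hr' := rStar_sq_bounds.2
  have hα0 : 0 < α := by
    have h1 : 0 < 2 * Real.pi * rStar ^ 2 := by have := rStar_pos; positivity
    by_contra hα
    nlinarith
  have hs : 2 * Real.pi * α ≤ 630 := by nlinarith
  have hs0 : 0 < 2 * Real.pi * α := by positivity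
  have hs4 : 4 ≤ 2 * Real.pi * α := by nlinarith
  -- Tiny displacements allow `κ` close to the Taylor value `1/2`, which is needed at the crossover:
  -- `12/25 · (21/4)/4 - 3/5 - 1/100 = 1/50`.
  have key := energy_gap_of_shell hp (fun x => (hpx x).trans (by norm_num)) (α := α)
    (κ := 12 / 25) (η := 1 / 100) (γ := 1 / 50) hS (by linarith) (by norm_num) ?_
  · refine le_trans ?_ key
    rw [EReal.coe_le_coe_iff]
    have h1 : Real.exp (-400) ≤ Real.exp (-(Real.pi * α * rStar ^ 2)) := by
      apply Real.exp_le_exp.2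
      have : 2 * Real.pi * α * rStar ^ 2 ≤ 630 * (6 / 5) := by gcongr
      linarith
    have h2 := FS_nonneg (L := L) (p := p)
    calc Real.exp (-400) / 20 * FS L p = Real.exp (-400) * (1 / 20 * FS L p) := by ring
      _ ≤ Real.exp (-(Real.pi * α * rStar ^ 2)) * (2 * Real.pi * α * (1 / 50) * FS L p) := by
        gcongr
        linarith
  · intro z hz x'
    set u := disp p (latEquiv z) x'
    have hu : ‖u‖ ≤ 2 * (1 / 1000000) := norm_disp_le hpx _ _
    have hi := abs_inner_pt_shell_le hz u
    have hu0 := norm_nonneg u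
    have hsu : 2 * Real.pi * α * ‖u‖ ≤ 630 * (2 * (1 / 1000000)) := by gcongr
    have hsu0 : 0 ≤ 2 * Real.pi * α * ‖u‖ := by positivity
    have hb : 2 * Real.pi * α * ‖u‖ ^ 2 ≤ 1 / 10000 := by nlinarith
    have hb0 : 0 ≤ 2 * Real.pi * α * ‖u‖ ^ 2 := by positivity
    have ha : |2 * Real.pi * α * inner ℝ (pt z) u| ≤ 1 / 100 := by
      rw [abs_mul, abs_of_pos hs0]
      have h1 := mul_le_mul_of_nonneg_left hi hs0.le
      linarith
    have hY : |2 * Real.pi * α * inner ℝ (pt z) u + Real.pi * α * ‖u‖ ^ 2| ≤ 1 / 25 := by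
      refine (abs_add_le _ _).trans ?_
      rw [abs_of_nonneg (by linarith : 0 ≤ Real.pi * α * ‖u‖ ^ 2)]
      linarith
    have h := exp_neg_add_ge hY (t := 1 / 50) (by norm_num)
    rw [dispExp]
    refine le_trans ?_ h
    have h3 := sq_nonneg (2 * Real.pi * α * inner ℝ (pt z) u)
    have h4 : (Real.pi * α * ‖u‖ ^ 2) ^ 2 ≤ 1 / 10000 * (2 * Real.pi * α * ‖u‖ ^ 2) := by
      nlinarith
    norm_num
    linarith

end

/-! ### High temperature -/

theorem one_le_latForm {z : ℤ × ℤ} (hz : z ≠ 0) : 1 ≤ latForm z := by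
  have h1 : 0 < latForm z := lt_of_le_of_ne (latForm_nonneg z) fun h => hz (latForm_eq_zero h.symm)
  have e : latForm z = ((z.1 ^ 2 + z.1 * z.2 + z.2 ^ 2 : ℤ) : ℝ) := by
    rw [latForm]; push_cast; ring
  rw [e] at h1 ⊢
  exact_mod_cast h1

/-- A bound for the interaction weighted by powers of the distance, uniform in the temperature. -/
theorem exists_error_bound : ∃ b : ℤ × ℤ → ℝ, Summable b ∧ (∀ z, 0 ≤ b z) ∧
    ∀ S : ℝ, 0 < S → ∀ z, Real.exp (-(S / 2) * latForm z) * ((1 + ‖pt z‖) ^ 3 *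
      max ((z.1 : ℝ) ^ 2) ((z.2 : ℝ) ^ 2)) ≤ b z / S ^ 5 := by
  have h1 : Summable fun n : ℤ => 1 / (1 + (n : ℝ) ^ 2) := by
    refine Summable.of_nonneg_of_le (fun n => by positivity) (fun n => ?_)
      ((Real.summable_one_div_int_pow (p := 2)).2 (by norm_num) |>.add
        (hasSum_ite_eq (0 : ℤ) (1 : ℝ)).summable)
    by_cases hn : n = 0
    · simp [hn]
    · simp only [hn, if_false, add_zero]
      have : (0 : ℝ) < (n : ℝ) ^ 2 := by positivity
      gcongr
      linarith
  refine ⟨fun z => 933120 * (1 / (1 + (z.1 : ℝ) ^ 2) * (1 / (1 + (z.2 : ℝ) ^ 2))),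
    (h1.mul_of_nonneg h1 (fun n => by positivity) (fun n => by positivity)).mul_left _,
    fun z => by positivity, fun S hS z => ?_⟩
  by_cases hz : z = 0
  · simp [hz]; positivity
  set Q := latForm z with hQ
  have hQ1 : 1 ≤ Q := one_le_latForm hz
  -- From `exp x ≥ x⁵/5!` at `x = SQ/2`. The fifth power leaves `Q⁻²` after the polynomial factors,
  -- which is summable.
  have hexp : Real.exp (-(S / 2) * Q) ≤ 3840 / (S * Q) ^ 5 := by
    have h := Real.pow_div_factorial_le_exp (S / 2 * Q) (by positivity) 5
    have e : (S / 2 * Q) ^ 5 / (Nat.factorial 5 : ℝ) = (S * Q) ^ 5 / 3840 := by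
      norm_num [Nat.factorial]; ring
    rw [e] at h
    rw [neg_mul, Real.exp_neg, inv_le_comm₀ (Real.exp_pos _) (by positivity), inv_div]
    exact h
  have hX : (1 + ‖pt z‖) ^ 3 ≤ 20 * Q ^ 2 := by
    have h0 := norm_nonneg (pt z)
    have h2 : ‖pt z‖ ^ 2 ≤ 6 / 5 * Q := by
      rw [norm_pt_sq]; exact mul_le_mul_of_nonneg_right rStar_sq_bounds.2 (by linarith)
    have h3 : (1 + ‖pt z‖) ^ 2 ≤ 22 / 5 * Q := by nlinarith [sq_nonneg (‖pt z‖ - 1)]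
    calc (1 + ‖pt z‖) ^ 3 ≤ (1 + ‖pt z‖) ^ 4 := pow_le_pow_right₀ (by linarith) (by norm_num)
      _ = ((1 + ‖pt z‖) ^ 2) ^ 2 := by ring
      _ ≤ (22 / 5 * Q) ^ 2 := by gcongr
      _ ≤ 20 * Q ^ 2 := by nlinarith
  have hm := max_sq_le_latForm z
  have hm0 : 0 ≤ max ((z.1 : ℝ) ^ 2) ((z.2 : ℝ) ^ 2) := le_max_of_le_left (sq_nonneg _)
  have hden : (1 + (z.1 : ℝ) ^ 2) * (1 + (z.2 : ℝ) ^ 2) ≤ 9 * Q ^ 2 := by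
    have h2 := half_le_latForm z
    have h3 : 1 + (z.1 : ℝ) ^ 2 + (z.2 : ℝ) ^ 2 ≤ 3 * Q := by linarith
    calc (1 + (z.1 : ℝ) ^ 2) * (1 + (z.2 : ℝ) ^ 2) ≤ (1 + (z.1 : ℝ) ^ 2 + (z.2 : ℝ) ^ 2) ^ 2 := by
          nlinarith [sq_nonneg (z.1 : ℝ), sq_nonneg (z.2 : ℝ),
            mul_nonneg (sq_nonneg (z.1 : ℝ)) (sq_nonneg (z.2 : ℝ))]
      _ ≤ (3 * Q) ^ 2 := by gcongr
      _ = 9 * Q ^ 2 := by ring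
  calc Real.exp (-(S / 2) * Q) * ((1 + ‖pt z‖) ^ 3 * max ((z.1 : ℝ) ^ 2) ((z.2 : ℝ) ^ 2))
      ≤ 3840 / (S * Q) ^ 5 * (20 * Q ^ 2 * (4 / 3 * Q)) := by gcongr
    _ = 102400 / (S ^ 5 * Q ^ 2) := by field_simp; norm_num
    _ ≤ 933120 / (S ^ 5 * (9 * Q ^ 2)) := by
      rw [div_le_div_iff₀ (by positivity) (by positivity)]
      have : 0 ≤ S ^ 5 * Q ^ 2 := by positivity
      linarith
    _ ≤ 933120 / (S ^ 5 * ((1 + (z.1 : ℝ) ^ 2) * (1 + (z.2 : ℝ) ^ 2))) := by gcongr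
    _ = _ := by field_simp

theorem summable_dynForm {S : ℝ} (hS : 0 < S) (θ v : ℝ × ℝ) :
    Summable fun z : ℤ × ℤ => Real.exp (-(S / 2) * latForm z) *
      (weight θ z * (3 / 4 * S ^ 2 * latPair z v ^ 2 - S * qf v)) := by
  have hw : ∀ z, |weight θ z| ≤ 2 := fun z => by
    rw [abs_of_nonneg (weight_nonneg θ z), weight]
    linarith [Real.neg_one_le_cos (2 * Real.pi * latPair z θ)]
  refine (((summable_exp_latForm_mul_sq (c := S / 2) (by linarith) v hw).mul_left
    (3 / 4 * S ^ 2)).sub ((summable_exp_latForm_mul (c := S / 2) (by linarith) hw).mul_left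
    (S * qf v))).congr fun z => ?_
  ring

/-- Here `s = 2πα`, `r` is the length of the displacement, `i` its pairing with a lattice point of
length `X`. Every error of third order in `r` gives up one factor `r ≤ 2δ` and keeps `r²`, which
averages to `msd`. -/
theorem exp_neg_cube_ge {s i r X δ : ℝ} (hs : 0 ≤ s) (hX : 0 ≤ X) (hr : 0 ≤ r) (hrδ : r ≤ 2 * δ)
    (hδ : δ ≤ 1 / 4) (hi : |i| ≤ X * r) :
    1 - (s * i + s / 2 * r ^ 2) + s ^ 2 / 2 * i ^ 2 - δ * (s ^ 2 + s ^ 3) * (1 + X) ^ 3 * r ^ 2 ≤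
      Real.exp (-(s * i + s / 2 * r ^ 2)) := by
  refine le_trans ?_ (exp_neg_ge_cubic _)
  have h1 : |s * i + s / 2 * r ^ 2| ≤ s * r * (1 + X) := by
    refine (abs_add_le _ _).trans ?_
    rw [abs_mul, abs_of_nonneg hs, abs_of_nonneg (by positivity : 0 ≤ s / 2 * r ^ 2)]
    have h2 := mul_le_mul_of_nonneg_left hi hs
    have h3 : s / 2 * r ^ 2 ≤ s * r := by
      have : 0 ≤ s * r * (1 - r / 2) := mul_nonneg (mul_nonneg hs hr) (by linarith)
      linarith
    linarith
  have h2 : |s * i + s / 2 * r ^ 2| ^ 3 ≤ (s * r * (1 + X)) ^ 3 := by gcongr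
  have h3 : -(s ^ 2 * r ^ 2 * (X * r)) ≤ s ^ 2 * r ^ 2 * i := by
    have := mul_le_mul_of_nonneg_left (abs_le.1 hi).1 (by positivity : 0 ≤ s ^ 2 * r ^ 2)
    linarith
  have h4 : X ≤ (1 + X) ^ 3 := by
    have := pow_le_pow_right₀ (by linarith : 1 ≤ 1 + X) (by norm_num : 1 ≤ 3)
    rw [pow_one] at this
    linarith
  have h5 : s ^ 2 * r ^ 2 * (X * r) ≤ s ^ 2 * r ^ 2 * ((1 + X) ^ 3 * (2 * δ)) := by gcongr
  have h6 : (s * r * (1 + X)) ^ 3 ≤ s ^ 3 * r ^ 2 * (1 + X) ^ 3 * (2 * δ) := by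
    have : s ^ 3 * r ^ 2 * (1 + X) ^ 3 * r ≤ s ^ 3 * r ^ 2 * (1 + X) ^ 3 * (2 * δ) := by gcongr
    linarith
  have h7 : 0 ≤ (s / 2 * r ^ 2) ^ 2 := sq_nonneg _
  have h8 : 0 ≤ s ^ 3 * r ^ 2 * (1 + X) ^ 3 * (2 * δ) := by
    have : 0 ≤ δ := by linarith
    positivity
  linarith

/-- The energy gain at high temperature. -/
theorem exists_energy_gap_of_small : ∃ C : ℝ, 0 < C ∧ ∀ (L : AddSubgroup A2) (p : A2 → Plane),
    L.FiniteIndex → IsPeriodic L p → ∀ α : ℝ, 0 < α → 2 * Real.pi * α * rStar ^ 2 ≤ 21 / 4 →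
    pertSize p ≤ 1 / 4 →
    (((Real.exp (-(Real.pi / α * rStar ^ 2)) / 200 -
      pertSize p * (C / (2 * Real.pi * α * rStar ^ 2) ^ 3)) * FS L p : ℝ) : EReal) ≤
      gaussEnergy α (perturbedLattice p) - gaussEnergy α (A2 : Set Plane) := by
  obtain ⟨b, hb, hb0, hbound⟩ := exists_error_bound
  refine ⟨7 * (∑' z, b z) + 1, by
    have : 0 ≤ ∑' z, b z := tsum_nonneg hb0
    positivity,
    fun L p hL hp α hα hS hsize => ?_⟩
  set δ := pertSize p with hδ
  have hpx : ∀ x, ‖p x‖ ≤ δ := hp.norm_le_pertSize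
  have hδ0 : 0 ≤ δ := (norm_nonneg _).trans (hpx 0)
  set s := 2 * Real.pi * α with hs
  set S := s * rStar ^ 2 with hSdef
  have hs0 : 0 < s := by positivity
  have hr := rStar_sq_bounds.1
  have hr' := rStar_sq_bounds.2
  have hS0 : 0 < S := by have := rStar_pos; positivity
  have hsS : s ≤ S := by nlinarith
  have hFS := FS_nonneg (L := L) (p := p)
  obtain ⟨J, hJ, θ, ν, hθ, hV, hP, hFSj⟩ := hp.exists_modes_msd
  set f : ℤ × ℤ → ℝ := fun z => Real.exp (-(S / 2) * latForm z) with hf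
  have hfg : ∀ z, gaussPotential α ‖pt z‖ = f z := fun z => gaussPotential_norm_pt' α z
  -- the error terms
  set e : ℤ × ℤ → ℝ := fun z => f z * ((1 + ‖pt z‖) ^ 3 * msd L p z) with he
  have he0 : ∀ z, 0 ≤ e z := fun z => mul_nonneg (Real.exp_pos _).le
    (mul_nonneg (by positivity) (msd_nonneg z))
  have hele : ∀ z, e z ≤ b z * (FS L p / S ^ 5) := by
    intro z
    have h1 := mul_le_mul_of_nonneg_right (hbound S hS0 z) hFS
    have h2 : e z ≤ f z * ((1 + ‖pt z‖) ^ 3 * (max ((z.1 : ℝ) ^ 2) ((z.2 : ℝ) ^ 2) * FS L p)) := by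
      have := hp.msd_le z
      simp only [he]
      have h3 : 0 ≤ f z := (Real.exp_pos _).le
      gcongr
    have e1 : b z * (FS L p / S ^ 5) = b z / S ^ 5 * FS L p := by ring
    rw [e1]
    refine h2.trans (le_trans (le_of_eq ?_) h1)
    ring
  have hesum : Summable e := (hb.mul_right _).of_nonneg_of_le he0 hele
  have hetsum : ∑' z, e z ≤ (∑' z, b z) * (FS L p / S ^ 5) := by
    rw [← tsum_mul_right]
    exact hesum.tsum_le_tsum hele (hb.mul_right _)
  -- the main terms
  have hmain : HasSum (fun z => ∑ j, f z *
      (weight (θ j) z * (3 / 4 * S ^ 2 * latPair z (ν j) ^ 2 - S * qf (ν j))))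
      (∑ j, dynForm S (θ j) (ν j)) :=
    hasSum_sum fun j _ => (summable_dynForm hS0 (θ j) (ν j)).hasSum
  have hsum := hmain.sub (hesum.hasSum.mul_left (δ * (s ^ 2 + s ^ 3)))
  have key := tsum_le_gaussEnergy_sub hp (fun x => (hpx x).trans hsize) hα hsum.summable ?_ ?_
  · rw [hsum.tsum_eq] at key
    refine le_trans ?_ key
    rw [EReal.coe_le_coe_iff]
    -- The dual exponent is the shell exponent at inverse temperature `1/α`, by `r⋆⁴ = 4/3`.
    have hX : 8 * Real.pi ^ 2 / (3 * S) = Real.pi / α * rStar ^ 2 := by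
      rw [hSdef, hs]
      have h4 := rStar_sq_sq
      have hr0 : 0 < rStar ^ 2 := by linarith
      generalize rStar ^ 2 = ρ at h4 hr0 ⊢
      have h5 : Real.pi / α * ρ * (3 * (2 * Real.pi * α * ρ)) = 6 * Real.pi ^ 2 * ρ ^ 2 := by
        field_simp
        ring
      rw [div_eq_iff (by positivity), h5, h4]
      ring
    have hdyn : Real.exp (-(Real.pi / α * rStar ^ 2)) / 200 * FS L p ≤
        ∑ j, dynForm S (θ j) (ν j) := by
      rw [hFSj, Finset.mul_sum]
      refine Finset.sum_le_sum fun j _ => ?_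
      obtain ⟨h1, h2, h3⟩ := hθ j
      have h4 := dynForm_ge hS0 hS (θ j) (ν j) h1 h2 h3
      rw [hX] at h4
      refine le_trans ?_ h4
      have h5 := shellWeight_le (θ j)
      -- The source of the `200`: `2 · 8π² · 6/5 ≤ 200`.
      have h6 : 2 * shellWeight (θ j) * (rStar ^ 2 * qf (ν j)) ≤ 200 * (qf (θ j) * qf (ν j)) := by
        have hq := qf_nonneg (ν j)
        have hq' := qf_nonneg (θ j)
        have hw := shellWeight_nonneg (θ j)
        have hpi : Real.pi ^ 2 ≤ 9.93 := by nlinarith [Real.pi_lt_d2, Real.pi_gt_d2]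
        calc 2 * shellWeight (θ j) * (rStar ^ 2 * qf (ν j))
            ≤ 2 * (8 * Real.pi ^ 2 * qf (θ j)) * (6 / 5 * qf (ν j)) := by gcongr
          _ = 96 / 5 * Real.pi ^ 2 * (qf (θ j) * qf (ν j)) := by ring
          _ ≤ 96 / 5 * 9.93 * (qf (θ j) * qf (ν j)) := by gcongr
          _ ≤ 200 * (qf (θ j) * qf (ν j)) := by
            gcongr; norm_num
      have := mul_le_mul_of_nonneg_left h6 (Real.exp_pos (-(Real.pi / α * rStar ^ 2))).le
      linarith
    have herr : δ * (s ^ 2 + s ^ 3) * ∑' z, e z ≤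
        δ * ((7 * (∑' z, b z) + 1) / S ^ 3) * FS L p := by
      have hB : 0 ≤ ∑' z, b z := tsum_nonneg hb0
      -- Together with the `S⁻⁵` of the error bound this leaves `S⁻³`.
      have h1 : s ^ 2 + s ^ 3 ≤ 7 * S ^ 2 := by
        calc s ^ 2 + s ^ 3 ≤ S ^ 2 + S ^ 3 := by gcongr
          _ = S ^ 2 * (1 + S) := by ring
          _ ≤ S ^ 2 * 7 := by gcongr; linarith
          _ = 7 * S ^ 2 := by ring
      calc δ * (s ^ 2 + s ^ 3) * ∑' z, e z
          ≤ δ * (7 * S ^ 2) * ((∑' z, b z) * (FS L p / S ^ 5)) := by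
            have : 0 ≤ ∑' z, e z := tsum_nonneg he0
            gcongr
        _ = δ * ((7 * (∑' z, b z)) / S ^ 3) * FS L p := by field_simp
        _ ≤ δ * ((7 * (∑' z, b z) + 1) / S ^ 3) * FS L p := by gcongr; linarith
    linarith
  · simp [he, msd_zero, weight, latPair]
  · intro z
    have h1 := mean_gaussPotential_ge hp α z (s ^ 2 / 2) (δ * (s ^ 2 + s ^ 3) * (1 + ‖pt z‖) ^ 3)
      (fun x' => by
        have := exp_neg_cube_ge (s := s) (i := inner ℝ (pt z) (disp p (latEquiv z) x'))
          hs0.le (norm_nonneg (pt z)) (norm_nonneg (disp p (latEquiv z) x'))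
          (norm_disp_le hpx _ _) hsize (abs_real_inner_le_norm _ _)
        have e1 : dispExp α (pt z) (disp p (latEquiv z) x') =
            s * inner ℝ (pt z) (disp p (latEquiv z) x') + s / 2 * ‖disp p (latEquiv z) x'‖ ^ 2 := by
          rw [dispExp, hs]; ring
        rw [e1]
        exact this)
    refine le_trans (le_of_eq ?_) h1
    rw [hfg]
    congr 1
    have hSs : 3 / 4 * S ^ 2 = s ^ 2 := by
      rw [hSdef, mul_pow, rStar_sq_sq]; ring
    have e2 : ∑ j, f z * (weight (θ j) z * (3 / 4 * S ^ 2 * latPair z (ν j) ^ 2 - S * qf (ν j))) =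
        f z * (s ^ 2 / 2 * longMsd L p z - s / 2 * msd L p z) := by
      rw [hV, hP, Finset.mul_sum, Finset.mul_sum, ← Finset.sum_sub_distrib, Finset.mul_sum]
      refine Finset.sum_congr rfl fun j _ => ?_
      rw [hSs, hSdef]
      ring
    rw [e2, he, show Real.pi * α = s / 2 by rw [hs]; ring]
    ring

/-- The exponents are dual, `S X = 8π²/3`, so `exp X ≥ X³/6` suffices. This absorbs the factor `S⁻³`
of the cubic error. -/
theorem exp_neg_dual_le {α : ℝ} (hα : 0 < α) :
    Real.exp (-(Real.pi / α * rStar ^ 2)) ≤ (2 * Real.pi * α * rStar ^ 2) ^ 3 := by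
  have hr : 0 < rStar ^ 2 := by have := rStar_pos; positivity
  set X := Real.pi / α * rStar ^ 2 with hX
  set S := 2 * Real.pi * α * rStar ^ 2 with hS
  have hX0 : 0 < X := by positivity
  have hS0 : 0 < S := by positivity
  have hXS : 26 ≤ S * X := by
    have h4 := rStar_sq_sq
    have e : S * X = 2 * Real.pi ^ 2 * (rStar ^ 2) ^ 2 := by
      rw [hS, hX]; field_simp
    rw [e, h4]
    nlinarith [Real.pi_gt_d2]
  have h := Real.pow_div_factorial_le_exp X hX0.le 3
  have h1 : (26 : ℝ) ^ 3 ≤ (S * X) ^ 3 := by gcongr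
  rw [mul_pow] at h1
  have h2 : S ^ 3 * (X ^ 3 / (Nat.factorial 3 : ℝ)) ≤ S ^ 3 * Real.exp X := by gcongr
  have h3 : 1 ≤ S ^ 3 * Real.exp X := by
    refine le_trans ?_ h2
    norm_num [Nat.factorial]
    linarith
  rw [Real.exp_neg, inv_le_iff_one_le_mul₀ (Real.exp_pos _)]
  exact h3

end Hexagonal

/-! ### Choice of the constants -/

theorem proposition3p1 :
    ∃ αd : ℝ, 0 < αd ∧ ∃ c : ℝ, 0 < c ∧
      ∀ (L : AddSubgroup A2) (p : A2 → Plane), L.FiniteIndex → IsPeriodic L p →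
        (∀ α : ℝ, αd ≤ α → pertSize p ≤ α⁻¹ →
          gaussEnergy α (perturbedLattice p) - gaussEnergy α (A2 : Set Plane) ≥
            ((c * Real.exp (-(Real.pi * α * rStar ^ 2)) * FS L p : ℝ) : EReal)) ∧
        (∃ μ : PSDMeasure, IsSpectralMeasure L p μ) ∧
        (∀ μ : PSDMeasure, IsSpectralMeasure L p μ →
          ∀ α : ℝ, 0 < α → α ≤ αd →
            pertSize p ≤ c * Real.exp (-(2 * Real.pi / α * rStar ^ 2)) →
            gaussEnergy α (perturbedLattice p) - gaussEnergy α (A2 : Set Plane) ≥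
              ((c * Real.exp (-(Real.pi / α * rStar ^ 2)) * SM μ : ℝ) : EReal)) := by
  obtain ⟨C, hC, hsmall⟩ := exists_energy_gap_of_small
  set c : ℝ := min (min (Real.exp (-400) / 20) (1 / 1000000)) (1 / (400 * (C + 1))) with hc
  have hc0 : 0 < c := by
    rw [hc]; positivity
  have hc1 : c ≤ Real.exp (-400) / 20 := (min_le_left _ _).trans (min_le_left _ _)
  have hc2 : c ≤ 1 / 1000000 := (min_le_left _ _).trans (min_le_right _ _)
  have hc3 : c * C ≤ 1 / 400 := by
    have h : c ≤ 1 / (400 * (C + 1)) := min_le_right _ _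
    rw [le_div_iff₀ (by positivity)] at h
    linarith
  refine ⟨100, by norm_num, c, hc0, fun L p hL hp => ⟨fun α hα hsize => ?_,
    hp.exists_isSpectralMeasure, fun μ hμ α hα0 hα hsize => ?_⟩⟩
  · refine le_trans ?_ (energy_gap_of_large hp hα hsize)
    rw [EReal.coe_le_coe_iff, mul_assoc]
    have h := mul_nonneg (Real.exp_pos (-(Real.pi * α * rStar ^ 2))).le (FS_nonneg (L := L) (p := p))
    nlinarith
  · obtain ⟨hSM0, hSM⟩ := SM_bounds hp hμ
    have hFS := FS_nonneg (L := L) (p := p)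
    set X := Real.pi / α * rStar ^ 2 with hX
    have hX0 : 0 ≤ X := by positivity
    have h2X : 2 * Real.pi / α * rStar ^ 2 = X + X := by rw [hX]; ring
    rw [h2X, neg_add, Real.exp_add] at hsize
    have hE0 := Real.exp_pos (-X)
    have hE1 : Real.exp (-X) ≤ 1 := Real.exp_le_one_iff.2 (by linarith)
    have hsize' : pertSize p ≤ c := by
      refine hsize.trans ?_
      have : Real.exp (-X) * Real.exp (-X) ≤ 1 := mul_le_one₀ hE1 hE0.le hE1
      nlinarith
    -- The value `21/4` lies between `24/5`, where the first shell argument starts to work, and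
    -- `16π²/30`, where the dual one stops.
    rcases le_total (21 / 4) (2 * Real.pi * α * rStar ^ 2) with hS | hS
    · refine le_trans ?_ (energy_gap_of_medium hp hα hS (hsize'.trans hc2))
      rw [EReal.coe_le_coe_iff]
      calc c * Real.exp (-X) * SM μ ≤ c * 1 * FS L p := by gcongr
        _ ≤ Real.exp (-400) / 20 * FS L p := by rw [mul_one]; gcongr
    · refine le_trans ?_ (hsmall L p hL hp α hα0 hS (by linarith))
      rw [EReal.coe_le_coe_iff]
      have hdual := exp_neg_dual_le hα0
      rw [← hX] at hdual
      have hS0 : 0 < 2 * Real.pi * α * rStar ^ 2 := by have := rStar_pos; positivity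
      set S := 2 * Real.pi * α * rStar ^ 2
      -- One factor `exp(-X)` of the smallness assumption absorbs `S⁻³`; the other makes the error
      -- half of the gain `exp(-X)/200`.
      have h1 : pertSize p * (C / S ^ 3) ≤ Real.exp (-X) / 400 := by
        have h2 : Real.exp (-X) * (C / S ^ 3) ≤ C := by
          rw [mul_div_assoc', div_le_iff₀ (by positivity)]
          nlinarith
        calc pertSize p * (C / S ^ 3) ≤ c * (Real.exp (-X) * Real.exp (-X)) * (C / S ^ 3) := by
              gcongr
          _ = c * Real.exp (-X) * (Real.exp (-X) * (C / S ^ 3)) := by ring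
          _ ≤ c * Real.exp (-X) * C := by gcongr
          _ = Real.exp (-X) * (c * C) := by ring
          _ ≤ Real.exp (-X) * (1 / 400) := by gcongr
          _ = Real.exp (-X) / 400 := by ring
      calc c * Real.exp (-X) * SM μ ≤ 1 / 400 * Real.exp (-X) * FS L p := by
            gcongr
            linarith
        _ ≤ (Real.exp (-X) / 200 - pertSize p * (C / S ^ 3)) * FS L p := by
          gcongr
          linarith
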